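/- Let $d\ge 1$, let $|\cdot|$ be the $\ell^\infty$ norm on $\mathbb{R}^d$, and take real or complex scalars. A \emph{modulus of continuity} is a strictly increasing $\varphi:[0,1]\to[0,1]$ with $\varphi(0)=0$, $\varphi(1)=1$, $\varphi(t)/t$ non-increasing, and $\int_0^1\varphi(t)\frac{dt}{t}<\infty$. Let $\phi$ and $\psi$ be moduli of continuity, with in addition $\lim_{t\to0}\phi(t)/t=\infty$. Put $\Psi(t)=\int_0^t\psi(s)\frac{ds}{s}$, and for $i,j\in\mathbb{N}=\{0,1,2,\dots\}$ and $t=2^{-\max\{i,j\}}$ let $$\tau(i,j)=\phi(t)^{-d}\,\psi\big(t\,\phi(t)^{-1}\big)\ \text{ if }\min\{i,j\}>0,\qquad \tau(i,j)=\Psi\big(t\,\phi(t)^{-1}\big)\ \text{ if }\min\{i,j\}=0.$$ Assume $\sum_{i,j=0}^\infty\tau(i,j)<\infty$. \emph{Calderón--Zygmund operators.} Let $T$ be a bounded linear operator on $L^2(\mathbb{R}^d)$ with a kernel $K$: on some dense subspace of $L^2(\mathbb{R}^d)$ containing the indicators of all cubes, $Tf(x)=\int K(x,y)f(y)\,dy$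 for a.e. $x\notin\operatorname{supp}f$. Assume that for some constants $C_0,C_\psi$ one has $|K(x,y)|\le C_0|x-y|^{-d}$ for $x\ne y$, and $$|K(x,y)-K(x',y)|+|K(y,x)-K(y,x')|\le\frac{C_\psi}{|x-y|^d}\,\psi\Big(\frac{|x-x'|}{|x-y|}\Big)\quad\text{whenever }|x-y|>2|x-x'|.$$ Let $\|K\|_{CZ_\psi}$ be the smallest admissible $C_\psi\ge0$. \emph{Random dyadic systems.} Let $\Omega=(\{0,1\}^d)^{\mathbb{Z}}$ with the product of the uniform probability measures. For $\omega\in\Omega$ let $\mathscr{D}^\omega=\{I+\sum_{j:2^{-j}<\ell(I)}2^{-j}\omega_j\}$, where $I$ runs over the standard dyadic cubes $2^{-k}([0,1)^d+m)$, $k\in\mathbb{Z}$, $m\in\mathbb{Z}^d$. \emph{Dyadic shifts.} For a cube $I=I_1\times\cdots\times I_d$ and $\eta\in\{0,1\}^d$ let $h_I^\eta=\prod_n h_{I_n}^{\eta_n}(x_n)$, where $h^0_{I_n}=|I_n|^{-1/2}1_{I_n}$, $h^1_{I_n}=|I_n|^{-1/2}(1_{\text{left half}}-1_{\text{right half}})$;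 it is cancellative if $\eta\neq0$. A dyadic shift of parameters $(i,j)$ on $\mathscr{D}^\omega$ is an operator $S=\sum_{K\in\mathscr{D}^\omega}A_K$ on $L^2(\mathbb{R}^d)$ with $$A_Kf=\sum_{\substack{I,J\in\mathscr{D}^\omega;\ I,J\subseteq K\\ \ell(I)=2^{-i}\ell(K),\ \ell(J)=2^{-j}\ell(K)}}\ \sum_{\eta,\eta'\in\{0,1\}^d}a_{IJK}^{\eta\eta'}\langle f,h_I^\eta\rangle h_J^{\eta'},\qquad \sum_{\eta,\eta'}|a_{IJK}^{\eta\eta'}|\le\frac{\sqrt{|I||J|}}{|K|},$$ such that for every $\mathscr{Q}\subseteq\mathscr{D}^\omega$ the series $\sum_{K\in\mathscr{Q}}A_Kf$ converges unconditionally in $L^2$ for each $f \in L^2$ and defines an operator of norm at most $1$ on $L^2(\mathbb{R}^d)$. It is cancellative if $a_{IJK}^{\eta\eta'}=0$ whenever $\eta=0$ or $\eta'=0$. \textbf{Theorem.} There is a constant $c>0$, depending only on $d$ and on the auxiliary modulus $\phi$ (not on $\psi$, $T$, $K$), such that for every $T$ as above there are dyadic shifts $S^{ij}_\omega$ of parameters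 $(i,j)$ on $\mathscr{D}^\omega$ ($\omega\in\Omega$, $i,j\in\mathbb{N}$), all cancellative except possibly $S^{00}_\omega$, such that for all $f,g\in C^1_c(\mathbb{R}^d)$ $$\langle g,Tf\rangle=c\,\big(\|T\|_{L^2\to L^2}+\|K\|_{CZ_\psi}\big)\,\mathbb{E}_\omega\sum_{i,j=0}^\infty\tau(i,j)\langle g,S^{ij}_\omega f\rangle,$$ where the double series converges absolutely for every $\omega$ and its sum is integrable over $\Omega$. -/

import Mathlib

open MeasureTheory Set Filter Topology

noncomputable section

namespace DyadicRep

/-! ### Moduli of continuity -/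

/-- A modulus of continuity on `[0,1]`: strictly increasing, `φ 0 = 0`, `φ 1 = 1`, `φ(t)/t`
decreasing (non-strictly), and the Dini condition `∫₀¹ φ(t) dt/t < ∞`. -/
structure IsModulus (φ : ℝ → ℝ) : Prop where
  strictMono : StrictMonoOn φ (Icc 0 1)
  map_zero : φ 0 = 0
  map_one : φ 1 = 1
  antitone_div : AntitoneOn (fun t => φ t / t) (Ioc 0 1)
  dini : IntegrableOn (fun t => φ t / t) (Ioc 0 1)

/-- `Ψ(t) = ∫₀ᵗ ψ(s) ds/s`. -/
def bigPsi (ψ : ℝ → ℝ) (t : ℝ) : ℝ := ∫ s in (0 : ℝ)..t, ψ s / s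

/-- The coefficients `τ(i,j)`. With `t = 2^{-max(i,j)}`, they are `φ(t)^{-d} ψ(t/φ(t))` if
`min(i,j) > 0`, and `Ψ(t/φ(t))` if `min(i,j) = 0`. -/
def tau (d : ℕ) (φ ψ : ℝ → ℝ) (i j : ℕ) : ℝ :=
  if 0 < min i j then
    (φ ((2 : ℝ)⁻¹ ^ max i j) ^ d)⁻¹ * ψ ((2 : ℝ)⁻¹ ^ max i j / φ ((2 : ℝ)⁻¹ ^ max i j))
  else
    bigPsi ψ ((2 : ℝ)⁻¹ ^ max i j / φ ((2 : ℝ)⁻¹ ^ max i j))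

/-! ### The space `L²(ℝᵈ)` and Calderón–Zygmund operators

`Fin d → ℝ` carries Lebesgue measure and the `ℓ^∞` norm. -/

/-- `L²(ℝᵈ)` with scalars `𝕜` (real or complex). -/
abbrev L2 (𝕜 : Type*) [RCLike 𝕜] (d : ℕ) := Lp 𝕜 2 (volume : Measure (Fin d → ℝ))

/-- The half-open cube with lower corner `a` and side length `l`. -/
def cubeAt {d : ℕ} (a : Fin d → ℝ) (l : ℝ) : Set (Fin d → ℝ) :=
  univ.pi fun i => Ico (a i) (a i + l)

/-- `C` is an admissible constant in the size estimate `|K(x,y)| ≤ C / |x-y|^d`. -/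
def IsSizeBound {𝕜 : Type*} [RCLike 𝕜] {d : ℕ} (K : (Fin d → ℝ) → (Fin d → ℝ) → 𝕜)
    (C : ℝ) : Prop :=
  ∀ x y, x ≠ y → ‖K x y‖ ≤ C / ‖x - y‖ ^ d

/-- `C` is an admissible constant in the regularity estimate with modulus `ψ`. -/
def IsRegularityBound {𝕜 : Type*} [RCLike 𝕜] {d : ℕ} (K : (Fin d → ℝ) → (Fin d → ℝ) → 𝕜)
    (ψ : ℝ → ℝ) (C : ℝ) : Prop :=
  0 ≤ C ∧ ∀ x x' y, 2 * ‖x - x'‖ < ‖x - y‖ →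
    ‖K x y - K x' y‖ + ‖K y x - K y x'‖ ≤ C / ‖x - y‖ ^ d * ψ (‖x - x'‖ / ‖x - y‖)

/-- The smallest admissible constant in the regularity estimate. -/
def czNorm {𝕜 : Type*} [RCLike 𝕜] {d : ℕ} (K : (Fin d → ℝ) → (Fin d → ℝ) → 𝕜)
    (ψ : ℝ → ℝ) : ℝ :=
  sInf {C | IsRegularityBound K ψ C}

/-- `T` is a bounded Calderón–Zygmund operator with kernel `K` and modulus `ψ`: `K` satisfies
the standard estimates, and on some dense subspace of `L²` containing the indicators of all cubes,
`Tf(x) = ∫ K(x,y) f(y) dy` for (almost every) `x` outside the support of `f`. Here `f₀` runs over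
the functions that represent the class `f`. -/
structure IsBoundedCZOperator {𝕜 : Type*} [RCLike 𝕜] {d : ℕ} (ψ : ℝ → ℝ)
    (T : L2 𝕜 d →L[𝕜] L2 𝕜 d) (K : (Fin d → ℝ) → (Fin d → ℝ) → 𝕜) : Prop where
  size : ∃ C, IsSizeBound K C
  regularity : ∃ C, IsRegularityBound K ψ C
  kernel_rep : ∃ F : Submodule 𝕜 (L2 𝕜 d), Dense (F : Set (L2 𝕜 d)) ∧
    (∀ (a : Fin d → ℝ) (l : ℝ), 0 < l →
      ∀ f : L2 𝕜 d, f =ᵐ[volume] (cubeAt a l).indicator (fun _ => (1 : 𝕜)) → f ∈ F) ∧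
    ∀ f ∈ F, ∀ f₀ : (Fin d → ℝ) → 𝕜, f =ᵐ[volume] f₀ →
      ∀ᵐ x, x ∉ tsupport f₀ → T f x = ∫ y, K x y * f₀ y

/-- The class `f ∈ L²` is represented by a `C¹` function with compact support. -/
def IsC1c {𝕜 : Type*} [RCLike 𝕜] {d : ℕ} (f : L2 𝕜 d) : Prop :=
  ∃ f₀ : (Fin d → ℝ) → 𝕜, ContDiff ℝ 1 f₀ ∧ HasCompactSupport f₀ ∧ f =ᵐ[volume] f₀

/-! ### Random dyadic systems -/

/-- The parameter space `Ω = ({0,1}^d)^ℤ`. -/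
abbrev Omega (d : ℕ) := ℤ → Fin d → Fin 2

/-- The natural probability on `Ω`: independent components, uniform on `{0,1}^d`. -/
def prob (d : ℕ) : Measure (Omega d) :=
  Measure.infinitePi fun _ : ℤ => (PMF.uniformOfFintype (Fin d → Fin 2)).toMeasure

/-- The pair `(k, m)` names the standard dyadic cube `2^{-k}([0,1)^d + m)`. It also names the
translated cube `I ∔ ω` in `𝓓^ω`. -/
abbrev DCube (d : ℕ) := ℤ × (Fin d → ℤ)

/-- The side length `2^{-k}`. -/
def side {d : ℕ} (I : DCube d) : ℝ := (2 : ℝ) ^ (-I.1)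

/-- The lower corner of `I ∔ ω = I + ∑_{2^{-j} < ℓ(I)} 2^{-j} ω_j`. -/
def corner {d : ℕ} (ω : Omega d) (I : DCube d) : Fin d → ℝ := fun n =>
  (2 : ℝ) ^ (-I.1) * (I.2 n : ℝ) +
    ∑' j : {j : ℤ // (2 : ℝ) ^ (-j) < side I}, (2 : ℝ) ^ (-(j : ℤ)) * ((ω j n : ℕ) : ℝ)

/-- The cube `I ∔ ω` of the system `𝓓^ω`. -/
def dcube {d : ℕ} (ω : Omega d) (I : DCube d) : Set (Fin d → ℝ) := cubeAt (corner ω I) (side I)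

/-- The cubes `I ⊆ K` of `𝓓^ω` with `ℓ(I) = 2^{-i} ℓ(K)`. -/
def descendants {d : ℕ} (ω : Omega d) (K : DCube d) (i : ℕ) : Set (DCube d) :=
  {I | dcube ω I ⊆ dcube ω K ∧ side I = (2 : ℝ)⁻¹ ^ i * side K}

theorem side_pos {d : ℕ} (I : DCube d) : 0 < side I := zpow_pos (by norm_num) _

theorem descendants_finite {d : ℕ} (ω : Omega d) (K : DCube d) (i : ℕ) :
    (descendants ω K i).Finite := by
  have key : ∀ I ∈ descendants ω K i, I.1 = K.1 + i := by
    rintro I ⟨-, h⟩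
    have h2 : (2 : ℝ) ^ (-I.1) = (2 : ℝ) ^ (-(K.1 + i)) := by
      rw [show (2 : ℝ) ^ (-I.1) = side I from rfl, h, side, neg_add, zpow_add₀ (by norm_num),
        mul_comm]
      simp
    have := zpow_right_injective₀ (by norm_num : (0 : ℝ) < 2) (by norm_num) h2
    omega
  -- all descendants have the same size, hence the same translation vector
  let s : Fin d → ℝ := fun n => corner ω (K.1 + i, fun _ => 0) n
  let δ : ℝ := (2 : ℝ) ^ (-(K.1 + i : ℤ))
  have hδ : 0 < δ := zpow_pos (by norm_num) _
  let lo : Fin d → ℤ := fun n => ⌊(corner ω K n - s n) / δ⌋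
  let hi : Fin d → ℤ := fun n => ⌈(corner ω K n + side K - s n) / δ⌉
  refine ((Set.finite_singleton (K.1 + (i : ℤ))).prod (Set.finite_Icc lo hi)).subset ?_
  rintro ⟨k, m⟩ hI
  have hk : k = K.1 + i := key _ hI
  subst hk
  refine ⟨rfl, ?_⟩
  have hc : corner ω (K.1 + i, m) ∈ dcube ω K := by
    apply hI.1
    intro n _
    exact ⟨le_rfl, lt_add_of_pos_right _ (side_pos _)⟩
  have hcm : ∀ n, corner ω (K.1 + (i : ℤ), m) n = δ * m n + s n := by
    intro n
    simp only [corner, s, δ, side, Int.cast_zero, mul_zero, zero_add]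
  constructor
  · intro n
    have h1 := (hc n trivial).1
    rw [hcm] at h1
    have : (corner ω K n - s n) / δ ≤ m n := by
      rw [div_le_iff₀ hδ]; linarith
    exact_mod_cast (Int.floor_le _).trans this
  · intro n
    have h1 := (hc n trivial).2
    rw [hcm] at h1
    have : (m n : ℝ) ≤ (corner ω K n + side K - s n) / δ := by
      rw [le_div_iff₀ hδ]; linarith
    exact_mod_cast this.trans (Int.le_ceil _)

/-! ### Haar functions -/

/-- The one-dimensional Haar functions on `[a, a+l)`: `η = 0` gives the non-cancellative
`l^{-1/2} 1_{[a,a+l)}`, and `η = 1` gives the cancellative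
`l^{-1/2} (1_{[a,a+l/2)} - 1_{[a+l/2,a+l)})`. -/
def haarOne (η : Fin 2) (a l x : ℝ) : ℝ :=
  (√l)⁻¹ *
    (if η = 0 then (Ico a (a + l)).indicator (fun _ => 1) x
     else (Ico a (a + l / 2)).indicator (fun _ => 1) x
        - (Ico (a + l / 2) (a + l)).indicator (fun _ => 1) x)

/-- The Haar function `h_I^η` on the cube `I ∔ ω`, for `η ∈ {0,1}^d`. It is cancellative iff
`η ≠ 0`. -/
def haarFun {d : ℕ} (ω : Omega d) (I : DCube d) (η : Fin d → Fin 2) (x : Fin d → ℝ) : ℝ :=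
  ∏ n, haarOne (η n) (corner ω I n) (side I) (x n)

theorem memLp_haarOne (η : Fin 2) (a l : ℝ) : MemLp (haarOne η a l) 2 volume := by
  have h : ∀ b c : ℝ, MemLp ((Ico b c).indicator (fun _ => (1 : ℝ))) 2 volume := fun b c =>
    memLp_indicator_const 2 measurableSet_Ico 1 (Or.inr (by simp))
  unfold haarOne
  split_ifs
  · exact (h a (a + l)).const_mul _
  · exact ((h a (a + l / 2)).sub (h (a + l / 2) (a + l))).const_mul _

theorem memLp_haarFun (𝕜 : Type*) [RCLike 𝕜] {d : ℕ} (ω : Omega d) (I : DCube d)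
    (η : Fin d → Fin 2) :
    MemLp (fun x => (haarFun ω I η x : 𝕜)) 2 (volume : Measure (Fin d → ℝ)) := by
  have hmeas : ∀ n, Measurable (haarOne (η n) (corner ω I n) (side I)) := by
    intro n
    unfold haarOne
    split_ifs
    · exact (measurable_const.indicator measurableSet_Ico).const_mul _
    · exact ((measurable_const.indicator measurableSet_Ico).sub
        (measurable_const.indicator measurableSet_Ico)).const_mul _
  have hm : Measurable (haarFun ω I η) :=
    Finset.measurable_prod _ fun n _ => (hmeas n).comp (measurable_pi_apply n)
  have : MemLp (haarFun ω I η) 2 (volume : Measure (Fin d → ℝ)) := by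
    rw [memLp_two_iff_integrable_sq hm.aestronglyMeasurable]
    have hint := Integrable.fintype_prod (μ := fun _ : Fin d => (volume : Measure ℝ))
      (f := fun n t => haarOne (η n) (corner ω I n) (side I) t ^ 2)
      fun n => (memLp_two_iff_integrable_sq (hmeas n).aestronglyMeasurable).1
        (memLp_haarOne _ _ _)
    simpa [haarFun, Finset.prod_pow, volume_pi] using hint
  exact this.ofReal

/-- `h_I^η` as an element of `L²(ℝᵈ)`. -/
def haar (𝕜 : Type*) [RCLike 𝕜] {d : ℕ} (ω : Omega d) (I : DCube d) (η : Fin d → Fin 2) :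
    L2 𝕜 d :=
  (memLp_haarFun 𝕜 ω I η).toLp _

/-! ### Dyadic shifts -/

/-- Coefficients `a_{IJK}`, with the summation over the types `η`, `η'` of `h_I` and `h_J` made
explicit: `a I J K η η'`. -/
abbrev ShiftCoeff (𝕜 : Type*) (d : ℕ) :=
  DCube d → DCube d → DCube d → (Fin d → Fin 2) → (Fin d → Fin 2) → 𝕜

/-- The averaging operator
`A_K f = ∑_{I,J ⊆ K, ℓ(I) = 2^{-i}ℓ(K), ℓ(J) = 2^{-j}ℓ(K)} ∑_{η,η'} a_{IJK}^{ηη'} ⟨f,h_I^η⟩ h_J^{η'}`.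
Since `h_I^η` is real, `⟨f,h_I^η⟩ = ∫ f h_I^η` is `inner 𝕜 h_I^η f`. -/
def averagingOp {𝕜 : Type*} [RCLike 𝕜] {d : ℕ} (ω : Omega d) (i j : ℕ) (a : ShiftCoeff 𝕜 d)
    (K : DCube d) (f : L2 𝕜 d) : L2 𝕜 d :=
  ∑ I ∈ (descendants_finite ω K i).toFinset, ∑ J ∈ (descendants_finite ω K j).toFinset,
    ∑ η : Fin d → Fin 2, ∑ η' : Fin d → Fin 2,
      (a I J K η η' * inner 𝕜 (haar 𝕜 ω I η) f) • haar 𝕜 ω J η'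

/-- `S` is the (normalized) dyadic shift on `𝓓^ω` with parameters `(i,j)` and coefficients `a`.
* `bound` is `|a_{IJK}| ≤ √(|I||J|)/|K|`, for the total size of the coefficients over all types;
  this gives each single coefficient the same bound, and `|A_K f| ≤ 1_K ⨍_K |f|`.
* `subshift`: every subfamily `Q` of `𝓓^ω` defines an operator `S_Q = ∑_{K ∈ Q} A_K` on `L²`
  of norm at most one.
* `sum`: `S f = ∑_K A_K f`.
The series converge unconditionally in `L²`. -/
structure IsDyadicShift {𝕜 : Type*} [RCLike 𝕜] {d : ℕ} (ω : Omega d) (i j : ℕ)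
    (a : ShiftCoeff 𝕜 d) (S : L2 𝕜 d →L[𝕜] L2 𝕜 d) : Prop where
  bound : ∀ K, ∀ I ∈ descendants ω K i, ∀ J ∈ descendants ω K j,
    ∑ η : Fin d → Fin 2, ∑ η' : Fin d → Fin 2, ‖a I J K η η'‖ ≤
      √(side I ^ d * side J ^ d) / side K ^ d
  subshift : ∀ Q : Set (DCube d), ∃ SQ : L2 𝕜 d →L[𝕜] L2 𝕜 d, ‖SQ‖ ≤ 1 ∧
    ∀ f, HasSum (fun K : Q => averagingOp ω i j a K f) (SQ f)
  sum : ∀ f, HasSum (fun K => averagingOp ω i j a K f) (S f)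

/-- Only cancellative Haar functions `h_I`, `h_J` occur. -/
def ShiftCoeff.IsCancellative {𝕜 : Type*} [RCLike 𝕜] {d : ℕ} (a : ShiftCoeff 𝕜 d) : Prop :=
  ∀ I J K η η', η = 0 ∨ η' = 0 → a I J K η η' = 0

end DyadicRep

end

/-! For a fixed system `𝓓^ω` let E_k be the orthogonal projection onto functions constant on the
cubes of generation k (`condExpGen`), and D_k = E_{k+1} - E_k (`diffGen`). The increment of ⟨E_k g,
T E_k f⟩ from k to k+1 equals ⟨D_k g, T(E_k f + D_k f / 2)⟩ plus the conjugate of the same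
expression with T replaced by its adjoint and f, g exchanged (`genForm_add_conj`). Since E_k f tends
to f as k → ∞ and to 0 as k → -∞, the increments add up to ⟨g, Tf⟩. The hypotheses are stable under
adjoints, so it suffices to treat the first expression. It yields the shifts with i ≤ j, and the
adjoint yields those with i ≥ j.

Let J, Q be cubes of one generation and h_J a cancellative Haar function. Write ⟨h_Q^0, f⟩ = ⟨h_J^0,
f⟩ + (⟨h_Q^0, f⟩ - ⟨h_J^0, f⟩) in E_k f. The first summand, added over Q, is a paraproduct with the
coefficients ⟨h_J, T1⟩ (`paraB`). The rest is one contribution `pairTerm` for each pair J, Q. If J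
and Q have a common ancestor P, the difference of averages is a sum over cancellative Haar functions
of the ancestors of Q and of J up to P, because the remainders at P cancel
(`inner_haar_zero_telescope`, `pairWeight_mul_pairTerm`). All cubes involved then lie in P, as a
shift requires.

Randomness supplies the common ancestor. A relative position m = Q - J is given the number N =
`ancGen φ m` of generations, the least N ≥ 1 with 2d|m| ≤ φ(2^{-N})2^N. The expected ℓ¹ distance of
N-th ancestors is exactly 2^{-N} times that of the cubes (`lintegral_ancDist`), so J and Q share
their N-th ancestor with probability at least 1/2. The event depends on the levels up to k of ω,
while the pair contribution depends on the levels above k. Multiplying the contribution by the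
indicator of the event over its probability therefore does not change the expectation
(`integral_commonWeight_mul`), and costs a factor of at most 2.

Kernel regularity gives |⟨h_J, T h_Q⟩| ≲ |m|^{-d} ψ(1/|m|) (`WeakCZ.norm_inner_haar_le_decay`), and
minimality of N gives 1/|m| ≲ 2^{-N}/φ(2^{-N}). Thus a single entry is at most a multiple of 2^{-dN}
τ, and counting the cubes Q in I gives the normalized coefficient size for i > 0. For i = 0 the
entries of all positions with `ancGen` at least j are added up, and Dini summation over dyadic
shells of m produces Ψ in place of ψ.

Cancellative shifts are bounded by a Hilbert–Schmidt estimate inside each cube and orthogonality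
between cubes (`shiftBd_of_isCancellative`). The paraproduct is bounded by Carleson embedding,
proved with a Bellman function. Its Carleson condition is Bessel's inequality for a local substitute
of T1 (`WeakCZ.exists_inner_eq_paraB`). All sums are interchanged by dominated convergence: any set
of generations gives a subshift of norm ≲ τ(i,j), and τ is summable. -/

noncomputable section

namespace DyadicRep

/-! ### Geometry of the dyadic systems -/

section Geometry

variable {d : ℕ}

/-- The translation of the cubes of side length `2^{-k}` in `𝓓^ω`. -/
def shiftVec (ω : Omega d) (k : ℤ) : Fin d → ℝ := fun n =>
  ∑' l : ℕ, (2 : ℝ) ^ (-(k + 1 + l)) * ((ω (k + 1 + l) n : ℕ) : ℝ)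

theorem two_zpow_pos (k : ℤ) : (0 : ℝ) < 2 ^ k := zpow_pos (by norm_num) k

/-- The levels j with 2^{-j} < 2^{-k} are exactly k+1+l with l ∈ ℕ. So all cubes of generation k are
translated by one vector, which depends only on the levels above k of ω. -/
theorem corner_apply (ω : Omega d) (k : ℤ) (p : Fin d → ℤ) (n : Fin d) :
    corner ω (k, p) n = (2 : ℝ) ^ (-k) * p n + shiftVec ω k n := by
  unfold corner shiftVec
  congr 1
  let e : ℕ ≃ {j : ℤ // (2 : ℝ) ^ (-j) < side ((k, p) : DCube d)} :=
    { toFun := fun l => ⟨k + 1 + l, by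
        unfold side
        apply zpow_lt_zpow_right₀ (by norm_num)
        simp only; omega⟩
      invFun := fun j => (j.1 - k - 1).toNat
      left_inv := fun l => by simp only; omega
      right_inv := fun j => by
        have h := j.2
        unfold side at h
        have := (zpow_lt_zpow_iff_right₀ (by norm_num : (1 : ℝ) < 2)).1 h
        ext
        simp only at this ⊢
        omega }
  exact (e.tsum_eq (fun j => (2 : ℝ) ^ (-(j : ℤ)) * ((ω j n : ℕ) : ℝ))).symm

theorem bit_le_one (b : Fin 2) : ((b : ℕ) : ℝ) ≤ 1 := by
  exact_mod_cast Nat.lt_succ_iff.1 b.2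

theorem shiftVec_term_le (ω : Omega d) (k : ℤ) (n : Fin d) (l : ℕ) :
    (2 : ℝ) ^ (-(k + 1 + l)) * ((ω (k + 1 + l) n : ℕ) : ℝ) ≤ 2 ^ (-k) / 2 / 2 ^ l := by
  have h : (2 : ℝ) ^ (-(k + 1 + l)) = 2 ^ (-k) / 2 / 2 ^ l := by
    rw [neg_add, neg_add, zpow_add₀ (by norm_num), zpow_add₀ (by norm_num)]
    simp [div_eq_mul_inv]
  rw [← h]
  exact mul_le_of_le_one_right (two_zpow_pos _).le (bit_le_one _)

theorem shiftVec_term_nonneg (ω : Omega d) (k : ℤ) (n : Fin d) (l : ℕ) :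
    0 ≤ (2 : ℝ) ^ (-(k + 1 + l)) * ((ω (k + 1 + l) n : ℕ) : ℝ) :=
  mul_nonneg (two_zpow_pos _).le (Nat.cast_nonneg _)

theorem summable_shiftVec (ω : Omega d) (k : ℤ) (n : Fin d) :
    Summable fun l : ℕ => (2 : ℝ) ^ (-(k + 1 + l)) * ((ω (k + 1 + l) n : ℕ) : ℝ) :=
  Summable.of_nonneg_of_le (shiftVec_term_nonneg ω k n) (shiftVec_term_le ω k n)
    (summable_geometric_two' _)

theorem shiftVec_nonneg (ω : Omega d) (k : ℤ) (n : Fin d) : 0 ≤ shiftVec ω k n :=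
  tsum_nonneg (shiftVec_term_nonneg ω k n)

theorem shiftVec_le (ω : Omega d) (k : ℤ) (n : Fin d) : shiftVec ω k n ≤ 2 ^ (-k) := by
  rw [← tsum_geometric_two' ((2 : ℝ) ^ (-k))]
  exact (summable_shiftVec ω k n).tsum_le_tsum (shiftVec_term_le ω k n)
    (summable_geometric_two' _)

/-- Splitting off level k+1. This recursion is what makes consecutive generations nested. -/
theorem shiftVec_eq_add (ω : Omega d) (k : ℤ) (n : Fin d) :
    shiftVec ω k n = 2 ^ (-(k + 1)) * ((ω (k + 1) n : ℕ) : ℝ) + shiftVec ω (k + 1) n := by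
  unfold shiftVec
  rw [(summable_shiftVec ω k n).tsum_eq_zero_add]
  congr 1
  · simp
  · refine tsum_congr fun l => ?_
    rw [show k + 1 + ((l + 1 : ℕ) : ℤ) = k + 1 + 1 + l by push_cast; ring]

theorem measurable_shiftVec (k : ℤ) : Measurable fun ω : Omega d => shiftVec ω k := by
  refine measurable_pi_lambda _ fun n => ?_
  have hlim : ∀ ω : Omega d, Tendsto (fun N : ℕ => ∑ l ∈ Finset.range N,
      (2 : ℝ) ^ (-(k + 1 + l)) * ((ω (k + 1 + l) n : ℕ) : ℝ)) atTop (𝓝 (shiftVec ω k n)) :=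
    fun ω => (summable_shiftVec ω k n).hasSum.tendsto_sum_nat
  refine measurable_of_tendsto_metrizable (fun N => ?_) (tendsto_pi_nhds.2 hlim)
  refine Finset.measurable_sum _ fun l _ => ?_
  refine Measurable.const_mul ?_ _
  have h1 : Measurable fun ω : Omega d => ω (k + 1 + l) n :=
    (measurable_pi_apply n).comp (measurable_pi_apply (k + 1 + (l : ℤ)))
  exact (measurable_of_finite fun b : Fin 2 => ((b : ℕ) : ℝ)).comp h1

/-- The child of `K` in `𝓓^ω` in the position `ε`. -/
def child (ω : Omega d) (K : DCube d) (ε : Fin d → Fin 2) : DCube d :=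
  (K.1 + 1, fun n => 2 * K.2 n + ((ω (K.1 + 1) n : ℕ) : ℤ) + ((ε n : ℕ) : ℤ))

/-- The dyadic parent of `I` in `𝓓^ω`. -/
def parent (ω : Omega d) (I : DCube d) : DCube d :=
  (I.1 - 1, fun n => (I.2 n - ((ω I.1 n : ℕ) : ℤ)) / 2)

/-- The `N`-th dyadic ancestor of `I` in `𝓓^ω`. -/
def anc (ω : Omega d) (N : ℕ) (I : DCube d) : DCube d := (parent ω)^[N] I

@[simp] theorem anc_zero (ω : Omega d) (I : DCube d) : anc ω 0 I = I := rfl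

theorem anc_succ (ω : Omega d) (N : ℕ) (I : DCube d) :
    anc ω (N + 1) I = parent ω (anc ω N I) := Function.iterate_succ_apply' _ _ _

theorem anc_succ' (ω : Omega d) (N : ℕ) (I : DCube d) :
    anc ω (N + 1) I = anc ω N (parent ω I) := Function.iterate_succ_apply _ _ _

theorem anc_add (ω : Omega d) (M N : ℕ) (I : DCube d) :
    anc ω (M + N) I = anc ω M (anc ω N I) := Function.iterate_add_apply _ _ _ _

theorem anc_fst (ω : Omega d) (N : ℕ) (I : DCube d) : (anc ω N I).1 = I.1 - N := by
  induction N with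
  | zero => simp
  | succ N ih => rw [anc_succ]; simp only [parent, ih]; push_cast; ring

@[simp] theorem parent_child (ω : Omega d) (K : DCube d) (ε : Fin d → Fin 2) :
    parent ω (child ω K ε) = K := by
  unfold parent child
  ext n
  · simp
  · have := (ε n).2
    simp only
    omega

theorem exists_child_eq (ω : Omega d) (I : DCube d) : ∃ ε, child ω (parent ω I) ε = I := by
  refine ⟨fun n => ⟨((I.2 n - ((ω I.1 n : ℕ) : ℤ)) % 2).toNat, by omega⟩, ?_⟩
  unfold parent child
  ext n
  · simp
  · simp only [sub_add_cancel]
    omega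

theorem child_injective (ω : Omega d) (K : DCube d) : Function.Injective (child ω K) := by
  intro ε ε' h
  ext n
  have := congrFun (congrArg Prod.snd h) n
  simp only [child] at this
  omega

theorem parent_eq_iff (ω : Omega d) (I K : DCube d) :
    parent ω I = K ↔ ∃ ε, child ω K ε = I := by
  constructor
  · rintro rfl
    exact exists_child_eq ω I
  · rintro ⟨ε, rfl⟩
    exact parent_child ω K ε

theorem side_eq (I : DCube d) : side I = (2 : ℝ) ^ (-I.1) := rfl

theorem side_parent (ω : Omega d) (I : DCube d) : side (parent ω I) = 2 * side I := by
  simp only [side_eq, parent]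
  rw [show -(I.1 - 1) = -I.1 + 1 by ring, zpow_add₀ (by norm_num)]
  ring

theorem side_child (ω : Omega d) (K : DCube d) (ε) : side (child ω K ε) = side K / 2 := by
  have := side_parent ω (child ω K ε)
  rw [parent_child] at this
  linarith

/-- The bit ω_{k+1} in the index of `child` compensates for the part of the translation that
generation k has and generation k+1 lacks. What remains is the usual subdivision of a cube into
halves. -/
theorem corner_child (ω : Omega d) (K : DCube d) (ε : Fin d → Fin 2) (n : Fin d) :
    corner ω (child ω K ε) n = corner ω K n + side K / 2 * ((ε n : ℕ) : ℝ) := by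
  obtain ⟨k, p⟩ := K
  unfold child
  rw [corner_apply, corner_apply, shiftVec_eq_add ω k]
  have h : (2 : ℝ) ^ (-k) = 2 * 2 ^ (-(k + 1)) := by
    rw [show -k = -(k + 1) + 1 by ring, zpow_add₀ (by norm_num)]
    ring
  simp only [side_eq]
  rw [h]
  push_cast
  ring

theorem mem_dcube {ω : Omega d} {I : DCube d} {x : Fin d → ℝ} :
    x ∈ dcube ω I ↔ ∀ n, corner ω I n ≤ x n ∧ x n < corner ω I n + side I := by
  simp [dcube, cubeAt, Set.mem_pi]

theorem corner_mem_dcube (ω : Omega d) (I : DCube d) : corner ω I ∈ dcube ω I :=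
  mem_dcube.2 fun _ => ⟨le_rfl, lt_add_of_pos_right _ (side_pos _)⟩

theorem dcube_child_subset (ω : Omega d) (K : DCube d) (ε : Fin d → Fin 2) :
    dcube ω (child ω K ε) ⊆ dcube ω K := by
  intro x hx
  rw [mem_dcube] at hx ⊢
  intro n
  have h := hx n
  rw [corner_child, side_child] at h
  have h0 : (0 : ℝ) ≤ ((ε n : ℕ) : ℝ) := Nat.cast_nonneg _
  have h1 := bit_le_one (ε n)
  have h2 := side_pos K
  constructor <;> nlinarith

theorem dcube_subset_anc (ω : Omega d) (N : ℕ) (I : DCube d) :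
    dcube ω I ⊆ dcube ω (anc ω N I) := by
  induction N with
  | zero => rfl
  | succ N ih =>
    rw [anc_succ]
    obtain ⟨ε, hε⟩ := exists_child_eq ω (anc ω N I)
    refine ih.trans ?_
    conv_lhs => rw [← hε]
    exact dcube_child_subset ω _ ε

/-- Cubes of one generation share their translation, so a common point forces each pair of integer
coordinates to differ by less than 1. -/
theorem eq_of_mem_dcube {ω : Omega d} {I J : DCube d} (h : I.1 = J.1) {x : Fin d → ℝ}
    (hI : x ∈ dcube ω I) (hJ : x ∈ dcube ω J) : I = J := by
  obtain ⟨k, p⟩ := I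
  obtain ⟨k', q⟩ := J
  obtain rfl : k = k' := h
  ext n
  · rfl
  · have h1 := mem_dcube.1 hI n
    have h2 := mem_dcube.1 hJ n
    rw [corner_apply] at h1 h2
    simp only [side_eq] at h1 h2
    have hp := two_zpow_pos (-k)
    have a1 : (p n : ℝ) < q n + 1 := by
      by_contra! hc
      nlinarith
    have a2 : (q n : ℝ) < p n + 1 := by
      by_contra! hc
      nlinarith
    have b1 : p n < q n + 1 := by exact_mod_cast a1
    have b2 : q n < p n + 1 := by exact_mod_cast a2
    show p n = q n
    omega

/-- Passes from inclusion of sets to the index arithmetic of `anc`. From here on nesting is handled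
combinatorially. -/
theorem mem_descendants {ω : Omega d} {K I : DCube d} {i : ℕ} :
    I ∈ descendants ω K i ↔ anc ω i I = K := by
  constructor
  · rintro ⟨h1, h2⟩
    have h3 : I.1 = K.1 + i := by
      have h4 : (2 : ℝ) ^ (-I.1) = (2 : ℝ) ^ (-(K.1 + i)) := by
        rw [← side_eq, h2, side, neg_add, zpow_add₀ (by norm_num), mul_comm]
        simp
      have := zpow_right_injective₀ (by norm_num : (0 : ℝ) < 2) (by norm_num) h4
      omega
    refine eq_of_mem_dcube (by rw [anc_fst]; omega)
      (dcube_subset_anc ω i I (corner_mem_dcube ω I)) (h1 (corner_mem_dcube ω I))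
  · rintro rfl
    refine ⟨dcube_subset_anc ω i I, ?_⟩
    simp only [side_eq, anc_fst]
    rw [neg_sub, sub_eq_add_neg, zpow_add₀ (by norm_num)]
    simp

/-- The cubes `I ⊆ K` of `𝓓^ω` with `ℓ(I) = 2^{-i} ℓ(K)`, as a finite set. -/
def desc (ω : Omega d) (K : DCube d) (i : ℕ) : Finset (DCube d) :=
  (descendants_finite ω K i).toFinset

@[simp] theorem mem_desc {ω : Omega d} {K I : DCube d} {i : ℕ} :
    I ∈ desc ω K i ↔ anc ω i I = K := by
  simp [desc, mem_descendants]

theorem desc_zero (ω : Omega d) (K : DCube d) : desc ω K 0 = {K} := by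
  ext I; simp

theorem sum_desc_succ {M : Type*} [AddCommMonoid M] (ω : Omega d) (K : DCube d) (i : ℕ)
    (F : DCube d → M) :
    ∑ I ∈ desc ω K (i + 1), F I = ∑ ε, ∑ I ∈ desc ω (child ω K ε) i, F I := by
  classical
  rw [← Finset.sum_biUnion]
  · congr 1
    ext I
    simp only [mem_desc, Finset.mem_biUnion, Finset.mem_univ, true_and]
    rw [anc_succ, parent_eq_iff]
    exact exists_congr fun ε => eq_comm
  · intro ε _ ε' _ hne
    refine Finset.disjoint_left.2 fun I h1 h2 => hne ?_
    rw [mem_desc] at h1 h2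
    exact child_injective ω K (h1.symm.trans h2)

theorem sum_desc_add {M : Type*} [AddCommMonoid M] (ω : Omega d) (K : DCube d) (i r : ℕ)
    (F : DCube d → M) :
    ∑ Q ∈ desc ω K (i + r), F Q = ∑ I ∈ desc ω K i, ∑ Q ∈ desc ω I r, F Q := by
  classical
  rw [← Finset.sum_biUnion]
  · congr 1
    ext Q
    simp [anc_add]
  · intro I _ I' _ hne
    refine Finset.disjoint_left.2 fun Q h1 h2 => hne ?_
    rw [mem_desc] at h1 h2
    exact h1.symm.trans h2

theorem card_desc (ω : Omega d) (K : DCube d) (i : ℕ) :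
    (desc ω K i).card = (2 ^ d) ^ i := by
  induction i generalizing K with
  | zero => simp [desc_zero]
  | succ i ih =>
    rw [Finset.card_eq_sum_ones, sum_desc_succ]
    simp_rw [← Finset.card_eq_sum_ones, ih]
    simp [pow_succ, mul_comm]

end Geometry


/-! ### Haar functions in `L²` -/

section Haar

variable {𝕜 : Type*} [RCLike 𝕜] {d : ℕ}

theorem measurableSet_cubeAt (a : Fin d → ℝ) (l : ℝ) : MeasurableSet (cubeAt a l) :=
  MeasurableSet.univ_pi fun _ => measurableSet_Ico

theorem volume_cubeAt (a : Fin d → ℝ) (l : ℝ) : volume (cubeAt a l) = ENNReal.ofReal l ^ d := by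
  simp [cubeAt, volume_pi_pi]

theorem volume_cubeAt_ne_top (a : Fin d → ℝ) (l : ℝ) : volume (cubeAt a l) ≠ ⊤ := by
  rw [volume_cubeAt]
  exact ENNReal.pow_ne_top ENNReal.ofReal_ne_top

theorem volume_real_cubeAt (a : Fin d → ℝ) {l : ℝ} (hl : 0 ≤ l) :
    volume.real (cubeAt a l) = l ^ d := by
  simp [measureReal_def, volume_cubeAt, ENNReal.toReal_ofReal hl]

/-- The indicator of a cube as an element of `L²`. -/
def ind (𝕜 : Type*) [RCLike 𝕜] {d : ℕ} (a : Fin d → ℝ) (l : ℝ) : L2 𝕜 d :=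
  indicatorConstLp 2 (measurableSet_cubeAt a l) (volume_cubeAt_ne_top a l) (1 : 𝕜)

theorem ind_coeFn (a : Fin d → ℝ) (l : ℝ) :
    ind 𝕜 a l =ᵐ[volume] (cubeAt a l).indicator fun _ => (1 : 𝕜) :=
  indicatorConstLp_coeFn

theorem inner_ind (a : Fin d → ℝ) (l : ℝ) (f : L2 𝕜 d) :
    inner 𝕜 (ind 𝕜 a l) f = ∫ x in cubeAt a l, f x :=
  L2.inner_indicatorConstLp_one (measurableSet_cubeAt a l) (volume_cubeAt_ne_top a l) f

theorem inner_ind_ind (a b : Fin d → ℝ) (l l' : ℝ) :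
    inner 𝕜 (ind 𝕜 a l) (ind 𝕜 b l') = (volume.real (cubeAt a l ∩ cubeAt b l') : 𝕜) := by
  unfold ind
  rw [L2.inner_indicatorConstLp_indicatorConstLp (measurableSet_cubeAt a l)
    (measurableSet_cubeAt b l') (volume_cubeAt_ne_top a l) (volume_cubeAt_ne_top b l')]
  simp [RCLike.real_smul_eq_coe_mul]

theorem norm_ind (a : Fin d → ℝ) {l : ℝ} (hl : 0 ≤ l) : ‖ind 𝕜 a l‖ = √(l ^ d) := by
  rw [@norm_eq_sqrt_re_inner 𝕜, inner_ind_ind, inter_self, volume_real_cubeAt a hl, RCLike.ofReal_re]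

/-- Translations act continuously on L². This is the source of measurability in ω: the Haar
functions become continuous functions of the translation vector. -/
theorem continuous_ind (l : ℝ) : Continuous fun a : Fin d → ℝ => ind 𝕜 a l := by
  have h : (fun a : Fin d → ℝ => ind 𝕜 a l) =
      fun a : Fin d → ℝ => (DomAddAct.mk (-a) +ᵥ ind 𝕜 (0 : Fin d → ℝ) l : L2 𝕜 d) := by
    funext a
    unfold ind
    rw [DomAddAct.mk_vadd_indicatorConstLp]
    congr 1
    ext x
    simp only [cubeAt, Set.mem_pi, mem_univ, true_imp_iff, mem_Ico, mem_preimage, vadd_eq_add,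
      Pi.add_apply, Pi.neg_apply, Pi.zero_apply, zero_add]
    refine forall_congr' fun n => and_congr ?_ ?_ <;> constructor <;> intro h <;> linarith
  rw [h]
  have h2 : Continuous fun a : Fin d → ℝ => DomAddAct.mk (-a) :=
    DomAddAct.continuous_mk.comp continuous_neg
  have : Fact ((2 : ENNReal) ≠ ⊤) := ⟨by norm_num⟩
  exact h2.vadd continuous_const

/-- The height of the normalized indicator of a cube. -/
def amp (I : DCube d) : ℝ := (√(side I))⁻¹ ^ d

theorem amp_pos (I : DCube d) : 0 < amp I := by
  have := side_pos I
  unfold amp; positivity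

theorem amp_sq_mul (I : DCube d) : amp I ^ 2 * side I ^ d = 1 := by
  have := side_pos I
  unfold amp
  rw [← pow_mul, mul_comm d 2, pow_mul, inv_pow, Real.sq_sqrt this.le, ← mul_pow,
    inv_mul_cancel₀ this.ne', one_pow]

theorem haarFun_zero (ω : Omega d) (I : DCube d) (x : Fin d → ℝ) :
    haarFun ω I 0 x = amp I * (dcube ω I).indicator (fun _ => 1) x := by
  unfold haarFun haarOne amp
  simp only [Pi.zero_apply, if_true, Finset.prod_mul_distrib, Finset.prod_const, Finset.card_univ,
    Fintype.card_fin]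
  congr 1
  by_cases hx : x ∈ dcube ω I
  · rw [indicator_of_mem hx]
    refine Finset.prod_eq_one fun n _ => ?_
    rw [indicator_of_mem]
    exact mem_dcube.1 hx n
  · rw [indicator_of_notMem hx]
    rw [mem_dcube] at hx
    push Not at hx
    obtain ⟨n, hn⟩ := hx
    refine Finset.prod_eq_zero (Finset.mem_univ n) ?_
    rw [indicator_of_notMem]
    rintro ⟨h1, h2⟩
    linarith [hn h1]

theorem haar_zero (ω : Omega d) (I : DCube d) :
    haar 𝕜 ω I 0 = (amp I : 𝕜) • ind 𝕜 (corner ω I) (side I) := by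
  ext1
  filter_upwards [(memLp_haarFun 𝕜 ω I 0).coeFn_toLp,
    Lp.coeFn_smul (amp I : 𝕜) (ind 𝕜 (corner ω I) (side I)), ind_coeFn (𝕜 := 𝕜) (corner ω I) (side I)]
    with x h1 h2 h3
  rw [haar, h1, h2, Pi.smul_apply, h3, haarFun_zero, dcube]
  by_cases hx : x ∈ cubeAt (corner ω I) (side I) <;> simp [hx]

/-- The sign of `h^η` on the child in the position `ε`. -/
def haarSign (η ε : Fin d → Fin 2) : ℝ := ∏ n, if η n = 1 ∧ ε n = 1 then -1 else 1

theorem haarSign_sq (η ε : Fin d → Fin 2) : haarSign η ε * haarSign η ε = 1 := by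
  unfold haarSign
  rw [← Finset.prod_mul_distrib]
  refine Finset.prod_eq_one fun n _ => ?_
  split_ifs <;> norm_num

theorem abs_haarSign (η ε : Fin d → Fin 2) : |haarSign η ε| = 1 := by
  have h := haarSign_sq η ε
  rw [← abs_mul_abs_self] at h
  nlinarith [abs_nonneg (haarSign η ε)]

theorem haarSign_zero (ε : Fin d → Fin 2) : haarSign 0 ε = 1 := by
  simp [haarSign]

theorem haarSign_comm (η ε : Fin d → Fin 2) : haarSign η ε = haarSign ε η := by
  simp only [haarSign, and_comm]

/-- The signs are the characters of (ℤ/2)^d, and the sum over ε factors into one-dimensional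
character sums. -/
theorem sum_haarSign (η η' : Fin d → Fin 2) :
    ∑ ε, haarSign η ε * haarSign η' ε = if η = η' then 2 ^ d else 0 := by
  have h : ∀ ε, haarSign η ε * haarSign η' ε =
      ∏ n, ((if η n = 1 ∧ ε n = 1 then (-1 : ℝ) else 1) *
        (if η' n = 1 ∧ ε n = 1 then -1 else 1)) := fun ε => by
    rw [haarSign, haarSign, Finset.prod_mul_distrib]
  simp_rw [h]
  have h2 := Finset.prod_univ_sum (fun _ : Fin d => (Finset.univ : Finset (Fin 2)))
    (fun n b => (if η n = 1 ∧ b = 1 then (-1 : ℝ) else 1) * (if η' n = 1 ∧ b = 1 then -1 else 1))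
  rw [Fintype.piFinset_univ] at h2
  rw [← h2]
  have h3 : ∀ n, ∑ b : Fin 2, (if η n = 1 ∧ b = 1 then (-1 : ℝ) else 1) *
      (if η' n = 1 ∧ b = 1 then -1 else 1) = if η n = η' n then 2 else 0 := by
    intro n
    rw [Fin.sum_univ_two]
    generalize η n = u
    generalize η' n = v
    fin_cases u <;> fin_cases v <;> norm_num
  simp_rw [h3]
  split_ifs with hη
  · subst hη; simp
  · obtain ⟨n, hn⟩ := Function.ne_iff.1 hη
    exact Finset.prod_eq_zero (Finset.mem_univ n) (if_neg hn)

/-- A Haar function of either type is a signed combination of the normalized indicators of the two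
halves. The factor 1/√2 is the ratio of their heights. -/
theorem haarOne_eq_sum (η : Fin 2) (a x : ℝ) {l : ℝ} (hl : 0 < l) :
    haarOne η a l x = ∑ b : Fin 2, (√2)⁻¹ * (if η = 1 ∧ b = 1 then -1 else 1) *
      haarOne 0 (a + l / 2 * ((b : ℕ) : ℝ)) (l / 2) x := by
  rw [Fin.sum_univ_two]
  unfold haarOne
  have hs : (√l)⁻¹ = (√2)⁻¹ * (√(l / 2))⁻¹ := by
    rw [← mul_inv, ← Real.sqrt_mul (by norm_num)]
    congr 2; ring
  have e1 : a + l / 2 + l / 2 = a + l := by ring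
  rw [hs]
  simp only [if_true, Fin.val_zero, Nat.cast_zero, mul_zero, add_zero, Fin.val_one, Nat.cast_one,
    mul_one, e1]
  have key : (Ico a (a + l)).indicator (fun _ => (1 : ℝ)) x =
      (Ico a (a + l / 2)).indicator (fun _ => 1) x +
        (Ico (a + l / 2) (a + l)).indicator (fun _ => 1) x := by
    rw [← Ico_union_Ico_eq_Ico (b := a + l / 2) (by linarith) (by linarith),
      indicator_union_of_disjoint]
    rw [Set.disjoint_left]
    rintro y ⟨_, h1⟩ ⟨h2, _⟩
    linarith
  fin_cases η
  · simp only [Fin.zero_eta, if_true, key]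
    norm_num
    ring
  · norm_num
    ring

theorem haarFun_eq_sum (ω : Omega d) (K : DCube d) (η : Fin d → Fin 2) (x : Fin d → ℝ) :
    haarFun ω K η x =
      ∑ ε, (√2)⁻¹ ^ d * haarSign η ε * haarFun ω (child ω K ε) 0 x := by
  unfold haarFun
  simp_rw [fun n => haarOne_eq_sum (η n) (corner ω K n) (x n) (side_pos K)]
  rw [Finset.prod_univ_sum, Fintype.piFinset_univ]
  refine Finset.sum_congr rfl fun ε _ => ?_
  rw [Finset.prod_mul_distrib, Finset.prod_mul_distrib, Finset.prod_const, haarSign]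
  simp [corner_child, side_child]

theorem coeFn_finset_sum_smul_toLp {ι : Type*} (s : Finset ι) (c : ι → 𝕜)
    (f : ι → (Fin d → ℝ) → 𝕜) (hf : ∀ i, MemLp (f i) 2 volume) :
    (∑ i ∈ s, c i • (hf i).toLp (f i) : L2 𝕜 d) =ᵐ[volume] fun x => ∑ i ∈ s, c i * f i x := by
  classical
  induction s using Finset.induction_on with
  | empty =>
    simp only [Finset.sum_empty]
    exact Lp.coeFn_zero 𝕜 2 volume
  | insert i s his ih =>
    rw [Finset.sum_insert his]
    filter_upwards [Lp.coeFn_add (c i • (hf i).toLp (f i)) (∑ i ∈ s, c i • (hf i).toLp (f i)), ih,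
      Lp.coeFn_smul (c i) ((hf i).toLp (f i)), (hf i).coeFn_toLp] with x h1 h2 h3 h4
    rw [h1, Pi.add_apply, h2, h3, Pi.smul_apply, h4, Finset.sum_insert his, smul_eq_mul]

theorem haar_eq_sum (ω : Omega d) (K : DCube d) (η : Fin d → Fin 2) :
    haar 𝕜 ω K η =
      ∑ ε, (((√2)⁻¹ ^ d * haarSign η ε : ℝ) : 𝕜) • haar 𝕜 ω (child ω K ε) 0 := by
  ext1
  filter_upwards [(memLp_haarFun 𝕜 ω K η).coeFn_toLp,
    coeFn_finset_sum_smul_toLp Finset.univ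
      (fun ε => (((√2)⁻¹ ^ d * haarSign η ε : ℝ) : 𝕜)) _
      (fun ε => memLp_haarFun 𝕜 ω (child ω K ε) 0)] with x h1 h2
  unfold haar
  rw [h1, h2, haarFun_eq_sum]
  push_cast
  rfl

theorem inner_haar_zero_zero (ω : Omega d) {I J : DCube d} (h : I.1 = J.1) :
    inner 𝕜 (haar 𝕜 ω I 0) (haar 𝕜 ω J 0) = if I = J then 1 else 0 := by
  rw [haar_zero, haar_zero, inner_smul_left, inner_smul_right, inner_ind_ind]
  split_ifs with hIJ
  · subst hIJ
    rw [inter_self, volume_real_cubeAt _ (side_pos I).le, RCLike.conj_ofReal, ← mul_assoc,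
      ← pow_two]
    exact_mod_cast amp_sq_mul I
  · have : cubeAt (corner ω I) (side I) ∩ cubeAt (corner ω J) (side J) = ∅ := by
      by_contra hne
      obtain ⟨x, hx⟩ := Set.nonempty_iff_ne_empty.2 hne
      exact hIJ (eq_of_mem_dcube h hx.1 hx.2)
    simp [this]

/-- The Haar function `h_I^η` as a function of the translation of the cubes of its generation. -/
def haarAt (𝕜 : Type*) [RCLike 𝕜] {d : ℕ} (I : DCube d) (η : Fin d → Fin 2) (s : Fin d → ℝ) :
    L2 𝕜 d :=
  ∑ ε : Fin d → Fin 2, (((√2)⁻¹ ^ d * haarSign η ε * (√(side I / 2))⁻¹ ^ d : ℝ) : 𝕜) •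
    ind 𝕜 (fun n => (2 : ℝ) ^ (-I.1) * I.2 n + s n + side I / 2 * ((ε n : ℕ) : ℝ)) (side I / 2)

theorem continuous_haarAt (I : DCube d) (η : Fin d → Fin 2) : Continuous (haarAt 𝕜 I η) := by
  refine continuous_finsetSum _ fun ε _ => ?_
  have h : Continuous fun s : Fin d → ℝ => ind 𝕜
      (fun n => (2 : ℝ) ^ (-I.1) * I.2 n + s n + side I / 2 * ((ε n : ℕ) : ℝ)) (side I / 2) :=
    (continuous_ind _).comp (by fun_prop)
  exact (continuous_const_smul (Γ := 𝕜) _).comp h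

/-- The Haar functions of generation k see ω only through `shiftVec ω k`, that is, through the
levels above k. This is one side of the independence argument. -/
theorem haar_eq_haarAt (ω : Omega d) (I : DCube d) (η : Fin d → Fin 2) :
    haar 𝕜 ω I η = haarAt 𝕜 I η (shiftVec ω I.1) := by
  rw [haar_eq_sum, haarAt]
  refine Finset.sum_congr rfl fun ε _ => ?_
  rw [haar_zero, smul_smul, amp, side_child]
  push_cast
  congr 2
  funext n
  rw [corner_child]
  congr 1
  exact corner_apply ω I.1 I.2 n

end Haar


/-! ### Orthogonality relations of the Haar functions -/

section Algebra

variable {𝕜 : Type*} [RCLike 𝕜] {d : ℕ}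

/-- The ratio `2^{-d/2}` of the heights of normalized indicators of consecutive generations. -/
def ratio (d : ℕ) : ℝ := (√2)⁻¹ ^ d

theorem ratio_pos (d : ℕ) : 0 < ratio d := by unfold ratio; positivity

theorem ratio_sq (d : ℕ) : ratio d * ratio d = (2 ^ d)⁻¹ := by
  unfold ratio
  rw [← mul_pow, ← mul_inv, Real.mul_self_sqrt (by norm_num), inv_pow]

theorem ratio_mul_ratio_mul (d : ℕ) (b c : ℝ) :
    ratio d * b * (ratio d * c) = ratio d * ratio d * (b * c) := by ring

theorem ratio_sq_mul (d : ℕ) : ratio d * ratio d * 2 ^ d = 1 := by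
  rw [ratio_sq, inv_mul_cancel₀ (by positivity)]

/-- The cancellative types of Haar functions. -/
def cancTypes (d : ℕ) : Finset (Fin d → Fin 2) := Finset.univ.erase 0

@[simp] theorem mem_cancTypes {η : Fin d → Fin 2} : η ∈ cancTypes d ↔ η ≠ 0 := by
  simp [cancTypes]

theorem sum_univ_eq_add_cancTypes {M : Type*} [AddCommMonoid M] (F : (Fin d → Fin 2) → M) :
    ∑ η, F η = F 0 + ∑ η ∈ cancTypes d, F η :=
  (Finset.add_sum_erase Finset.univ F (Finset.mem_univ 0)).symm

theorem card_cancTypes_le (d : ℕ) : (cancTypes d).card ≤ 2 ^ d := by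
  refine (Finset.card_le_univ _).trans ?_
  simp

theorem haar_eq_sum_child (ω : Omega d) (K : DCube d) (η : Fin d → Fin 2) :
    haar 𝕜 ω K η = ∑ ε, ((ratio d * haarSign η ε : ℝ) : 𝕜) • haar 𝕜 ω (child ω K ε) 0 :=
  haar_eq_sum ω K η

/-- The matrix of signs times `ratio d` is orthogonal and symmetric in η and ε, so it inverts
itself. -/
theorem haar_child_eq_sum (ω : Omega d) (K : DCube d) (ε : Fin d → Fin 2) :
    haar 𝕜 ω (child ω K ε) 0 = ∑ η, ((ratio d * haarSign η ε : ℝ) : 𝕜) • haar 𝕜 ω K η := by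
  simp_rw [haar_eq_sum_child ω K, Finset.smul_sum, smul_smul]
  rw [Finset.sum_comm]
  simp_rw [← Finset.sum_smul]
  rw [Finset.sum_eq_single ε]
  · have : ∑ η, ((ratio d * haarSign η ε : ℝ) : 𝕜) * ((ratio d * haarSign η ε : ℝ) : 𝕜) = 1 := by
      have h : ∑ η : Fin d → Fin 2, (ratio d * haarSign η ε) * (ratio d * haarSign η ε) = 1 := by
        simp_rw [ratio_mul_ratio_mul, haarSign_sq]
        rw [Finset.sum_const, Finset.card_univ, nsmul_eq_mul, mul_one, mul_comm]
        simpa using ratio_sq_mul d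
      exact_mod_cast h
    rw [this, one_smul]
  · intro ε' _ hne
    have : ∑ η, ((ratio d * haarSign η ε : ℝ) : 𝕜) * ((ratio d * haarSign η ε' : ℝ) : 𝕜) = 0 := by
      have h : ∑ η : Fin d → Fin 2, (ratio d * haarSign η ε) * (ratio d * haarSign η ε') = 0 := by
        simp_rw [ratio_mul_ratio_mul, haarSign_comm _ ε, haarSign_comm _ ε']
        rw [← Finset.mul_sum, sum_haarSign, if_neg hne.symm, mul_zero]
      exact_mod_cast h
    rw [this, zero_smul]
  · simp

theorem inner_haar_haar_same (ω : Omega d) {I J : DCube d} (h : I.1 = J.1)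
    (η η' : Fin d → Fin 2) :
    inner 𝕜 (haar 𝕜 ω I η) (haar 𝕜 ω J η') = if I = J ∧ η = η' then 1 else 0 := by
  rw [haar_eq_sum_child ω I, haar_eq_sum_child ω J, sum_inner]
  simp_rw [inner_sum, inner_smul_left, inner_smul_right, RCLike.conj_ofReal]
  have h2 : ∀ ε ε', inner 𝕜 (haar 𝕜 ω (child ω I ε) 0) (haar 𝕜 ω (child ω J ε') 0) =
      if I = J ∧ ε = ε' then (1 : 𝕜) else 0 := by
    intro ε ε'
    rw [inner_haar_zero_zero ω (by simp [child, h])]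
    congr 1
    refine propext ⟨fun hc => ?_, ?_⟩
    · have hIJ : I = J := by
        rw [← parent_child ω I ε, hc, parent_child]
      subst hIJ
      exact ⟨rfl, child_injective ω I hc⟩
    · rintro ⟨rfl, rfl⟩
      rfl
  simp_rw [h2]
  by_cases hIJ : I = J
  · simp only [hIJ, true_and, mul_ite, mul_one, mul_zero, Finset.sum_ite_eq, Finset.mem_univ,
      if_true]
    have h : ∑ ε : Fin d → Fin 2, (ratio d * haarSign η ε) * (ratio d * haarSign η' ε) =
        if η = η' then 1 else 0 := by
      simp_rw [ratio_mul_ratio_mul]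
      rw [← Finset.mul_sum, sum_haarSign]
      split_ifs
      · exact ratio_sq_mul d
      · simp
    have h3 := congrArg (RCLike.ofReal : ℝ → 𝕜) h
    push_cast at h3 ⊢
    simpa using h3
  · simp [hIJ]

theorem norm_haar (ω : Omega d) (I : DCube d) (η : Fin d → Fin 2) : ‖haar 𝕜 ω I η‖ = 1 := by
  rw [@norm_eq_sqrt_re_inner 𝕜, inner_haar_haar_same ω rfl]
  simp

/-- The coarser indicator is split into children until it reaches the generation of `K`, where
different types or different cubes are orthogonal. -/
theorem inner_haar_zero_of_le (ω : Omega d) {M K : DCube d} (h : M.1 ≤ K.1)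
    {η : Fin d → Fin 2} (hη : η ≠ 0) :
    inner 𝕜 (haar 𝕜 ω M 0) (haar 𝕜 ω K η) = 0 := by
  obtain ⟨n, hn⟩ : ∃ n : ℕ, K.1 = M.1 + n := ⟨(K.1 - M.1).toNat, by omega⟩
  clear h
  induction n generalizing M with
  | zero =>
    rw [inner_haar_haar_same ω (by simpa using hn.symm), if_neg]
    rintro ⟨-, h⟩
    exact hη h.symm
  | succ n ih =>
    rw [haar_eq_sum_child ω M, sum_inner]
    refine Finset.sum_eq_zero fun ε _ => ?_
    rw [inner_smul_left, ih, mul_zero]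
    simp only [child]
    push_cast at hn ⊢
    omega

theorem inner_haar_of_lt (ω : Omega d) {M K : DCube d} (h : M.1 < K.1)
    {η : Fin d → Fin 2} (hη : η ≠ 0) (η' : Fin d → Fin 2) :
    inner 𝕜 (haar 𝕜 ω M η') (haar 𝕜 ω K η) = 0 := by
  rw [haar_eq_sum_child ω M, sum_inner]
  refine Finset.sum_eq_zero fun ε _ => ?_
  rw [inner_smul_left, inner_haar_zero_of_le ω _ hη, mul_zero]
  simp only [child]
  omega

/-- The cancellative Haar functions are orthonormal. -/
theorem orthonormal_haar (ω : Omega d) :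
    Orthonormal 𝕜 fun x : DCube d × {η : Fin d → Fin 2 // η ≠ 0} => haar 𝕜 ω x.1 x.2.1 := by
  refine ⟨fun x => norm_haar ω _ _, ?_⟩
  rintro ⟨I, η, hη⟩ ⟨J, η', hη'⟩ hne
  rcases lt_trichotomy I.1 J.1 with h | h | h
  · exact inner_haar_of_lt ω h hη' η
  · show inner 𝕜 (haar 𝕜 ω I η) (haar 𝕜 ω J η') = 0
    rw [inner_haar_haar_same ω h, if_neg]
    rintro ⟨rfl, rfl⟩
    exact hne rfl
  · exact inner_eq_zero_symm.1 (inner_haar_of_lt ω h hη η')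

/-- All Haar functions of one generation are orthonormal. -/
theorem orthonormal_haar_gen (ω : Omega d) (k : ℤ) :
    Orthonormal 𝕜 fun x : (Fin d → ℤ) × (Fin d → Fin 2) => haar 𝕜 ω (k, x.1) x.2 := by
  refine ⟨fun x => norm_haar ω _ _, ?_⟩
  rintro ⟨p, η⟩ ⟨q, η'⟩ hne
  show inner 𝕜 (haar 𝕜 ω (k, p) η) (haar 𝕜 ω (k, q) η') = 0
  rw [inner_haar_haar_same ω (show ((k, p) : DCube d).1 = ((k, q) : DCube d).1 from rfl), if_neg]
  rintro ⟨h, rfl⟩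
  simp only [Prod.mk.injEq, true_and] at h
  exact hne (by rw [h])

theorem orthonormal_haar_zero (ω : Omega d) (k : ℤ) :
    Orthonormal 𝕜 fun p : Fin d → ℤ => haar 𝕜 ω (k, p) 0 :=
  (orthonormal_haar_gen ω k).comp (fun p => (p, 0)) fun _ _ h => congrArg Prod.fst h

theorem haar_zero_eq_sum_desc (ω : Omega d) (M : DCube d) (r : ℕ) :
    haar 𝕜 ω M 0 = ∑ Q ∈ desc ω M r, ((ratio d ^ r : ℝ) : 𝕜) • haar 𝕜 ω Q 0 := by
  induction r generalizing M with
  | zero => simp [desc_zero]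
  | succ r ih =>
    rw [sum_desc_succ, haar_eq_sum_child ω M 0]
    refine Finset.sum_congr rfl fun ε _ => ?_
    rw [ih, Finset.smul_sum]
    refine Finset.sum_congr rfl fun Q _ => ?_
    rw [smul_smul, haarSign_zero, pow_succ]
    push_cast
    rw [mul_one, mul_comm]

theorem inner_haar_zero_anc (ω : Omega d) (Q : DCube d) (r : ℕ) {M : DCube d}
    (h : M.1 = Q.1 - r) :
    inner 𝕜 (haar 𝕜 ω Q 0) (haar 𝕜 ω M 0) = if anc ω r Q = M then ((ratio d ^ r : ℝ) : 𝕜) else 0 := by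
  rw [haar_zero_eq_sum_desc ω M r, inner_sum]
  have h1 : ∀ Q' ∈ desc ω M r, inner 𝕜 (haar 𝕜 ω Q 0) (((ratio d ^ r : ℝ) : 𝕜) • haar 𝕜 ω Q' 0) =
      if Q = Q' then ((ratio d ^ r : ℝ) : 𝕜) else 0 := by
    intro Q' hQ'
    have h2 : Q'.1 - r = M.1 := by rw [← anc_fst ω r Q', mem_desc.1 hQ']
    rw [inner_smul_right, inner_haar_zero_zero ω (by omega)]
    simp
  rw [Finset.sum_congr rfl h1, Finset.sum_ite_eq]
  simp only [mem_desc]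

/-- Only the child of the ancestor that contains `Q` contributes, and the Haar function is constant
there. Hence a power of `ratio d` times one sign. -/
theorem inner_haar_anc_succ (ω : Omega d) (Q : DCube d) (r : ℕ) (η ε : Fin d → Fin 2)
    (hε : child ω (anc ω (r + 1) Q) ε = anc ω r Q) :
    inner 𝕜 (haar 𝕜 ω Q 0) (haar 𝕜 ω (anc ω (r + 1) Q) η) =
      ((ratio d ^ (r + 1) * haarSign η ε : ℝ) : 𝕜) := by
  rw [haar_eq_sum_child ω (anc ω (r + 1) Q), inner_sum, Finset.sum_eq_single ε]
  · rw [inner_smul_right, hε, inner_haar_zero_anc ω Q r (anc_fst ω r Q), if_pos rfl, pow_succ]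
    push_cast
    ring
  · intro ε' _ hne
    rw [inner_smul_right, inner_haar_zero_anc ω Q r, if_neg, mul_zero]
    · rw [← hε]
      exact fun hc => hne (child_injective ω _ hc).symm
    · simp only [child, anc_fst]
      push_cast
      ring
  · simp

theorem norm_inner_haar_anc (ω : Omega d) (Q : DCube d) (r : ℕ) (η : Fin d → Fin 2) :
    ‖(inner 𝕜 (haar 𝕜 ω Q 0) (haar 𝕜 ω (anc ω (r + 1) Q) η) : 𝕜)‖ = ratio d ^ (r + 1) := by
  obtain ⟨ε, hε⟩ := exists_child_eq ω (anc ω r Q)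
  rw [← anc_succ] at hε
  rw [inner_haar_anc_succ ω Q r η ε hε, RCLike.norm_ofReal, abs_mul, abs_haarSign, mul_one,
    abs_of_pos (pow_pos (ratio_pos d) _)]

/-- Expansion of an average over the cancellative Haar functions of the ancestors. -/
theorem inner_haar_zero_telescope (ω : Omega d) (Q : DCube d) (N : ℕ) (f : L2 𝕜 d) :
    inner 𝕜 (haar 𝕜 ω Q 0) f =
      ∑ r ∈ Finset.range N, ∑ η ∈ cancTypes d,
        inner 𝕜 (haar 𝕜 ω Q 0) (haar 𝕜 ω (anc ω (r + 1) Q) η) *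
          inner 𝕜 (haar 𝕜 ω (anc ω (r + 1) Q) η) f +
      ((ratio d ^ N : ℝ) : 𝕜) * inner 𝕜 (haar 𝕜 ω (anc ω N Q) 0) f := by
  induction N with
  | zero => simp
  | succ N ih =>
    rw [ih, Finset.sum_range_succ, add_assoc]
    congr 1
    obtain ⟨ε, hε⟩ := exists_child_eq ω (anc ω N Q)
    rw [← anc_succ] at hε
    conv_lhs => rw [← hε, haar_child_eq_sum, sum_univ_eq_add_cancTypes]
    simp_rw [fun η => inner_haar_anc_succ (𝕜 := 𝕜) ω Q N η ε hε]
    rw [inner_add_left, sum_inner, mul_add, Finset.mul_sum, add_comm]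
    congr 1
    · refine Finset.sum_congr rfl fun η _ => ?_
      rw [inner_smul_left, RCLike.conj_ofReal, pow_succ]
      push_cast
      ring
    · rw [inner_smul_left, RCLike.conj_ofReal, haarSign_zero, pow_succ]
      push_cast
      ring

/-- The Haar functions of a cube and the indicators of its children have the same span. -/
theorem sum_child_inner_smul (ω : Omega d) (K : DCube d) (f : L2 𝕜 d) :
    ∑ ε, inner 𝕜 (haar 𝕜 ω (child ω K ε) 0) f • haar 𝕜 ω (child ω K ε) 0 =
      ∑ η, inner 𝕜 (haar 𝕜 ω K η) f • haar 𝕜 ω K η := by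
  conv_rhs =>
    enter [2, η]
    rw [haar_eq_sum_child ω K η, Finset.smul_sum]
  rw [Finset.sum_comm]
  refine Finset.sum_congr rfl fun ε _ => ?_
  simp_rw [smul_smul]
  rw [← Finset.sum_smul]
  congr 1
  conv_lhs => rw [haar_child_eq_sum, sum_inner]
  refine Finset.sum_congr rfl fun η _ => ?_
  rw [← haar_eq_sum_child, inner_smul_left, RCLike.conj_ofReal, mul_comm]

end Algebra


/-! ### Bessel's inequality and the Carleson embedding theorem -/

section Carleson

variable {𝕜 : Type*} [RCLike 𝕜] {d : ℕ}

theorem norm_sq_sum_smul_orthonormal {ι : Type*} {v : ι → L2 𝕜 d} (hv : Orthonormal 𝕜 v)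
    (s : Finset ι) (c : ι → 𝕜) : ‖∑ i ∈ s, c i • v i‖ ^ 2 = ∑ i ∈ s, ‖c i‖ ^ 2 := by
  have h := hv.inner_sum c c s
  have h2 := inner_self_eq_norm_sq_to_K (𝕜 := 𝕜) (∑ i ∈ s, c i • v i)
  rw [h] at h2
  simp_rw [RCLike.conj_mul] at h2
  exact_mod_cast h2.symm

theorem norm_sq_sum_haar (ω : Omega d) (s : Finset (DCube d))
    (c : DCube d → (Fin d → Fin 2) → 𝕜) :
    ‖∑ J ∈ s, ∑ η ∈ cancTypes d, c J η • haar 𝕜 ω J η‖ ^ 2 =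
      ∑ J ∈ s, ∑ η ∈ cancTypes d, ‖c J η‖ ^ 2 := by
  have h := norm_sq_sum_smul_orthonormal (orthonormal_haar (𝕜 := 𝕜) ω)
    (s ×ˢ (Finset.univ : Finset {η : Fin d → Fin 2 // η ≠ 0})) fun x => c x.1 x.2.1
  rw [Finset.sum_product, Finset.sum_product] at h
  have e1 : ∀ J, ∑ η ∈ cancTypes d, c J η • haar 𝕜 ω J η =
      ∑ η : {η : Fin d → Fin 2 // η ≠ 0}, c J η • haar 𝕜 ω J η := fun J =>
    Finset.sum_subtype _ (fun _ => mem_cancTypes) _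
  have e2 : ∀ J, ∑ η ∈ cancTypes d, ‖c J η‖ ^ 2 =
      ∑ η : {η : Fin d → Fin 2 // η ≠ 0}, ‖c J η‖ ^ 2 := fun J =>
    Finset.sum_subtype _ (fun _ => mem_cancTypes) _
  simp_rw [e1, e2]
  exact h

theorem sum_inner_haar_sq_le (ω : Omega d) (s : Finset (DCube d)) (f : L2 𝕜 d) :
    ∑ J ∈ s, ∑ η ∈ cancTypes d, ‖(inner 𝕜 (haar 𝕜 ω J η) f : 𝕜)‖ ^ 2 ≤ ‖f‖ ^ 2 := by
  have h := (orthonormal_haar (𝕜 := 𝕜) ω).sum_inner_products_le f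
    (s := s ×ˢ (Finset.univ : Finset {η : Fin d → Fin 2 // η ≠ 0}))
  rw [Finset.sum_product] at h
  refine le_trans (le_of_eq ?_) h
  refine Finset.sum_congr rfl fun J _ => ?_
  exact Finset.sum_subtype _ (fun _ => mem_cancTypes) _

theorem sum_inner_haar_zero_sq_le (ω : Omega d) (s : Finset (DCube d)) {k : ℤ}
    (hs : ∀ J ∈ s, J.1 = k) (f : L2 𝕜 d) :
    ∑ J ∈ s, ‖(inner 𝕜 (haar 𝕜 ω J 0) f : 𝕜)‖ ^ 2 ≤ ‖f‖ ^ 2 := by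
  have h := (orthonormal_haar_zero (𝕜 := 𝕜) ω k).sum_inner_products_le f
    (s := s.image Prod.snd)
  rw [Finset.sum_image] at h
  · refine le_trans (le_of_eq (Finset.sum_congr rfl fun J hJ => ?_)) h
    rw [← hs J hJ]
  · intro I hI J hJ hIJ
    exact Prod.ext ((hs I hI).trans (hs J hJ).symm) hIJ

/-- The Carleson sums of `α` below the cube `K`, down to `n` generations. -/
def carlesonSum (ω : Omega d) (α : DCube d → ℝ) (n : ℕ) (K : DCube d) : ℝ :=
  ∑ l ∈ Finset.range (n + 1), ((2 : ℝ) ^ d)⁻¹ ^ l * ∑ J ∈ desc ω K l, α J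

theorem carlesonSum_zero (ω : Omega d) (α : DCube d → ℝ) (K : DCube d) :
    carlesonSum ω α 0 K = α K := by
  simp [carlesonSum, desc_zero]

theorem carlesonSum_succ (ω : Omega d) (α : DCube d → ℝ) (n : ℕ) (K : DCube d) :
    carlesonSum ω α (n + 1) K =
      α K + ((2 : ℝ) ^ d)⁻¹ * ∑ ε, carlesonSum ω α n (child ω K ε) := by
  unfold carlesonSum
  rw [Finset.sum_range_succ', add_comm]
  simp only [pow_zero, one_mul, desc_zero, Finset.sum_singleton]
  congr 1
  rw [Finset.sum_comm, Finset.mul_sum]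
  refine Finset.sum_congr rfl fun l _ => ?_
  rw [sum_desc_succ, ← Finset.mul_sum, pow_succ]
  ring

theorem carlesonSum_nonneg (ω : Omega d) {α : DCube d → ℝ} (hα : ∀ J, 0 ≤ α J) (n : ℕ)
    (K : DCube d) : 0 ≤ carlesonSum ω α n K := by
  refine Finset.sum_nonneg fun l _ => mul_nonneg (by positivity) ?_
  exact Finset.sum_nonneg fun J _ => hα J

/-- The Bellman function estimate behind the Carleson embedding theorem. -/
theorem bellman_le (ω : Omega d) {α c : DCube d → ℝ} (hα : ∀ J, 0 ≤ α J) (hc : ∀ J, 0 ≤ c J)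
    (hcc : ∀ K, c K ≤ ratio d * ∑ ε, c (child ω K ε))
    (hM : ∀ n K, carlesonSum ω α n K ≤ 1) (n : ℕ) (K : DCube d) :
    ∑ l ∈ Finset.range (n + 1), ∑ J ∈ desc ω K l, α J * c J ^ 2 ≤
      4 * (∑ J ∈ desc ω K n, c J ^ 2 - c K ^ 2 / (1 + carlesonSum ω α n K)) := by
  -- The Bellman function x / (1 + M): raising M from m to a + m lowers it by a x / ((1+m)(1+a+m)),
  -- which is at least a x / 4 as long as a + m ≤ 1. This is the origin of the factor 4.
  have key : ∀ x a m : ℝ, 0 ≤ x → 0 ≤ a → 0 ≤ m → a + m ≤ 1 →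
      a * x + 4 * (x / (1 + (a + m))) ≤ 4 * (x / (1 + m)) := by
    intro x a m hx ha hm ham
    have h1 : 0 < 1 + m := by linarith
    have h2 : 0 < 1 + (a + m) := by linarith
    have h3 : 4 * (x / (1 + m)) - 4 * (x / (1 + (a + m))) =
        4 * a * x / ((1 + m) * (1 + (a + m))) := by
      field_simp
      ring
    have h4 : a * x ≤ 4 * a * x / ((1 + m) * (1 + (a + m))) := by
      rw [le_div_iff₀ (by positivity)]
      have : (1 + m) * (1 + (a + m)) ≤ 4 := by nlinarith
      have hax := mul_nonneg ha hx
      nlinarith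
    linarith
  induction n generalizing K with
  | zero =>
    simp only [zero_add, Finset.range_one, Finset.sum_singleton, desc_zero, carlesonSum_zero]
    have h := key (c K ^ 2) (α K) 0 (sq_nonneg _) (hα K) le_rfl
      (by simpa [carlesonSum_zero] using hM 0 K)
    simp only [add_zero, div_one] at h
    linarith
  | succ n ih =>
    rw [Finset.sum_range_succ']
    simp_rw [sum_desc_succ]
    rw [Finset.sum_comm]
    simp only [desc_zero, Finset.sum_singleton]
    have h1 := Finset.sum_le_sum fun ε (_ : ε ∈ Finset.univ) => ih (child ω K ε)
    rw [← Finset.mul_sum, Finset.sum_sub_distrib] at h1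
    set m : ℝ := ((2 : ℝ) ^ d)⁻¹ * ∑ ε, carlesonSum ω α n (child ω K ε) with hm
    have hm0 : 0 ≤ m := mul_nonneg (by positivity)
      (Finset.sum_nonneg fun _ _ => carlesonSum_nonneg ω hα _ _)
    have hM1 : α K + m ≤ 1 := by
      have := hM (n + 1) K
      rwa [carlesonSum_succ] at this
    -- Joint convexity of c² / (1 + M), in the form of Cauchy–Schwarz for sums of quotients. The
    -- number 2^d of children cancels against the square of `ratio d`.
    have h2 : c K ^ 2 / (1 + m) ≤
        ∑ ε, c (child ω K ε) ^ 2 / (1 + carlesonSum ω α n (child ω K ε)) := by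
      refine le_trans ?_ (Finset.sq_sum_div_le_sum_sq_div Finset.univ
        (fun ε => c (child ω K ε)) fun ε _ => ?_)
      · have hsum : ∑ ε : Fin d → Fin 2, (1 + carlesonSum ω α n (child ω K ε)) =
            2 ^ d * (1 + m) := by
          rw [Finset.sum_add_distrib, hm, mul_add, mul_inv_cancel_left₀ (by positivity)]
          simp
        rw [hsum, ← div_div]
        refine div_le_div_of_nonneg_right ?_ (by linarith)
        rw [le_div_iff₀ (by positivity)]
        calc c K ^ 2 * 2 ^ d ≤ (ratio d * ∑ ε, c (child ω K ε)) ^ 2 * 2 ^ d := by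
              have := pow_le_pow_left₀ (hc K) (hcc K) 2
              gcongr
          _ = (ratio d * ratio d * 2 ^ d) * (∑ ε, c (child ω K ε)) ^ 2 := by ring
          _ = _ := by rw [ratio_sq_mul, one_mul]
      · have := carlesonSum_nonneg ω hα n (child ω K ε)
        linarith
    have h3 := key (c K ^ 2) (α K) m (sq_nonneg _) (hα K) hm0 hM1
    rw [carlesonSum_succ, ← hm]
    linarith

theorem norm_inner_haar_zero_le (ω : Omega d) (K : DCube d) (f : L2 𝕜 d) :
    ‖(inner 𝕜 (haar 𝕜 ω K 0) f : 𝕜)‖ ≤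
      ratio d * ∑ ε, ‖(inner 𝕜 (haar 𝕜 ω (child ω K ε) 0) f : 𝕜)‖ := by
  rw [haar_eq_sum_child ω K 0, sum_inner, Finset.mul_sum]
  refine (norm_sum_le _ _).trans (Finset.sum_le_sum fun ε _ => ?_)
  rw [inner_smul_left, RCLike.conj_ofReal, haarSign_zero, mul_one, norm_mul, RCLike.norm_ofReal,
    abs_of_pos (ratio_pos d)]

/-- The dyadic Carleson embedding theorem. -/
theorem carleson_embedding (ω : Omega d) {α : DCube d → ℝ} (hα : ∀ J, 0 ≤ α J)
    (hM : ∀ n K, carlesonSum ω α n K ≤ 1) (s : Finset (DCube d)) (f : L2 𝕜 d) :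
    ∑ K ∈ s, α K * ‖(inner 𝕜 (haar 𝕜 ω K 0) f : 𝕜)‖ ^ 2 ≤ 4 * ‖f‖ ^ 2 := by
  classical
  -- The finite family lies in n + 1 consecutive generations. It is enlarged to the full trees of
  -- depth n below its ancestors of generation k₀.
  obtain ⟨k₀, n, hk⟩ : ∃ (k₀ : ℤ) (n : ℕ), ∀ K ∈ s, k₀ ≤ K.1 ∧ K.1 ≤ k₀ + n := by
    obtain ⟨lo, hlo⟩ := (s.image Prod.fst).bddBelow
    obtain ⟨hi, hhi⟩ := (s.image Prod.fst).bddAbove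
    refine ⟨lo, (hi - lo).toNat, fun K hK => ?_⟩
    have h1 := hlo (Finset.mem_coe.2 (Finset.mem_image_of_mem Prod.fst hK))
    have h2 := hhi (Finset.mem_coe.2 (Finset.mem_image_of_mem Prod.fst hK))
    omega
  let top : DCube d → DCube d := fun K => anc ω (K.1 - k₀).toNat K
  set x : DCube d → ℝ := fun K => α K * ‖(inner 𝕜 (haar 𝕜 ω K 0) f : 𝕜)‖ ^ 2 with hx
  have hx0 : ∀ K, 0 ≤ x K := fun K => mul_nonneg (hα K) (sq_nonneg _)
  have htop : ∀ P ∈ s.image top, P.1 = k₀ := by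
    intro P hP
    obtain ⟨K, hK, rfl⟩ := Finset.mem_image.1 hP
    simp only [top, anc_fst]
    have := (hk K hK).1
    omega
  -- All tops have generation k₀, so a cube determines both its depth and its top. The trees are
  -- disjoint and the Bellman estimate can be applied to each.
  have hdisj : ∀ y ∈ s.image top ×ˢ Finset.range (n + 1),
      ∀ y' ∈ s.image top ×ˢ Finset.range (n + 1), y ≠ y' →
      Disjoint (desc ω y.1 y.2) (desc ω y'.1 y'.2) := by
    intro y hy y' hy' hne
    refine Finset.disjoint_left.2 fun J h1 h2 => hne ?_
    rw [mem_desc] at h1 h2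
    have a1 := htop _ (Finset.mem_product.1 hy).1
    have a2 := htop _ (Finset.mem_product.1 hy').1
    rw [← h1, anc_fst] at a1
    rw [← h2, anc_fst] at a2
    have : y.2 = y'.2 := by omega
    refine Prod.ext ?_ this
    rw [← h1, ← h2, this]
  calc ∑ K ∈ s, x K
      ≤ ∑ K ∈ (s.image top ×ˢ Finset.range (n + 1)).biUnion fun y => desc ω y.1 y.2, x K := by
        refine Finset.sum_le_sum_of_subset_of_nonneg (fun K hK => ?_) fun K _ _ => hx0 K
        rw [Finset.mem_biUnion]
        refine ⟨(top K, (K.1 - k₀).toNat), Finset.mem_product.2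
          ⟨Finset.mem_image_of_mem _ hK, Finset.mem_range.2 ?_⟩, mem_desc.2 rfl⟩
        have := hk K hK
        simp only
        omega
    _ = ∑ P ∈ s.image top, ∑ l ∈ Finset.range (n + 1), ∑ J ∈ desc ω P l, x J := by
        rw [Finset.sum_biUnion hdisj, Finset.sum_product]
    _ ≤ ∑ P ∈ s.image top, 4 * ∑ J ∈ desc ω P n, ‖(inner 𝕜 (haar 𝕜 ω J 0) f : 𝕜)‖ ^ 2 := by
        refine Finset.sum_le_sum fun P _ => ?_
        refine (bellman_le ω hα (c := fun J => ‖(inner 𝕜 (haar 𝕜 ω J 0) f : 𝕜)‖)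
          (fun _ => norm_nonneg _) (fun K => norm_inner_haar_zero_le ω K f) hM n P).trans ?_
        have : 0 ≤ ‖(inner 𝕜 (haar 𝕜 ω P 0) f : 𝕜)‖ ^ 2 / (1 + carlesonSum ω α n P) :=
          div_nonneg (sq_nonneg _) (by linarith [carlesonSum_nonneg ω hα n P])
        linarith
    -- The bottom cubes have the single generation k₀ + n, so their normalized indicators are
    -- orthonormal and Bessel's inequality applies.
    _ ≤ 4 * ‖f‖ ^ 2 := by
        rw [← Finset.mul_sum, ← Finset.sum_biUnion]
        · refine mul_le_mul_of_nonneg_left (sum_inner_haar_zero_sq_le ω _ (k := k₀ + n) ?_ f)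
            (by norm_num)
          intro J hJ
          obtain ⟨P, hP, hJP⟩ := Finset.mem_biUnion.1 hJ
          have := htop P hP
          rw [← mem_desc.1 hJP, anc_fst] at this
          omega
        · intro P _ P' _ hne
          refine Finset.disjoint_left.2 fun J h1 h2 => hne ?_
          exact (mem_desc.1 h1).symm.trans (mem_desc.1 h2)

end Carleson

/-! ### Construction of dyadic shifts -/

section Shifts

variable {𝕜 : Type*} [RCLike 𝕜] {d : ℕ}

/-- The prescribed bound √(|I||J|)/|K| is 2^{-d(i+j)/2}. All coefficient estimates are stated with
this power of `ratio d`. -/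
theorem sqrt_side_eq (ω : Omega d) {K I J : DCube d} {i j : ℕ} (hI : I ∈ descendants ω K i)
    (hJ : J ∈ descendants ω K j) :
    √(side I ^ d * side J ^ d) / side K ^ d = ratio d ^ (i + j) := by
  have hK := side_pos K
  have h2 : ((2 : ℝ)⁻¹) ^ d = ratio d * ratio d := by rw [ratio_sq, inv_pow]
  rw [hI.2, hJ.2, mul_pow, mul_pow, ← pow_mul, ← pow_mul, mul_comm i, mul_comm j, pow_mul, pow_mul,
    h2, div_eq_iff (by positivity)]
  rw [show (ratio d * ratio d) ^ i * side K ^ d * ((ratio d * ratio d) ^ j * side K ^ d) =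
    (ratio d ^ (i + j) * side K ^ d) ^ 2 by rw [pow_add]; ring]
  exact Real.sqrt_sq (mul_nonneg (pow_nonneg (ratio_pos d).le _) (by positivity))

/-- The coefficients `a` define a dyadic shift of norm at most `M`. -/
structure ShiftBd (ω : Omega d) (i j : ℕ) (a : ShiftCoeff 𝕜 d) (M : ℝ) : Prop where
  bound : ∀ K, ∀ I ∈ descendants ω K i, ∀ J ∈ descendants ω K j,
    ∑ η : Fin d → Fin 2, ∑ η' : Fin d → Fin 2, ‖a I J K η η'‖ ≤ M * ratio d ^ (i + j)
  subshift : ∀ Q : Set (DCube d), ∃ SQ : L2 𝕜 d →L[𝕜] L2 𝕜 d, ‖SQ‖ ≤ M ∧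
    ∀ f, HasSum (fun K : Q => averagingOp ω i j a K f) (SQ f)

theorem averagingOp_eq (ω : Omega d) (i j : ℕ) (a : ShiftCoeff 𝕜 d) (K : DCube d) (f : L2 𝕜 d) :
    averagingOp ω i j a K f = ∑ I ∈ desc ω K i, ∑ J ∈ desc ω K j, ∑ η, ∑ η',
      (a I J K η η' * inner 𝕜 (haar 𝕜 ω I η) f) • haar 𝕜 ω J η' := rfl

theorem averagingOp_add_coeff (ω : Omega d) (i j : ℕ) (a b : ShiftCoeff 𝕜 d) (K : DCube d)
    (f : L2 𝕜 d) :
    averagingOp ω i j (a + b) K f = averagingOp ω i j a K f + averagingOp ω i j b K f := by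
  simp only [averagingOp_eq, Pi.add_apply, add_mul, add_smul, Finset.sum_add_distrib]

theorem averagingOp_smul_coeff (ω : Omega d) (i j : ℕ) (c : 𝕜) (a : ShiftCoeff 𝕜 d) (K : DCube d)
    (f : L2 𝕜 d) : averagingOp ω i j (c • a) K f = c • averagingOp ω i j a K f := by
  simp only [averagingOp_eq, Pi.smul_apply, smul_eq_mul, mul_assoc, Finset.smul_sum, smul_smul]

theorem averagingOp_add (ω : Omega d) (i j : ℕ) (a : ShiftCoeff 𝕜 d) (K : DCube d)
    (f g : L2 𝕜 d) :
    averagingOp ω i j a K (f + g) = averagingOp ω i j a K f + averagingOp ω i j a K g := by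
  simp only [averagingOp_eq, inner_add_right, mul_add, add_smul, Finset.sum_add_distrib]

theorem averagingOp_smul (ω : Omega d) (i j : ℕ) (a : ShiftCoeff 𝕜 d) (K : DCube d) (c : 𝕜)
    (f : L2 𝕜 d) : averagingOp ω i j a K (c • f) = c • averagingOp ω i j a K f := by
  simp only [averagingOp_eq, inner_smul_right, Finset.smul_sum, smul_smul, mul_left_comm]

theorem ShiftBd.add {ω : Omega d} {i j : ℕ} {a b : ShiftCoeff 𝕜 d} {M N : ℝ}
    (ha : ShiftBd ω i j a M) (hb : ShiftBd ω i j b N) : ShiftBd ω i j (a + b) (M + N) := by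
  refine ⟨fun K I hI J hJ => ?_, fun Q => ?_⟩
  · rw [add_mul]
    refine le_trans ?_ (add_le_add (ha.bound K I hI J hJ) (hb.bound K I hI J hJ))
    simp_rw [← Finset.sum_add_distrib]
    exact Finset.sum_le_sum fun η _ => Finset.sum_le_sum fun η' _ => norm_add_le _ _
  · obtain ⟨S, hS, hS'⟩ := ha.subshift Q
    obtain ⟨S', h, h'⟩ := hb.subshift Q
    refine ⟨S + S', (norm_add_le _ _).trans (add_le_add hS h), fun f => ?_⟩
    simp_rw [averagingOp_add_coeff]
    exact (hS' f).add (h' f)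

theorem ShiftBd.smul {ω : Omega d} {i j : ℕ} {a : ShiftCoeff 𝕜 d} {M : ℝ}
    (ha : ShiftBd ω i j a M) (c : 𝕜) : ShiftBd ω i j (c • a) (‖c‖ * M) := by
  refine ⟨fun K I hI J hJ => ?_, fun Q => ?_⟩
  · rw [mul_assoc]
    refine le_trans (le_of_eq ?_)
      (mul_le_mul_of_nonneg_left (ha.bound K I hI J hJ) (norm_nonneg c))
    simp only [Pi.smul_apply, smul_eq_mul, norm_mul, Finset.mul_sum]
  · obtain ⟨S, hS, hS'⟩ := ha.subshift Q
    refine ⟨c • S, ?_, fun f => ?_⟩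
    · rw [norm_smul]
      exact mul_le_mul_of_nonneg_left hS (norm_nonneg c)
    · simp_rw [averagingOp_smul_coeff]
      exact (hS' f).const_smul c

theorem ShiftBd.mono {ω : Omega d} {i j : ℕ} {a : ShiftCoeff 𝕜 d} {M N : ℝ}
    (ha : ShiftBd ω i j a M) (h : M ≤ N) : ShiftBd ω i j a N := by
  refine ⟨fun K I hI J hJ => (ha.bound K I hI J hJ).trans ?_, fun Q => ?_⟩
  · exact mul_le_mul_of_nonneg_right h (pow_nonneg (ratio_pos d).le _)
  · obtain ⟨S, hS, hS'⟩ := ha.subshift Q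
    exact ⟨S, hS.trans h, hS'⟩

theorem ShiftBd.isDyadicShift {ω : Omega d} {i j : ℕ} {a : ShiftCoeff 𝕜 d}
    (ha : ShiftBd ω i j a 1) : ∃ S, IsDyadicShift ω i j a S := by
  obtain ⟨S, -, hS⟩ := ha.subshift univ
  refine ⟨S, ⟨fun K I hI J hJ => ?_, ha.subshift, fun f => ?_⟩⟩
  · rw [sqrt_side_eq ω hI hJ, ← one_mul (ratio d ^ (i + j))]
    exact ha.bound K I hI J hJ
  · exact (Equiv.Set.univ (DCube d)).hasSum_iff.1 (hS f)

/-- A square function bound for all finite partial sums gives the boundedness of all subshifts. -/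
theorem subshift_of_norm_sq_le (ω : Omega d) (i j : ℕ) (a : ShiftCoeff 𝕜 d) {M : ℝ} (hM : 0 ≤ M)
    (q : DCube d → L2 𝕜 d → ℝ) (hq0 : ∀ K f, 0 ≤ q K f)
    (hq : ∀ (s : Finset (DCube d)) f, ∑ K ∈ s, q K f ≤ ‖f‖ ^ 2)
    (h : ∀ (s : Finset (DCube d)) f,
      ‖∑ K ∈ s, averagingOp ω i j a K f‖ ^ 2 ≤ M ^ 2 * ∑ K ∈ s, q K f)
    (Q : Set (DCube d)) : ∃ SQ : L2 𝕜 d →L[𝕜] L2 𝕜 d, ‖SQ‖ ≤ M ∧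
      ∀ f, HasSum (fun K : Q => averagingOp ω i j a K f) (SQ f) := by
  have hfin : ∀ (t : Finset Q) f, ‖∑ K ∈ t, averagingOp ω i j a K f‖ ^ 2 ≤
      M ^ 2 * ∑ K ∈ t, q K f := by
    intro t f
    have := h (t.map (Function.Embedding.subtype _)) f
    simpa only [Finset.sum_map, Function.Embedding.subtype_apply] using this
  have hqt : ∀ (t : Finset Q) f, ∑ K ∈ t, q K f ≤ ‖f‖ ^ 2 := by
    intro t f
    have := hq (t.map (Function.Embedding.subtype _)) f
    simpa only [Finset.sum_map, Function.Embedding.subtype_apply] using this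
  have hsum : ∀ f, Summable fun K : Q => averagingOp ω i j a K f := by
    intro f
    have hqs : Summable fun K : Q => q K f :=
      summable_of_sum_le (fun K => hq0 K f) (fun t => hqt t f)
    rw [summable_iff_vanishing_norm]
    intro ε hε
    -- Tails of the square function control tails of the series, which gives unconditional
    -- convergence. The `+ 1` keeps the threshold meaningful when `M = 0`.
    obtain ⟨s, hs⟩ := summable_iff_vanishing_norm.1 hqs (ε ^ 2 / (M ^ 2 + 1)) (by positivity)
    refine ⟨s, fun t ht => ?_⟩
    have h1 := hs t ht
    have h3 : 0 ≤ ∑ K ∈ t, q K f := Finset.sum_nonneg fun K _ => hq0 K f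
    rw [Real.norm_of_nonneg h3, lt_div_iff₀ (by positivity)] at h1
    have h2 := hfin t f
    exact lt_of_pow_lt_pow_left₀ 2 hε.le (by nlinarith)
  have hbd : ∀ f, ‖∑' K : Q, averagingOp ω i j a K f‖ ≤ M * ‖f‖ := by
    intro f
    refine le_of_tendsto ((hsum f).hasSum.norm) (Eventually.of_forall fun t => ?_)
    refine le_of_sq_le_sq ?_ (by positivity)
    rw [mul_pow]
    exact (hfin t f).trans (mul_le_mul_of_nonneg_left (hqt t f) (sq_nonneg M))
  let L : L2 𝕜 d →ₗ[𝕜] L2 𝕜 d :=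
    { toFun := fun f => ∑' K : Q, averagingOp ω i j a K f
      map_add' := fun f g => by
        simp_rw [averagingOp_add]
        exact (hsum f).tsum_add (hsum g)
      map_smul' := fun c f => by
        simp_rw [averagingOp_smul]
        exact (hsum f).tsum_const_smul c }
  exact ⟨L.mkContinuous M hbd, L.mkContinuous_norm_le hM hbd, fun f => (hsum f).hasSum⟩

theorem norm_sum_mul_sq_le {ι : Type*} (s : Finset ι) (a x : ι → 𝕜) :
    ‖∑ i ∈ s, a i * x i‖ ^ 2 ≤ (∑ i ∈ s, ‖a i‖ ^ 2) * ∑ i ∈ s, ‖x i‖ ^ 2 := by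
  refine le_trans ?_ (Finset.sum_mul_sq_le_sq_mul_sq s (fun i => ‖a i‖) fun i => ‖x i‖)
  refine pow_le_pow_left₀ (norm_nonneg _) ?_ 2
  simpa only [norm_mul] using norm_sum_le s fun i => a i * x i

theorem sum_norm_sq_le_sq_sum {ι : Type*} (s : Finset ι) {x : ι → ℝ} (hx : ∀ i, 0 ≤ x i) :
    ∑ i ∈ s, x i ^ 2 ≤ (∑ i ∈ s, x i) ^ 2 := by
  rw [sq (∑ i ∈ s, x i), Finset.sum_mul]
  refine Finset.sum_le_sum fun i hi => ?_
  rw [sq]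
  exact mul_le_mul_of_nonneg_left (Finset.single_le_sum (fun j _ => hx j) hi) (hx i)

end Shifts


/-! ### Cancellative shifts, paraproducts and their adjoints. -/

section ShiftConstructions

variable {𝕜 : Type*} [RCLike 𝕜] {d : ℕ}

theorem pairwiseDisjoint_desc (ω : Omega d) (s : Finset (DCube d)) (j : ℕ) :
    (s : Set (DCube d)).PairwiseDisjoint fun K => desc ω K j := by
  intro K _ K' _ hne
  refine Finset.disjoint_left.2 fun J h1 h2 => hne ?_
  exact (mem_desc.1 h1).symm.trans (mem_desc.1 h2)

theorem averagingOp_cancellative (ω : Omega d) (i j : ℕ) {a : ShiftCoeff 𝕜 d}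
    (ha : a.IsCancellative) (K : DCube d) (f : L2 𝕜 d) :
    averagingOp ω i j a K f = ∑ J ∈ desc ω K j, ∑ η' ∈ cancTypes d,
      (∑ x ∈ desc ω K i ×ˢ cancTypes d, a x.1 J K x.2 η' * inner 𝕜 (haar 𝕜 ω x.1 x.2) f) •
        haar 𝕜 ω J η' := by
  rw [averagingOp_eq, Finset.sum_comm]
  refine Finset.sum_congr rfl fun J _ => ?_
  simp_rw [Finset.sum_smul, Finset.sum_product]
  conv_rhs => rw [Finset.sum_comm]
  refine Finset.sum_congr rfl fun I _ => ?_
  conv_rhs => rw [Finset.sum_comm]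
  rw [sum_univ_eq_add_cancTypes]
  have h0 : ∑ η', (a I J K 0 η' * inner 𝕜 (haar 𝕜 ω I 0) f) • haar 𝕜 ω J η' = 0 :=
    Finset.sum_eq_zero fun η' _ => by rw [ha I J K 0 η' (Or.inl rfl), zero_mul, zero_smul]
  rw [h0, zero_add]
  refine Finset.sum_congr rfl fun η _ => ?_
  rw [sum_univ_eq_add_cancTypes, ha I J K η 0 (Or.inr rfl), zero_mul, zero_smul, zero_add]

/-- Hilbert–Schmidt norm of one averaging operator. There are 2^{d(i+j)} pairs I, J, exactly
compensating the square of the size `ratio d ^ (i + j)` of a coefficient. -/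
theorem sum_coeff_sq_le (ω : Omega d) {i j : ℕ} {a : ShiftCoeff 𝕜 d} {M : ℝ} {K : DCube d}
    (h : ∀ I ∈ descendants ω K i, ∀ J ∈ descendants ω K j,
      ∑ η : Fin d → Fin 2, ∑ η' : Fin d → Fin 2, ‖a I J K η η'‖ ≤ M * ratio d ^ (i + j)) :
    ∑ J ∈ desc ω K j, ∑ η' ∈ cancTypes d, ∑ x ∈ desc ω K i ×ˢ cancTypes d,
      ‖a x.1 J K x.2 η'‖ ^ 2 ≤ M ^ 2 := by
  have h1 : ∀ J ∈ desc ω K j, ∀ I ∈ desc ω K i,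
      ∑ η' ∈ cancTypes d, ∑ η ∈ cancTypes d, ‖a I J K η η'‖ ^ 2 ≤
        (M * ratio d ^ (i + j)) ^ 2 := by
    intro J hJ I hI
    have hb := h I (mem_descendants.2 (mem_desc.1 hI)) J (mem_descendants.2 (mem_desc.1 hJ))
    have hnn : 0 ≤ ∑ η : Fin d → Fin 2, ∑ η' : Fin d → Fin 2, ‖a I J K η η'‖ :=
      Finset.sum_nonneg fun _ _ => Finset.sum_nonneg fun _ _ => norm_nonneg _
    refine le_trans ?_ (pow_le_pow_left₀ hnn hb 2)
    have h2 := sum_norm_sq_le_sq_sum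
      ((Finset.univ : Finset (Fin d → Fin 2)) ×ˢ (Finset.univ : Finset (Fin d → Fin 2)))
      (x := fun x => ‖a I J K x.1 x.2‖) fun _ => norm_nonneg _
    rw [Finset.sum_product, Finset.sum_product] at h2
    refine le_trans ?_ h2
    rw [Finset.sum_comm]
    refine (Finset.sum_le_sum fun η _ => Finset.sum_le_sum_of_subset_of_nonneg
      (Finset.subset_univ _) fun _ _ _ => sq_nonneg _).trans ?_
    exact Finset.sum_le_sum_of_subset_of_nonneg (Finset.subset_univ _)
      fun _ _ _ => Finset.sum_nonneg fun _ _ => sq_nonneg _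
  calc ∑ J ∈ desc ω K j, ∑ η' ∈ cancTypes d, ∑ x ∈ desc ω K i ×ˢ cancTypes d,
        ‖a x.1 J K x.2 η'‖ ^ 2
      = ∑ J ∈ desc ω K j, ∑ I ∈ desc ω K i, ∑ η' ∈ cancTypes d, ∑ η ∈ cancTypes d,
        ‖a I J K η η'‖ ^ 2 := by
        refine Finset.sum_congr rfl fun J _ => ?_
        simp_rw [Finset.sum_product]
        rw [Finset.sum_comm]
    _ ≤ ∑ J ∈ desc ω K j, ∑ I ∈ desc ω K i, (M * ratio d ^ (i + j)) ^ 2 :=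
        Finset.sum_le_sum fun J hJ => Finset.sum_le_sum fun I hI => h1 J hJ I hI
    _ = M ^ 2 * ((ratio d * ratio d * 2 ^ d) ^ i * (ratio d * ratio d * 2 ^ d) ^ j) := by
        simp only [Finset.sum_const, card_desc, nsmul_eq_mul]
        push_cast
        ring
    _ = M ^ 2 := by rw [ratio_sq_mul, one_pow, one_pow, mul_one, mul_one]

/-- Cancellative coefficients of the right size define a bounded dyadic shift. -/
theorem shiftBd_of_isCancellative (ω : Omega d) {i j : ℕ} {a : ShiftCoeff 𝕜 d} {M : ℝ}
    (hM : 0 ≤ M) (ha : a.IsCancellative)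
    (h : ∀ K, ∀ I ∈ descendants ω K i, ∀ J ∈ descendants ω K j,
      ∑ η : Fin d → Fin 2, ∑ η' : Fin d → Fin 2, ‖a I J K η η'‖ ≤ M * ratio d ^ (i + j)) :
    ShiftBd ω i j a M := by
  classical
  refine ⟨h, subshift_of_norm_sq_le ω i j a hM
    (fun K f => ∑ I ∈ desc ω K i, ∑ η ∈ cancTypes d, ‖(inner 𝕜 (haar 𝕜 ω I η) f : 𝕜)‖ ^ 2)
    (fun K f => Finset.sum_nonneg fun _ _ => Finset.sum_nonneg fun _ _ => sq_nonneg _) ?_ ?_⟩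
  · intro s f
    rw [← Finset.sum_biUnion (pairwiseDisjoint_desc ω s i)]
    exact sum_inner_haar_sq_le ω _ f
  · intro s f
    let c : DCube d → DCube d → (Fin d → Fin 2) → 𝕜 := fun K J η' =>
      ∑ x ∈ desc ω K i ×ˢ cancTypes d, a x.1 J K x.2 η' * inner 𝕜 (haar 𝕜 ω x.1 x.2) f
    -- Since `J` determines `K` as its j-th ancestor, the sum over `K` is a combination of distinct
    -- Haar functions h_J. Its norm can then be read off from the coefficients.
    have e1 : ∑ K ∈ s, averagingOp ω i j a K f =
        ∑ J ∈ s.biUnion fun K => desc ω K j, ∑ η' ∈ cancTypes d,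
          c (anc ω j J) J η' • haar 𝕜 ω J η' := by
      rw [Finset.sum_biUnion (pairwiseDisjoint_desc ω s j)]
      refine Finset.sum_congr rfl fun K _ => ?_
      rw [averagingOp_cancellative ω i j ha]
      refine Finset.sum_congr rfl fun J hJ => ?_
      rw [mem_desc.1 hJ]
    rw [e1, norm_sq_sum_haar, Finset.sum_biUnion (pairwiseDisjoint_desc ω s j), Finset.mul_sum]
    refine Finset.sum_le_sum fun K _ => ?_
    have e2 : ∀ J ∈ desc ω K j, ∑ η' ∈ cancTypes d, ‖c (anc ω j J) J η'‖ ^ 2 ≤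
        ∑ η' ∈ cancTypes d, (∑ x ∈ desc ω K i ×ˢ cancTypes d, ‖a x.1 J K x.2 η'‖ ^ 2) *
          ∑ x ∈ desc ω K i ×ˢ cancTypes d, ‖(inner 𝕜 (haar 𝕜 ω x.1 x.2) f : 𝕜)‖ ^ 2 := by
      intro J hJ
      rw [mem_desc.1 hJ]
      exact Finset.sum_le_sum fun η' _ => norm_sum_mul_sq_le _ _ _
    refine (Finset.sum_le_sum e2).trans ?_
    simp_rw [← Finset.sum_mul]
    rw [← Finset.sum_product' (f := fun I η => ‖(inner 𝕜 (haar 𝕜 ω I η) f : 𝕜)‖ ^ 2)]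
    exact mul_le_mul_of_nonneg_right (sum_coeff_sq_le ω (h K))
      (Finset.sum_nonneg fun _ _ => sq_nonneg _)

/-- The coefficients of the paraproduct `f ↦ ∑_K b_K ⟨f, h_K^0⟩ h_K`. -/
def paraCoeff (b : DCube d → (Fin d → Fin 2) → 𝕜) : ShiftCoeff 𝕜 d := fun _ J _ η η' =>
  if η = 0 ∧ η' ≠ 0 then b J η' else 0

/-- The coefficients of the adjoint paraproduct. -/
def dualParaCoeff (b : DCube d → (Fin d → Fin 2) → 𝕜) : ShiftCoeff 𝕜 d := fun I _ _ η η' =>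
  if η' = 0 ∧ η ≠ 0 then starRingEnd 𝕜 (b I η) else 0

theorem averagingOp_paraCoeff (ω : Omega d) (b : DCube d → (Fin d → Fin 2) → 𝕜) (K : DCube d)
    (f : L2 𝕜 d) :
    averagingOp ω 0 0 (paraCoeff b) K f =
      ∑ η ∈ cancTypes d, (b K η * inner 𝕜 (haar 𝕜 ω K 0) f) • haar 𝕜 ω K η := by
  rw [averagingOp_eq, desc_zero]
  simp only [Finset.sum_singleton]
  rw [Finset.sum_eq_single 0 (fun η _ hη => Finset.sum_eq_zero fun η' _ => by
    simp [paraCoeff, hη]) (by simp), sum_univ_eq_add_cancTypes]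
  have h0 : paraCoeff b K K K 0 0 = 0 := by simp [paraCoeff]
  rw [h0, zero_mul, zero_smul, zero_add]
  refine Finset.sum_congr rfl fun η hη => ?_
  rw [paraCoeff, if_pos ⟨rfl, mem_cancTypes.1 hη⟩]

theorem averagingOp_dualParaCoeff (ω : Omega d) (b : DCube d → (Fin d → Fin 2) → 𝕜) (K : DCube d)
    (f : L2 𝕜 d) :
    averagingOp ω 0 0 (dualParaCoeff b) K f =
      ∑ η ∈ cancTypes d,
        (starRingEnd 𝕜 (b K η) * inner 𝕜 (haar 𝕜 ω K η) f) • haar 𝕜 ω K 0 := by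
  rw [averagingOp_eq, desc_zero]
  simp only [Finset.sum_singleton]
  rw [Finset.sum_comm, Finset.sum_eq_single 0 (fun η _ hη => Finset.sum_eq_zero fun η' _ => by
    simp [dualParaCoeff, hη]) (by simp), sum_univ_eq_add_cancTypes]
  have h0 : dualParaCoeff b K K K 0 0 = 0 := by simp [dualParaCoeff]
  rw [h0, zero_mul, zero_smul, zero_add]
  refine Finset.sum_congr rfl fun η hη => ?_
  rw [dualParaCoeff, if_pos ⟨rfl, mem_cancTypes.1 hη⟩]

/-- The normalized Carleson condition for the coefficients of a paraproduct. -/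
def IsCarleson (ω : Omega d) (b : DCube d → (Fin d → Fin 2) → 𝕜) (B : ℝ) : Prop :=
  ∀ n K, carlesonSum ω (fun J => ∑ η ∈ cancTypes d, ‖b J η‖ ^ 2) n K ≤ B ^ 2

/-- The embedding theorem applied to the weights divided by B². The constant 4B² appears as (2B)².
-/
theorem IsCarleson.embedding {ω : Omega d} {b : DCube d → (Fin d → Fin 2) → 𝕜} {B : ℝ}
    (hb : IsCarleson ω b B) (hB : 0 < B) (s : Finset (DCube d)) (f : L2 𝕜 d) :
    ∑ K ∈ s, ∑ η ∈ cancTypes d, ‖b K η * inner 𝕜 (haar 𝕜 ω K 0) f‖ ^ 2 ≤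
      (2 * B) ^ 2 * ‖f‖ ^ 2 := by
  have hB2 : (0 : ℝ) < B ^ 2 := by positivity
  have h := carleson_embedding ω (α := fun J => (∑ η ∈ cancTypes d, ‖b J η‖ ^ 2) / B ^ 2)
    (fun J => div_nonneg (Finset.sum_nonneg fun _ _ => sq_nonneg _) hB2.le) (fun n K => ?_) s f
  · have e : ∀ K, ∑ η ∈ cancTypes d, ‖b K η * (inner 𝕜 (haar 𝕜 ω K 0) f : 𝕜)‖ ^ 2 =
        B ^ 2 * ((∑ η ∈ cancTypes d, ‖b K η‖ ^ 2) / B ^ 2 *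
          ‖(inner 𝕜 (haar 𝕜 ω K 0) f : 𝕜)‖ ^ 2) := by
      intro K
      simp_rw [norm_mul, mul_pow]
      rw [← Finset.sum_mul]
      field_simp
    simp_rw [e]
    rw [← Finset.mul_sum]
    nlinarith
  · have h1 := hb n K
    rw [← div_le_one hB2] at h1
    refine le_trans (le_of_eq ?_) h1
    unfold carlesonSum
    rw [Finset.sum_div]
    refine Finset.sum_congr rfl fun l _ => ?_
    rw [← Finset.sum_div, mul_div_assoc]

/-- The Carleson condition with no generations below `K` already bounds each single coefficient by
`B`. -/
theorem IsCarleson.sum_norm_le {ω : Omega d} {b : DCube d → (Fin d → Fin 2) → 𝕜} {B : ℝ}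
    (hb : IsCarleson ω b B) (hB : 0 < B) (K : DCube d) :
    ∑ η ∈ cancTypes d, ‖b K η‖ ≤ 2 ^ d * B := by
  have h1 := hb 0 K
  rw [carlesonSum_zero] at h1
  have h2 : ∀ η ∈ cancTypes d, ‖b K η‖ ≤ B := fun η hη =>
    le_of_sq_le_sq ((Finset.single_le_sum (f := fun η => ‖b K η‖ ^ 2)
      (fun _ _ => sq_nonneg _) hη).trans h1) hB.le
  refine (Finset.sum_le_card_nsmul _ _ B h2).trans ?_
  rw [nsmul_eq_mul]
  refine mul_le_mul_of_nonneg_right ?_ hB.le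
  exact_mod_cast card_cancTypes_le d

theorem two_le_two_pow_succ (d : ℕ) : (2 : ℝ) ≤ 2 ^ (d + 1) := by
  rw [pow_succ]
  nlinarith [one_le_pow₀ (one_le_two : (1 : ℝ) ≤ 2) (n := d)]

/-- The outputs h_K are orthonormal, so the square of the norm is the left side of the Carleson
embedding. The factor 2^d in the constant is needed only for the total coefficient size over the
types. -/
theorem shiftBd_paraCoeff (ω : Omega d) {b : DCube d → (Fin d → Fin 2) → 𝕜} {B : ℝ}
    (hb : IsCarleson ω b B) (hB : 0 < B) :
    ShiftBd ω 0 0 (paraCoeff b) (2 ^ (d + 1) * B) := by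
  have hle : 2 * B ≤ 2 ^ (d + 1) * B := mul_le_mul_of_nonneg_right (two_le_two_pow_succ d) hB.le
  refine ⟨fun K I hI J hJ => ?_, fun Q => ?_⟩
  · rw [mem_descendants, anc_zero] at hI hJ
    subst hI hJ
    rw [Finset.sum_eq_single 0 (fun η _ hη => Finset.sum_eq_zero fun η' _ => by
      simp [paraCoeff, hη]) (by simp), sum_univ_eq_add_cancTypes]
    have h1 : ∑ η ∈ cancTypes d, ‖paraCoeff b J J J 0 η‖ = ∑ η ∈ cancTypes d, ‖b J η‖ :=
      Finset.sum_congr rfl fun η hη => by rw [paraCoeff, if_pos ⟨rfl, mem_cancTypes.1 hη⟩]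
    have h0 : paraCoeff b J J J 0 0 = 0 := by simp [paraCoeff]
    rw [h1, h0, norm_zero, zero_add, pow_zero, mul_one, pow_succ]
    have := hb.sum_norm_le hB J
    have h2 : (0 : ℝ) ≤ 2 ^ d * B := by positivity
    linarith
  · suffices h : ∃ S : L2 𝕜 d →L[𝕜] L2 𝕜 d, ‖S‖ ≤ 2 * B ∧
        ∀ f, HasSum (fun K : Q => averagingOp ω 0 0 (paraCoeff b) K f) (S f) by
      obtain ⟨S, h1, h2⟩ := h
      exact ⟨S, h1.trans hle, h2⟩
    refine subshift_of_norm_sq_le ω 0 0 (paraCoeff b) (M := 2 * B) (by positivity)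
      (fun K f => (∑ η ∈ cancTypes d, ‖b K η * inner 𝕜 (haar 𝕜 ω K 0) f‖ ^ 2) / (2 * B) ^ 2)
      (fun K f => div_nonneg (Finset.sum_nonneg fun _ _ => sq_nonneg _) (sq_nonneg _))
      (fun s f => ?_) (fun s f => ?_) Q
    · rw [← Finset.sum_div, div_le_iff₀ (by positivity), mul_comm]
      exact hb.embedding hB s f
    · simp_rw [averagingOp_paraCoeff]
      rw [norm_sq_sum_haar ω s fun K η => b K η * inner 𝕜 (haar 𝕜 ω K 0) f, ← Finset.sum_div,
        mul_div_cancel₀ _ (by positivity)]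

theorem shiftBd_dualParaCoeff (ω : Omega d) {b : DCube d → (Fin d → Fin 2) → 𝕜} {B : ℝ}
    (hb : IsCarleson ω b B) (hB : 0 < B) :
    ShiftBd ω 0 0 (dualParaCoeff b) (2 ^ (d + 1) * B) := by
  have hle : 2 * B ≤ 2 ^ (d + 1) * B := mul_le_mul_of_nonneg_right (two_le_two_pow_succ d) hB.le
  refine ⟨fun K I hI J hJ => ?_, fun Q => ?_⟩
  · rw [mem_descendants, anc_zero] at hI hJ
    subst hI hJ
    rw [Finset.sum_comm, Finset.sum_eq_single 0 (fun η _ hη => Finset.sum_eq_zero fun η' _ => by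
      simp [dualParaCoeff, hη]) (by simp), sum_univ_eq_add_cancTypes]
    have h1 : ∑ η ∈ cancTypes d, ‖dualParaCoeff b J J J η 0‖ = ∑ η ∈ cancTypes d, ‖b J η‖ :=
      Finset.sum_congr rfl fun η hη => by
        rw [dualParaCoeff, if_pos ⟨rfl, mem_cancTypes.1 hη⟩, RCLike.norm_conj]
    have h0 : dualParaCoeff b J J J 0 0 = 0 := by simp [dualParaCoeff]
    rw [h1, h0, norm_zero, zero_add, pow_zero, mul_one, pow_succ]
    have := hb.sum_norm_le hB J
    have h2 : (0 : ℝ) ≤ 2 ^ d * B := by positivity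
    linarith
  · suffices h : ∃ S : L2 𝕜 d →L[𝕜] L2 𝕜 d, ‖S‖ ≤ 2 * B ∧
        ∀ f, HasSum (fun K : Q => averagingOp ω 0 0 (dualParaCoeff b) K f) (S f) by
      obtain ⟨S, h1, h2⟩ := h
      exact ⟨S, h1.trans hle, h2⟩
    refine subshift_of_norm_sq_le ω 0 0 (dualParaCoeff b) (M := 2 * B) (by positivity)
      (fun K f => ∑ η ∈ cancTypes d, ‖(inner 𝕜 (haar 𝕜 ω K η) f : 𝕜)‖ ^ 2)
      (fun K f => Finset.sum_nonneg fun _ _ => sq_nonneg _)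
      (fun s f => sum_inner_haar_sq_le ω s f) (fun s f => ?_) Q
    · set v := ∑ K ∈ s, averagingOp ω 0 0 (dualParaCoeff b) K f with hv
      set q := ∑ K ∈ s, ∑ η ∈ cancTypes d, ‖(inner 𝕜 (haar 𝕜 ω K η) f : 𝕜)‖ ^ 2 with hq
      have hq0 : 0 ≤ q := Finset.sum_nonneg fun _ _ => Finset.sum_nonneg fun _ _ => sq_nonneg _
      -- The noncancellative outputs are not orthogonal, so the bound goes by duality: testing `v`
      -- against itself and Cauchy–Schwarz give ‖v‖⁴ ≤ (2B)² ‖v‖² q.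
      have e0 : ∀ w, inner 𝕜 w v = ∑ x ∈ s ×ˢ cancTypes d,
          starRingEnd 𝕜 (b x.1 x.2 * inner 𝕜 (haar 𝕜 ω x.1 0) w) *
            inner 𝕜 (haar 𝕜 ω x.1 x.2) f := by
        intro w
        rw [hv]
        simp_rw [averagingOp_dualParaCoeff]
        rw [Finset.sum_product, inner_sum]
        refine Finset.sum_congr rfl fun K _ => ?_
        rw [inner_sum]
        refine Finset.sum_congr rfl fun η _ => ?_
        rw [inner_smul_right, map_mul, inner_conj_symm]
        ring
      have e1 := e0 v
      have e2 : (‖v‖ ^ 2) ^ 2 ≤ ((2 * B) ^ 2 * ‖v‖ ^ 2) * q := by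
        have h3 := norm_sum_mul_sq_le (s ×ˢ cancTypes d)
          (fun x => starRingEnd 𝕜 (b x.1 x.2 * inner 𝕜 (haar 𝕜 ω x.1 0) v))
          (fun x => inner 𝕜 (haar 𝕜 ω x.1 x.2) f)
        rw [← e1, inner_self_eq_norm_sq_to_K, Finset.sum_product, Finset.sum_product] at h3
        simp only [RCLike.norm_conj] at h3
        rw [norm_pow, RCLike.norm_ofReal, abs_norm] at h3
        exact h3.trans (mul_le_mul_of_nonneg_right (hb.embedding hB s v) hq0)
      by_cases hv0 : ‖v‖ = 0
      · rw [hv0]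
        have := mul_nonneg (sq_nonneg (2 * B)) hq0
        simpa using this
      · have hvp : 0 < ‖v‖ ^ 2 := by positivity
        refine le_of_mul_le_mul_right ?_ hvp
        nlinarith

/-- The coefficients of the adjoint shift. -/
def adjCoeff (a : ShiftCoeff 𝕜 d) : ShiftCoeff 𝕜 d := fun I J K η η' =>
  starRingEnd 𝕜 (a J I K η' η)

theorem inner_averagingOp (ω : Omega d) (i j : ℕ) (a : ShiftCoeff 𝕜 d) (K : DCube d)
    (f g : L2 𝕜 d) :
    inner 𝕜 g (averagingOp ω i j a K f) = ∑ I ∈ desc ω K i, ∑ J ∈ desc ω K j, ∑ η, ∑ η',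
      a I J K η η' * inner 𝕜 (haar 𝕜 ω I η) f * inner 𝕜 g (haar 𝕜 ω J η') := by
  simp only [averagingOp_eq, inner_sum, inner_smul_right]

theorem inner_averagingOp_adjCoeff (ω : Omega d) (i j : ℕ) (a : ShiftCoeff 𝕜 d) (K : DCube d)
    (f g : L2 𝕜 d) :
    inner 𝕜 g (averagingOp ω i j (adjCoeff a) K f) =
      starRingEnd 𝕜 (inner 𝕜 f (averagingOp ω j i a K g)) := by
  rw [inner_averagingOp, inner_averagingOp]
  simp only [map_sum, map_mul, inner_conj_symm]
  rw [Finset.sum_comm]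
  refine Finset.sum_congr rfl fun J _ => Finset.sum_congr rfl fun I _ => ?_
  rw [Finset.sum_comm]
  refine Finset.sum_congr rfl fun η' _ => Finset.sum_congr rfl fun η _ => ?_
  rw [adjCoeff]
  ring

theorem isCancellative_adjCoeff {a : ShiftCoeff 𝕜 d} (ha : a.IsCancellative) :
    (adjCoeff a).IsCancellative := by
  intro I J K η η' h
  rw [adjCoeff, ha J I K η' η h.symm, map_zero]

theorem adjCoeff_bound {ω : Omega d} {i j : ℕ} {a : ShiftCoeff 𝕜 d} {M : ℝ}
    (h : ∀ K, ∀ I ∈ descendants ω K i, ∀ J ∈ descendants ω K j,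
      ∑ η : Fin d → Fin 2, ∑ η' : Fin d → Fin 2, ‖a I J K η η'‖ ≤ M * ratio d ^ (i + j)) :
    ∀ K, ∀ I ∈ descendants ω K j, ∀ J ∈ descendants ω K i,
      ∑ η : Fin d → Fin 2, ∑ η' : Fin d → Fin 2, ‖adjCoeff a I J K η η'‖ ≤
        M * ratio d ^ (j + i) := by
  intro K I hI J hJ
  rw [Finset.sum_comm, add_comm j i]
  simp only [adjCoeff, RCLike.norm_conj]
  exact h K J hJ I hI

end ShiftConstructions


/-! ### Estimates for moduli of continuity -/

section Moduli

variable {φ ψ : ℝ → ℝ} {d : ℕ}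

theorem IsModulus.nonneg (h : IsModulus ψ) {t : ℝ} (h0 : 0 ≤ t) (h1 : t ≤ 1) : 0 ≤ ψ t := by
  rw [← h.map_zero]
  exact h.strictMono.monotoneOn ⟨le_rfl, zero_le_one⟩ ⟨h0, h1⟩ h0

theorem IsModulus.mono (h : IsModulus ψ) {s t : ℝ} (h0 : 0 ≤ s) (hst : s ≤ t) (h1 : t ≤ 1) :
    ψ s ≤ ψ t :=
  h.strictMono.monotoneOn ⟨h0, hst.trans h1⟩ ⟨h0.trans hst, h1⟩ hst

theorem IsModulus.div_anti (h : IsModulus ψ) {s t : ℝ} (h0 : 0 < s) (hst : s ≤ t) (h1 : t ≤ 1) :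
    ψ t / t ≤ ψ s / s :=
  h.antitone_div ⟨h0, hst.trans h1⟩ ⟨h0.trans_le hst, h1⟩ hst

theorem IsModulus.le_self (h : IsModulus ψ) {t : ℝ} (h0 : 0 < t) (h1 : t ≤ 1) : t ≤ ψ t := by
  have := h.div_anti h0 h1 le_rfl
  rwa [h.map_one, div_one, one_le_div h0] at this

theorem IsModulus.pos (h : IsModulus ψ) {t : ℝ} (h0 : 0 < t) (h1 : t ≤ 1) : 0 < ψ t :=
  h0.trans_le (h.le_self h0 h1)

theorem IsModulus.le_one (h : IsModulus ψ) {t : ℝ} (h0 : 0 ≤ t) (h1 : t ≤ 1) : ψ t ≤ 1 := by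
  rw [← h.map_one]
  exact h.mono h0 h1 le_rfl

/-- Monotonicity handles v ≤ u, and the decrease of ψ(t)/t handles v ≥ u. So constants inside ψ can
be moved outside. -/
theorem IsModulus.le_mul (h : IsModulus ψ) {u v A : ℝ} (hu : 0 < u) (hu1 : u ≤ 1) (hv : 0 ≤ v)
    (hv1 : v ≤ 1) (hA : 1 ≤ A) (hvu : v ≤ A * u) : ψ v ≤ A * ψ u := by
  have hp := h.pos hu hu1
  rcases le_total v u with hc | hc
  · exact (h.mono hv hc hu1).trans (by nlinarith)
  · have hv0 : 0 < v := hu.trans_le hc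
    have h2 := h.div_anti hu hc hv1
    rw [div_le_div_iff₀ hv0 hu] at h2
    have h3 : ψ v * u ≤ A * ψ u * u := by nlinarith
    exact le_of_mul_le_mul_right h3 hu

theorem IsModulus.intervalIntegrable (h : IsModulus ψ) {a b : ℝ} (ha : 0 ≤ a) (hb : 0 ≤ b)
    (ha1 : a ≤ 1) (hb1 : b ≤ 1) : IntervalIntegrable (fun s => ψ s / s) volume a b := by
  have h1 : IntervalIntegrable (fun s => ψ s / s) volume 0 1 :=
    (intervalIntegrable_iff_integrableOn_Ioc_of_le zero_le_one).2 h.dini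
  refine h1.mono_set ?_
  rw [uIcc_of_le (zero_le_one : (0 : ℝ) ≤ 1)]
  exact uIcc_subset_Icc ⟨ha, ha1⟩ ⟨hb, hb1⟩

theorem bigPsi_sub (h : IsModulus ψ) {a b : ℝ} (ha : 0 ≤ a) (hb : 0 ≤ b)
    (ha1 : a ≤ 1) (hb1 : b ≤ 1) : bigPsi ψ b - bigPsi ψ a = ∫ s in a..b, ψ s / s :=
  intervalIntegral.integral_interval_sub_left
    (h.intervalIntegrable le_rfl hb zero_le_one hb1)
    (h.intervalIntegrable le_rfl ha zero_le_one ha1)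

/-- The integrand ψ(s)/s is at least its value at the right endpoint. -/
theorem bigPsi_sub_ge (h : IsModulus ψ) {a b : ℝ} (ha : 0 ≤ a) (hab : a ≤ b)
    (hb1 : b ≤ 1) : (b - a) * (ψ b / b) ≤ bigPsi ψ b - bigPsi ψ a := by
  rw [bigPsi_sub h ha (ha.trans hab) (hab.trans hb1) hb1]
  have h1 : ∫ _ in a..b, ψ b / b = (b - a) * (ψ b / b) := by
    rw [intervalIntegral.integral_const, smul_eq_mul]
  rw [← h1]
  refine intervalIntegral.integral_mono_on_of_le_Ioo hab intervalIntegrable_const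
    (h.intervalIntegrable ha (ha.trans hab) (hab.trans hb1) hb1) fun s hs => ?_
  exact h.div_anti (ha.trans_lt hs.1) hs.2.le hb1

theorem bigPsi_sub_le (h : IsModulus ψ) {a b : ℝ} (ha : 0 < a) (hab : a ≤ b)
    (hb1 : b ≤ 1) : bigPsi ψ b - bigPsi ψ a ≤ (b - a) * (ψ a / a) := by
  rw [bigPsi_sub h ha.le (ha.le.trans hab) (hab.trans hb1) hb1]
  have h1 : ∫ _ in a..b, ψ a / a = (b - a) * (ψ a / a) := by
    rw [intervalIntegral.integral_const, smul_eq_mul]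
  rw [← h1]
  refine intervalIntegral.integral_mono_on_of_le_Ioo hab
    (h.intervalIntegrable ha.le (ha.le.trans hab) (hab.trans hb1) hb1)
    intervalIntegrable_const fun s hs => ?_
  exact h.div_anti ha hs.1.le (hs.2.le.trans hb1)

theorem bigPsi_zero (ψ : ℝ → ℝ) : bigPsi ψ 0 = 0 := intervalIntegral.integral_same

theorem le_bigPsi (h : IsModulus ψ) {u : ℝ} (hu : 0 < u) (hu1 : u ≤ 1) : ψ u ≤ bigPsi ψ u := by
  have := bigPsi_sub_ge h le_rfl hu.le hu1
  rwa [bigPsi_zero, sub_zero, sub_zero, mul_div_cancel₀ _ hu.ne'] at this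

theorem bigPsi_mono (h : IsModulus ψ) {a b : ℝ} (ha : 0 ≤ a) (hab : a ≤ b) (hb1 : b ≤ 1) :
    bigPsi ψ a ≤ bigPsi ψ b := by
  have h1 := bigPsi_sub_ge h ha hab hb1
  have h2 : 0 ≤ (b - a) * (ψ b / b) :=
    mul_nonneg (by linarith) (div_nonneg (h.nonneg (ha.trans hab) hb1) (ha.trans hab))
  linarith

theorem bigPsi_le_mul (h : IsModulus ψ) {u v A : ℝ} (hu : 0 < u) (hu1 : u ≤ 1) (hv : 0 ≤ v)
    (hv1 : v ≤ 1) (hA : 1 ≤ A) (hvu : v ≤ A * u) : bigPsi ψ v ≤ A * bigPsi ψ u := by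
  have hle := le_bigPsi h hu hu1
  have hp := h.pos hu hu1
  rcases le_total v u with hc | hc
  · exact (bigPsi_mono h hv hc hu1).trans (by nlinarith)
  · have h2 := bigPsi_sub_le h hu hc hv1
    have h3 : (v - u) * (ψ u / u) ≤ (A - 1) * ψ u := by
      rw [mul_div_assoc', div_le_iff₀ hu]
      nlinarith
    nlinarith

/-- The argument `t / φ(t)`, `t = 2^{-j}`, of the coefficients `τ`. -/
def relScale (φ : ℝ → ℝ) (j : ℕ) : ℝ := (2 : ℝ)⁻¹ ^ j / φ ((2 : ℝ)⁻¹ ^ j)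

theorem half_pow_pos (j : ℕ) : (0 : ℝ) < (2 : ℝ)⁻¹ ^ j := by positivity

theorem half_pow_le_one (j : ℕ) : (2 : ℝ)⁻¹ ^ j ≤ 1 := pow_le_one₀ (by norm_num) (by norm_num)

theorem relScale_pos (h : IsModulus φ) (j : ℕ) : 0 < relScale φ j :=
  div_pos (half_pow_pos j) (h.pos (half_pow_pos j) (half_pow_le_one j))

theorem relScale_le_one (h : IsModulus φ) (j : ℕ) : relScale φ j ≤ 1 :=
  (div_le_one (h.pos (half_pow_pos j) (half_pow_le_one j))).2
    (h.le_self (half_pow_pos j) (half_pow_le_one j))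

theorem relScale_zero (h : IsModulus φ) : relScale φ 0 = 1 := by
  simp [relScale, h.map_one]

theorem half_pow_le_relScale (h : IsModulus φ) (j : ℕ) : (2 : ℝ)⁻¹ ^ j ≤ relScale φ j := by
  have h1 := h.pos (half_pow_pos j) (half_pow_le_one j)
  have h2 := h.le_one (half_pow_pos j).le (half_pow_le_one j)
  rw [relScale, le_div_iff₀ h1]
  exact mul_le_of_le_one_right (half_pow_pos j).le h2

/-- The numerator halves exactly while φ does not increase. It is used to pass from the failed
condition at N - 1 to the scale of N. -/
theorem relScale_le_two_mul (h : IsModulus φ) (j : ℕ) :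
    relScale φ j ≤ 2 * relScale φ (j + 1) := by
  have h1 := h.pos (half_pow_pos (j + 1)) (half_pow_le_one (j + 1))
  have h2 : φ ((2 : ℝ)⁻¹ ^ (j + 1)) ≤ φ ((2 : ℝ)⁻¹ ^ j) :=
    h.mono (half_pow_pos _).le (pow_le_pow_of_le_one (by norm_num) (by norm_num) (Nat.le_succ j))
      (half_pow_le_one j)
  have h3 : 2 * relScale φ (j + 1) = (2 : ℝ)⁻¹ ^ j / φ ((2 : ℝ)⁻¹ ^ (j + 1)) := by
    unfold relScale
    rw [pow_succ (2 : ℝ)⁻¹ j]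
    ring
  rw [h3]
  exact div_le_div_of_nonneg_left (half_pow_pos j).le h1 h2

theorem tau_zero_left (d : ℕ) (φ ψ : ℝ → ℝ) (j : ℕ) : tau d φ ψ 0 j = bigPsi ψ (relScale φ j) := by
  simp [tau, relScale]

theorem tau_of_le (d : ℕ) (φ ψ : ℝ → ℝ) {i j : ℕ} (hi : 0 < i) (hij : i ≤ j) :
    tau d φ ψ i j = (φ ((2 : ℝ)⁻¹ ^ j) ^ d)⁻¹ * ψ (relScale φ j) := by
  rw [tau, max_eq_right hij, min_eq_left hij, if_pos hi, relScale]

theorem tau_comm (d : ℕ) (φ ψ : ℝ → ℝ) (i j : ℕ) : tau d φ ψ i j = tau d φ ψ j i := by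
  unfold tau
  rw [max_comm, min_comm]

theorem tau_pos (hφ : IsModulus φ) (hψ : IsModulus ψ) (i j : ℕ) : 0 < tau d φ ψ i j := by
  wlog hij : i ≤ j generalizing i j
  · rw [tau_comm]
    exact this j i (le_of_not_ge hij)
  have h1 := hψ.pos (relScale_pos hφ j) (relScale_le_one hφ j)
  rcases Nat.eq_zero_or_pos i with rfl | hi
  · rw [tau_zero_left]
    exact h1.trans_le (le_bigPsi hψ (relScale_pos hφ j) (relScale_le_one hφ j))
  · rw [tau_of_le d φ ψ hi hij]
    have := hφ.pos (half_pow_pos j) (half_pow_le_one j)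
    positivity

theorem one_le_tau_zero_zero (hφ : IsModulus φ) (hψ : IsModulus ψ) : 1 ≤ tau d φ ψ 0 0 := by
  rw [tau_zero_left, relScale_zero hφ]
  have := le_bigPsi hψ one_pos le_rfl
  rwa [hψ.map_one] at this

/-- The smallest number of generations after which two cubes in the relative position `m` have a
common ancestor with probability at least `1/2`, measured by `φ`. -/
def ancGen (φ : ℝ → ℝ) {d : ℕ} (m : Fin d → ℤ) : ℕ :=
  sInf {N : ℕ | 1 ≤ N ∧ 2 * d * ‖m‖ ≤ φ ((2 : ℝ)⁻¹ ^ N) * 2 ^ N}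

/-- The assumption φ(t)/t → ∞ makes the defining set nonempty, so its infimum is attained and is not
the default value 0. -/
theorem ancGen_mem (hφ' : Tendsto (fun t => φ t / t) (𝓝[>] 0) atTop) (m : Fin d → ℤ) :
    ancGen φ m ∈ {N : ℕ | 1 ≤ N ∧ 2 * d * ‖m‖ ≤ φ ((2 : ℝ)⁻¹ ^ N) * 2 ^ N} := by
  refine Nat.sInf_mem ?_
  have h1 : Tendsto (fun N : ℕ => (2 : ℝ)⁻¹ ^ N) atTop (𝓝[>] 0) :=
    tendsto_nhdsWithin_iff.2 ⟨tendsto_pow_atTop_nhds_zero_of_lt_one (by norm_num) (by norm_num),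
      Eventually.of_forall half_pow_pos⟩
  obtain ⟨N, hN, hN1⟩ := (((hφ'.comp h1).eventually_ge_atTop (2 * d * ‖m‖)).and
    (eventually_ge_atTop 1)).exists
  refine ⟨N, hN1, ?_⟩
  simpa [Function.comp, div_eq_mul_inv] using hN

theorem one_le_ancGen (hφ' : Tendsto (fun t => φ t / t) (𝓝[>] 0) atTop) (m : Fin d → ℤ) :
    1 ≤ ancGen φ m := (ancGen_mem hφ' m).1

theorem ancGen_spec (hφ' : Tendsto (fun t => φ t / t) (𝓝[>] 0) atTop) (m : Fin d → ℤ) :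
    2 * d * ‖m‖ ≤ φ ((2 : ℝ)⁻¹ ^ ancGen φ m) * 2 ^ ancGen φ m := (ancGen_mem hφ' m).2

theorem one_le_norm_int_vec {m : Fin d → ℤ} (hm : m ≠ 0) : 1 ≤ ‖m‖ := by
  obtain ⟨n, hn⟩ := Function.ne_iff.1 hm
  refine le_trans ?_ (norm_le_pi_norm m n)
  rw [Int.norm_eq_abs]
  exact_mod_cast Int.one_le_abs hn

/-- By minimality of `ancGen` the inequality fails at j - 1, so |m| exceeds
φ(2^{-(j-1)})2^{j-1}/(2d). One doubling step leads to the scale of j. -/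
theorem inv_norm_le_relScale (hφ : IsModulus φ) (hd : 0 < d) {m : Fin d → ℤ} (hm : m ≠ 0) {j : ℕ}
    (hj : j ≤ ancGen φ m) : ‖m‖⁻¹ ≤ 4 * d * relScale φ j := by
  have h1 := one_le_norm_int_vec hm
  have hd1 : (1 : ℝ) ≤ d := by exact_mod_cast hd
  have hinv : ‖m‖⁻¹ ≤ 1 := inv_le_one_of_one_le₀ h1
  by_cases hj2 : 2 ≤ j
  · obtain ⟨n, rfl⟩ : ∃ n, j = n + 1 := ⟨j - 1, by omega⟩
    have h2 : n ∉ {N : ℕ | 1 ≤ N ∧ 2 * d * ‖m‖ ≤ φ ((2 : ℝ)⁻¹ ^ N) * 2 ^ N} :=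
      Nat.notMem_of_lt_sInf (by unfold ancGen at hj; omega)
    rw [mem_ofPred_eq, not_and, not_le] at h2
    have h3 := h2 (by omega)
    have hp := hφ.pos (half_pow_pos n) (half_pow_le_one n)
    have h4 := relScale_le_two_mul hφ n
    have h5 : relScale φ n = (φ ((2 : ℝ)⁻¹ ^ n) * 2 ^ n)⁻¹ := by
      unfold relScale
      rw [mul_inv, inv_pow, div_eq_mul_inv, mul_comm]
    have h6 : (2 * d * ‖m‖)⁻¹ ≤ relScale φ n := by
      rw [h5]
      exact inv_anti₀ (by positivity) h3.le
    have h7 : ‖m‖⁻¹ = 2 * d * (2 * d * ‖m‖)⁻¹ := by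
      field_simp
    rw [h7]
    nlinarith
  -- For j ≤ 1 minimality says nothing, because the defining set requires N ≥ 1. Here the scale is
  -- bounded below by 1/2 and the claim is trivial.
  · have h2 := half_pow_le_relScale hφ j
    have h3 : (2 : ℝ)⁻¹ ≤ (2 : ℝ)⁻¹ ^ j := by
      interval_cases j <;> norm_num
    nlinarith

/-- The size of the matrix coefficients at the relative position `m`. -/
def decay (ψ : ℝ → ℝ) {d : ℕ} (m : Fin d → ℤ) : ℝ := (‖m‖ ^ d)⁻¹ * ψ ‖m‖⁻¹

theorem inv_norm_le_one (m : Fin d → ℤ) : ‖m‖⁻¹ ≤ 1 := by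
  rcases eq_or_ne m 0 with rfl | hm
  · simp
  · exact inv_le_one_of_one_le₀ (one_le_norm_int_vec hm)

theorem decay_nonneg (hψ : IsModulus ψ) (m : Fin d → ℤ) : 0 ≤ decay ψ m :=
  mul_nonneg (by positivity) (hψ.nonneg (by positivity) (inv_norm_le_one m))

/-- With u = 2^{-j}/φ(2^{-j}), the product 2^{-jd} τ(i,j) is exactly u^d ψ(u), while 1/|m| ≤ 4d u.
The d + 1 factors 4d come from the power and from ψ. -/
theorem decay_le (hφ : IsModulus φ) (hψ : IsModulus ψ) (hd : 0 < d) {m : Fin d → ℤ} (hm : m ≠ 0)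
    {i j : ℕ} (hi : 0 < i) (hij : i ≤ j) (hj : j ≤ ancGen φ m) :
    decay ψ m ≤ (4 * d) ^ (d + 1) * (((2 : ℝ) ^ d)⁻¹ ^ j * tau d φ ψ i j) := by
  have h1 := inv_norm_le_relScale hφ hd hm hj
  have hd1 : (1 : ℝ) ≤ d := by exact_mod_cast hd
  have h2 := hψ.le_mul (relScale_pos hφ j) (relScale_le_one hφ j) (by positivity)
    (inv_norm_le_one m) (by linarith : (1 : ℝ) ≤ 4 * d) h1
  have h3 := hψ.nonneg (relScale_pos hφ j).le (relScale_le_one hφ j)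
  have h4 := relScale_pos hφ j
  have h5 : ((2 : ℝ) ^ d)⁻¹ ^ j = ((2 : ℝ)⁻¹ ^ j) ^ d := by
    rw [← inv_pow, ← pow_mul, ← pow_mul, mul_comm]
  rw [decay, tau_of_le d φ ψ hi hij, ← inv_pow]
  calc ‖m‖⁻¹ ^ d * ψ ‖m‖⁻¹ ≤ (4 * d * relScale φ j) ^ d * (4 * d * ψ (relScale φ j)) := by
        gcongr
        exact hψ.nonneg (by positivity) (inv_norm_le_one m)
    _ = _ := by
        rw [mul_pow, h5]
        conv_lhs => rw [relScale, div_pow, div_eq_mul_inv]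
        rw [← relScale]
        ring

/-- On [2^{-k-1}, 2^{-k}] the integral of ψ(s)/s is at least ψ(2^{-k})/2. The sum is compared with Ψ
block by block. -/
theorem sum_Ico_le_bigPsi (hψ : IsModulus ψ) {l n : ℕ} (hln : l ≤ n) :
    ∑ k ∈ Finset.Ico l n, ψ ((2 : ℝ)⁻¹ ^ k) ≤ 2 * bigPsi ψ ((2 : ℝ)⁻¹ ^ l) := by
  suffices h : ∑ k ∈ Finset.Ico l n, ψ ((2 : ℝ)⁻¹ ^ k) ≤
      2 * (bigPsi ψ ((2 : ℝ)⁻¹ ^ l) - bigPsi ψ ((2 : ℝ)⁻¹ ^ n)) by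
    have h1 : 0 ≤ bigPsi ψ ((2 : ℝ)⁻¹ ^ n) :=
      (hψ.nonneg (half_pow_pos n).le (half_pow_le_one n)).trans
        (le_bigPsi hψ (half_pow_pos n) (half_pow_le_one n))
    linarith
  induction n, hln using Nat.le_induction with
  | base => simp
  | succ n hn ih =>
    rw [Finset.sum_Ico_succ_top hn]
    have hp := half_pow_pos n
    have h1 := bigPsi_sub_ge hψ (half_pow_pos (n + 1)).le
      (pow_le_pow_of_le_one (by norm_num) (by norm_num) (Nat.le_succ n)) (half_pow_le_one n)
    have h2 : ((2 : ℝ)⁻¹ ^ n - (2 : ℝ)⁻¹ ^ (n + 1)) * (ψ ((2 : ℝ)⁻¹ ^ n) / (2 : ℝ)⁻¹ ^ n) =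
        ψ ((2 : ℝ)⁻¹ ^ n) / 2 := by
      rw [pow_succ]
      field_simp
      ring
    rw [h2] at h1
    linarith

/-- The dyadic size of a vector. -/
def dyadicSize (m : Fin d → ℤ) : ℕ := Nat.log 2 ⌊‖m‖⌋₊

theorem two_pow_dyadicSize_le {m : Fin d → ℤ} (hm : m ≠ 0) : (2 : ℝ) ^ dyadicSize m ≤ ‖m‖ := by
  have h1 := one_le_norm_int_vec hm
  have h2 : ⌊‖m‖⌋₊ ≠ 0 := (Nat.floor_pos.2 h1).ne'
  have h3 : 2 ^ dyadicSize m ≤ ⌊‖m‖⌋₊ := Nat.pow_log_le_self 2 h2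
  calc (2 : ℝ) ^ dyadicSize m ≤ (⌊‖m‖⌋₊ : ℝ) := by exact_mod_cast h3
    _ ≤ ‖m‖ := Nat.floor_le (norm_nonneg m)

theorem norm_lt_two_pow_dyadicSize (m : Fin d → ℤ) : ‖m‖ < 2 ^ (dyadicSize m + 1) := by
  have h3 : ⌊‖m‖⌋₊ + 1 ≤ 2 ^ (dyadicSize m + 1) := Nat.lt_pow_succ_log_self (by norm_num) _
  calc ‖m‖ < ⌊‖m‖⌋₊ + 1 := Nat.lt_floor_add_one _
    _ ≤ 2 ^ (dyadicSize m + 1) := by exact_mod_cast h3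

theorem card_dyadicSize_le (s : Finset (Fin d → ℤ)) (l : ℕ) :
    ((s.filter fun m => dyadicSize m = l).card : ℝ) ≤ 8 ^ d * (2 ^ l) ^ d := by
  have hsub : (s.filter fun m => dyadicSize m = l) ⊆
      Fintype.piFinset fun _ : Fin d => Finset.Icc (-(2 ^ (l + 1) : ℤ)) (2 ^ (l + 1)) := by
    intro m hm
    rw [Finset.mem_filter] at hm
    rw [Fintype.mem_piFinset]
    intro n
    have h1 := (norm_le_pi_norm m n).trans (norm_lt_two_pow_dyadicSize m).le
    rw [hm.2, Int.norm_eq_abs] at h1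
    have h2 : |m n| ≤ 2 ^ (l + 1) := by exact_mod_cast h1
    rw [Finset.mem_Icc]
    exact abs_le.1 h2
  have h1 := Finset.card_le_card hsub
  rw [Fintype.card_piFinset_const, Int.card_Icc] at h1
  have h2 : (2 ^ (l + 1) + 1 - -(2 ^ (l + 1) : ℤ)).toNat ≤ 8 * 2 ^ l := by
    have h3 : (1 : ℤ) ≤ 2 ^ l := one_le_pow₀ (by norm_num)
    zify
    rw [Int.toNat_of_nonneg (by rw [pow_succ]; linarith), pow_succ]
    linarith
  have h4 : (s.filter fun m => dyadicSize m = l).card ≤ (8 * 2 ^ l) ^ d := by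
    exact h1.trans (Nat.pow_le_pow_left h2 d)
  rw [← mul_pow]
  exact_mod_cast h4

/-- The shell |m| ~ 2^l contains about 2^{ld} points, each contributing 2^{-ld} ψ(2^{-l}). Summing
over shells gives Ψ at the smallest shell that occurs, and that shell is controlled by
`inv_norm_le_relScale`. -/
theorem sum_decay_le (hφ : IsModulus φ) (hψ : IsModulus ψ) (hd : 0 < d) (j : ℕ)
    (s : Finset (Fin d → ℤ)) (hs : ∀ m ∈ s, m ≠ 0 ∧ j ≤ ancGen φ m) :
    ∑ m ∈ s, decay ψ m ≤ 2 * 8 ^ (d + 1) * d * bigPsi ψ (relScale φ j) := by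
  have hd1 : (1 : ℝ) ≤ d := by exact_mod_cast hd
  have hu := relScale_pos hφ j
  have hu1 := relScale_le_one hφ j
  have hP : 0 ≤ bigPsi ψ (relScale φ j) := (hψ.nonneg hu.le hu1).trans (le_bigPsi hψ hu hu1)
  rcases s.eq_empty_or_nonempty with rfl | hne
  · simp only [Finset.sum_empty]
    positivity
  obtain ⟨m₀, hm₀, hmin⟩ := s.exists_min_image dyadicSize hne
  obtain ⟨m₁, hm₁, hmax⟩ := s.exists_max_image dyadicSize hne
  have h1 : ∀ m ∈ s, dyadicSize m ∈ Finset.Ico (dyadicSize m₀) (dyadicSize m₁ + 1) := fun m hm =>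
    Finset.mem_Ico.2 ⟨hmin m hm, Nat.lt_succ_of_le (hmax m hm)⟩
  have h2 : ∀ m ∈ s, decay ψ m ≤ (((2 : ℝ) ^ dyadicSize m) ^ d)⁻¹ *
      ψ ((2 : ℝ)⁻¹ ^ dyadicSize m) := by
    intro m hm
    have h3 := two_pow_dyadicSize_le (hs m hm).1
    have h4 : ‖m‖⁻¹ ≤ (2 : ℝ)⁻¹ ^ dyadicSize m := by
      rw [inv_pow]
      exact inv_anti₀ (by positivity) h3
    unfold decay
    refine mul_le_mul ?_ (hψ.mono (by positivity) h4 (half_pow_le_one _))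
      (hψ.nonneg (by positivity) (inv_norm_le_one m)) (by positivity)
    exact inv_anti₀ (by positivity) (pow_le_pow_left₀ (by positivity) h3 d)
  calc ∑ m ∈ s, decay ψ m
      = ∑ l ∈ Finset.Ico (dyadicSize m₀) (dyadicSize m₁ + 1),
          ∑ m ∈ s.filter fun m => dyadicSize m = l, decay ψ m :=
        (Finset.sum_fiberwise_of_maps_to h1 _).symm
    _ ≤ ∑ l ∈ Finset.Ico (dyadicSize m₀) (dyadicSize m₁ + 1), 8 ^ d * ψ ((2 : ℝ)⁻¹ ^ l) := by
        refine Finset.sum_le_sum fun l _ => ?_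
        have h3 : ∀ m ∈ s.filter fun m => dyadicSize m = l,
            decay ψ m ≤ (((2 : ℝ) ^ l) ^ d)⁻¹ * ψ ((2 : ℝ)⁻¹ ^ l) := by
          intro m hm
          rw [Finset.mem_filter] at hm
          rw [← hm.2]
          exact h2 m hm.1
        refine (Finset.sum_le_card_nsmul _ _ _ h3).trans ?_
        rw [nsmul_eq_mul]
        have h4 := hψ.nonneg (half_pow_pos l).le (half_pow_le_one l)
        have h5 : 0 ≤ (((2 : ℝ) ^ l) ^ d)⁻¹ * ψ ((2 : ℝ)⁻¹ ^ l) := by positivity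
        refine (mul_le_mul_of_nonneg_right (card_dyadicSize_le s l) h5).trans (le_of_eq ?_)
        field_simp
    _ ≤ 8 ^ d * (2 * bigPsi ψ ((2 : ℝ)⁻¹ ^ dyadicSize m₀)) := by
        rw [← Finset.mul_sum]
        exact mul_le_mul_of_nonneg_left
          (sum_Ico_le_bigPsi hψ ((hmin m₁ hm₁).trans (Nat.le_succ _))) (by positivity)
    _ ≤ 8 ^ d * (2 * (8 * d * bigPsi ψ (relScale φ j))) := by
        have h3 := inv_norm_le_relScale hφ hd (hs m₀ hm₀).1 (hs m₀ hm₀).2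
        have h4 := norm_lt_two_pow_dyadicSize m₀
        have h5 := one_le_norm_int_vec (hs m₀ hm₀).1
        have h6 : (2 : ℝ)⁻¹ ^ dyadicSize m₀ ≤ 8 * d * relScale φ j := by
          have h7 : ((2 : ℝ) ^ (dyadicSize m₀ + 1))⁻¹ ≤ ‖m₀‖⁻¹ :=
            inv_anti₀ (by linarith) h4.le
          have h8 : (2 : ℝ)⁻¹ ^ dyadicSize m₀ = 2 * ((2 : ℝ) ^ (dyadicSize m₀ + 1))⁻¹ := by
            rw [← inv_pow, pow_succ]
            ring
          rw [h8]
          linarith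
        have := bigPsi_le_mul hψ hu hu1 (half_pow_pos _).le (half_pow_le_one _)
          (by linarith : (1 : ℝ) ≤ 8 * d) h6
        gcongr
    _ = _ := by ring

theorem decay_zero (hd : 0 < d) (ψ : ℝ → ℝ) : decay ψ (0 : Fin d → ℤ) = 0 := by
  simp [decay, hd.ne']

theorem sum_decay_le_one (hψ : IsModulus ψ) (hd : 0 < d) (s : Finset (Fin d → ℤ)) :
    ∑ m ∈ s, decay ψ m ≤ 2 * 8 ^ (d + 1) * d * bigPsi ψ 1 := by
  -- No auxiliary scale is involved when j = 0: the condition on `ancGen` is empty and the scale is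
  -- 1, so any modulus may stand in for φ.
  have h := sum_decay_le (φ := ψ) hψ hψ hd 0 (s.filter fun m => m ≠ 0) fun m hm =>
    ⟨(Finset.mem_filter.1 hm).2, Nat.zero_le _⟩
  rw [relScale_zero hψ] at h
  refine le_trans (le_of_eq ?_) h
  rw [Finset.sum_filter]
  refine Finset.sum_congr rfl fun m _ => ?_
  split_ifs with hm
  · rfl
  · rw [not_not.1 hm, decay_zero hd]

theorem summable_decay (hψ : IsModulus ψ) (hd : 0 < d) :
    Summable fun m : Fin d → ℤ => decay ψ m :=
  summable_of_sum_le (decay_nonneg hψ) (sum_decay_le_one hψ hd)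

theorem tsum_decay_le (hψ : IsModulus ψ) (hd : 0 < d) :
    ∑' m : Fin d → ℤ, decay ψ m ≤ 2 * 8 ^ (d + 1) * d * bigPsi ψ 1 :=
  (summable_decay hψ hd).tsum_le_of_sum_le (sum_decay_le_one hψ hd)

end Moduli


/-! ### Calderón–Zygmund kernels -/

section Kernel

variable {𝕜 : Type*} [RCLike 𝕜] {d : ℕ} {ψ : ℝ → ℝ}

/-- The sets `A` and `B` have positive distance. -/
def Separated (A B : Set (Fin d → ℝ)) : Prop := ∃ δ > 0, ∀ x ∈ A, ∀ y ∈ B, δ ≤ ‖x - y‖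

theorem Separated.symm {A B : Set (Fin d → ℝ)} (h : Separated A B) : Separated B A := by
  obtain ⟨δ, hδ, h⟩ := h
  exact ⟨δ, hδ, fun x hx y hy => by rw [norm_sub_rev]; exact h y hy x hx⟩

/-- The bilinear form of `T` on separated cubes is given by the measurable kernel `K`, with
constant `C` both in the `L²` bound and in the regularity estimate. -/
structure WeakCZ (ψ : ℝ → ℝ) (C : ℝ) (T : L2 𝕜 d →L[𝕜] L2 𝕜 d)
    (K : (Fin d → ℝ) → (Fin d → ℝ) → 𝕜) : Prop where
  norm_le : ‖T‖ ≤ C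
  meas : StronglyMeasurable fun p : (Fin d → ℝ) × (Fin d → ℝ) => K p.1 p.2
  size : ∃ C₀, IsSizeBound K C₀
  reg : IsRegularityBound K ψ C
  ker : ∀ (a : Fin d → ℝ) (l : ℝ) (b : Fin d → ℝ) (l' : ℝ), 0 < l → 0 < l' →
    Separated (cubeAt a l) (cubeAt b l') →
    inner 𝕜 (ind 𝕜 a l) (T (ind 𝕜 b l')) = ∫ x in cubeAt a l, ∫ y in cubeAt b l', K x y

/-- The Dini condition makes Ψ continuous at 0 and ψ ≤ Ψ, so ψ tends to 0 there. Continuity of ψ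
itself is not among the axioms. -/
theorem IsModulus.exists_lt (h : IsModulus ψ) {ε : ℝ} (hε : 0 < ε) :
    ∃ s, 0 < s ∧ s < 1 / 2 ∧ ψ s < ε := by
  have h1 : ContinuousOn (bigPsi ψ) (Icc 0 1) := by
    have := intervalIntegral.continuousOn_primitive_interval (μ := volume) (f := fun s => ψ s / s)
      (a := (0 : ℝ)) (b := 1) (by
        rw [uIcc_of_le zero_le_one, integrableOn_Icc_iff_integrableOn_Ioc]
        exact h.dini)
    rw [uIcc_of_le (zero_le_one : (0 : ℝ) ≤ 1)] at this
    exact this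
  have h2 := (h1 0 ⟨le_rfl, zero_le_one⟩).mono (Ioc_subset_Icc_self)
  rw [ContinuousWithinAt, bigPsi_zero, nhdsWithin_Ioc_eq_nhdsGT zero_lt_one] at h2
  have h3 : ∀ᶠ s in 𝓝[>] (0 : ℝ), s ∈ Ioo (0 : ℝ) (1 / 2) := Ioo_mem_nhdsGT (by norm_num)
  obtain ⟨s, hs, hs2⟩ := ((h2.eventually_lt_const hε).and h3).exists
  exact ⟨s, hs2.1, hs2.2, (le_bigPsi h hs2.1 (by linarith [hs2.2])).trans_lt hs⟩

/-- The infimum is attained because each inequality is linear in the constant. Where the factor of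
the constant is zero, any admissible constant gives the claim. -/
theorem czNorm_isRegularityBound {K : (Fin d → ℝ) → (Fin d → ℝ) → 𝕜}
    (h : ∃ C, IsRegularityBound K ψ C) (hψ : IsModulus ψ) :
    IsRegularityBound K ψ (czNorm K ψ) := by
  obtain ⟨C₁, hC₁⟩ := h
  refine ⟨Real.sInf_nonneg fun C hC => hC.1, fun x x' y hxy => ?_⟩
  set q : ℝ := ψ (‖x - x'‖ / ‖x - y‖) / ‖x - y‖ ^ d with hq
  have hq' : ∀ C : ℝ, C / ‖x - y‖ ^ d * ψ (‖x - x'‖ / ‖x - y‖) = C * q := fun C => by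
    rw [hq]; ring
  have hq0 : 0 ≤ q := by
    have h0 : 0 < ‖x - y‖ := lt_of_le_of_lt (by positivity) hxy
    refine div_nonneg (hψ.nonneg (by positivity) ((div_le_one h0).2 ?_)) (by positivity)
    linarith [norm_nonneg (x - x')]
  rw [hq']
  rcases hq0.eq_or_lt with h0 | h0
  · have := hC₁.2 x x' y hxy
    rw [hq', ← h0, mul_zero] at this
    rwa [← h0, mul_zero]
  · rw [← div_le_iff₀ h0]
    refine le_csInf ⟨C₁, hC₁⟩ fun C hC => ?_
    rw [div_le_iff₀ h0, ← hq']
    exact hC.2 x x' y hxy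

/-- Since ψ(s) → 0, the regularity estimate makes K continuous off the diagonal. The purpose is
measurability of K, needed for Fubini. -/
theorem IsRegularityBound.continuousOn {K : (Fin d → ℝ) → (Fin d → ℝ) → 𝕜} {C : ℝ}
    (h : IsRegularityBound K ψ C) (hψ : IsModulus ψ) :
    ContinuousOn (fun p : (Fin d → ℝ) × (Fin d → ℝ) => K p.1 p.2) {p | p.1 ≠ p.2} := by
  rw [Metric.continuousOn_iff]
  rintro ⟨x₀, y₀⟩ hne ε hε
  have hr : 0 < ‖x₀ - y₀‖ := norm_pos_iff.2 (sub_ne_zero.2 hne)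
  set r := ‖x₀ - y₀‖ with hrdef
  have hC := h.1
  obtain ⟨s, hs0, hs1, hs⟩ := hψ.exists_lt (ε := ε / (2 * (C * (2 / r) ^ d) + 1)) (by positivity)
  refine ⟨s * r / 2, by positivity, ?_⟩
  rintro ⟨x, y⟩ - hdist
  rw [Prod.dist_eq, max_lt_iff, dist_eq_norm, dist_eq_norm] at hdist
  simp only at hdist ⊢
  obtain ⟨hx, hy⟩ := hdist
  have hsr : s * r / 2 < r / 4 := by nlinarith
  have hxy : r / 2 ≤ ‖x₀ - y‖ := by
    have : r ≤ ‖x₀ - y‖ + ‖y - y₀‖ := by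
      rw [hrdef]
      calc ‖x₀ - y₀‖ = ‖(x₀ - y) + (y - y₀)‖ := by congr 1; abel
        _ ≤ _ := norm_add_le _ _
    linarith
  have hψs := hψ.nonneg hs0.le (by linarith : s ≤ 1)
  have key : ∀ u v : Fin d → ℝ, ∀ t : ℝ, r / 2 ≤ ‖u - v‖ → t < s * r / 2 → 0 ≤ t →
      C / ‖u - v‖ ^ d * ψ (t / ‖u - v‖) ≤ C * (2 / r) ^ d * ψ s := by
    intro u v t huv ht ht0
    have hp : 0 < ‖u - v‖ := by linarith
    have hts : t / ‖u - v‖ ≤ s := by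
      rw [div_le_iff₀ hp]
      nlinarith
    refine mul_le_mul ?_ (hψ.mono (by positivity) hts (by linarith))
      (hψ.nonneg (by positivity) (by linarith)) (by positivity)
    rw [div_eq_mul_inv, ← inv_pow]
    refine mul_le_mul_of_nonneg_left (pow_le_pow_left₀ (by positivity) ?_ d) hC
    rw [inv_le_comm₀ hp (by positivity), inv_div]
    exact huv
  -- One variable is moved at a time. The first difference uses the first term of the regularity
  -- estimate, the second uses its transposed term.
  have h1 := h.2 x₀ x y (by rw [norm_sub_rev x₀ x]; linarith)
  have h2 := h.2 y₀ y x₀ (by rw [norm_sub_rev y₀ y, norm_sub_rev y₀ x₀]; linarith)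
  have k1 := key x₀ y ‖x₀ - x‖ hxy (by rw [norm_sub_rev]; exact hx) (norm_nonneg _)
  have k2 := key y₀ x₀ ‖y₀ - y‖ (by rw [norm_sub_rev]; linarith)
    (by rw [norm_sub_rev]; exact hy) (norm_nonneg _)
  rw [dist_eq_norm]
  calc ‖K x y - K x₀ y₀‖ = ‖-(K x₀ y - K x y) + -(K x₀ y₀ - K x₀ y)‖ := by congr 1; abel
    _ ≤ ‖K x₀ y - K x y‖ + ‖K x₀ y₀ - K x₀ y‖ := by
        refine (norm_add_le _ _).trans ?_
        rw [norm_neg, norm_neg]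
    _ ≤ 2 * (C * (2 / r) ^ d) * ψ s := by
        have := norm_nonneg (K y x₀ - K x x₀)
        have := norm_nonneg (K y x₀ - K y x)
        have := norm_nonneg (K y₀ x₀ - K y x₀)
        linarith
    _ < ε := by
        rw [lt_div_iff₀ (by positivity)] at hs
        nlinarith

/-- The kernel `K`, set to zero on the diagonal. -/
def offDiag (K : (Fin d → ℝ) → (Fin d → ℝ) → 𝕜) (x y : Fin d → ℝ) : 𝕜 :=
  open Classical in if x = y then 0 else K x y

theorem offDiag_of_ne (K : (Fin d → ℝ) → (Fin d → ℝ) → 𝕜) {x y : Fin d → ℝ} (h : x ≠ y) :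
    offDiag K x y = K x y := if_neg h

theorem stronglyMeasurable_offDiag {K : (Fin d → ℝ) → (Fin d → ℝ) → 𝕜}
    (h : ContinuousOn (fun p : (Fin d → ℝ) × (Fin d → ℝ) => K p.1 p.2) {p | p.1 ≠ p.2}) :
    StronglyMeasurable fun p : (Fin d → ℝ) × (Fin d → ℝ) => offDiag K p.1 p.2 := by
  classical
  have hs : MeasurableSet {p : (Fin d → ℝ) × (Fin d → ℝ) | p.1 ≠ p.2} :=
    (isClosed_eq continuous_fst continuous_snd).measurableSet.compl
  have := ContinuousOn.measurable_piecewise h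
    (continuousOn_const (c := (0 : 𝕜)) (s := {p : (Fin d → ℝ) × (Fin d → ℝ) | p.1 ≠ p.2}ᶜ)) hs
  refine Measurable.stronglyMeasurable ?_
  convert this using 1
  funext p
  by_cases hp : p.1 = p.2 <;> simp [offDiag, Set.piecewise, hp]

theorem IsRegularityBound.offDiag {K : (Fin d → ℝ) → (Fin d → ℝ) → 𝕜} {C : ℝ}
    (h : IsRegularityBound K ψ C) : IsRegularityBound (offDiag K) ψ C := by
  refine ⟨h.1, fun x x' y hxy => ?_⟩
  have h1 : x ≠ y := by
    rintro rfl
    rw [sub_self, norm_zero] at hxy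
    linarith [norm_nonneg (x - x')]
  have h2 : x' ≠ y := by
    rintro rfl
    linarith [norm_nonneg (x - x')]
  rw [offDiag_of_ne K h1, offDiag_of_ne K h2, offDiag_of_ne K h1.symm, offDiag_of_ne K h2.symm]
  exact h.2 x x' y hxy

theorem Separated.ne {A B : Set (Fin d → ℝ)} (h : Separated A B) {x y : Fin d → ℝ} (hx : x ∈ A)
    (hy : y ∈ B) : x ≠ y := by
  obtain ⟨δ, hδ, h⟩ := h
  rintro rfl
  have := h x hx x hy
  rw [sub_self, norm_zero] at this
  linarith

theorem Separated.notMem_closure {A B : Set (Fin d → ℝ)} (h : Separated A B) {x : Fin d → ℝ}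
    (hx : x ∈ A) : x ∉ closure B := by
  obtain ⟨δ, hδ, h⟩ := h
  intro hc
  obtain ⟨y, hy, hxy⟩ := Metric.mem_closure_iff.1 hc δ hδ
  rw [dist_eq_norm] at hxy
  linarith [h x hx y hy]

/-- Collects what the proof needs: the form of T on indicators of separated cubes, and one constant
‖T‖ + ‖K‖ for both estimates. Diagonal values of K are never seen by separated cubes, so they may be
set to 0. -/
theorem IsBoundedCZOperator.weakCZ (hψ : IsModulus ψ) {T : L2 𝕜 d →L[𝕜] L2 𝕜 d}
    {K : (Fin d → ℝ) → (Fin d → ℝ) → 𝕜} (h : IsBoundedCZOperator ψ T K) :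
    WeakCZ ψ (‖T‖ + czNorm K ψ) T (offDiag K) := by
  have hcz := czNorm_isRegularityBound h.regularity hψ
  refine ⟨le_add_of_nonneg_right hcz.1, stronglyMeasurable_offDiag (hcz.continuousOn hψ), ?_, ?_, ?_⟩
  · obtain ⟨C, hC⟩ := h.size
    exact ⟨C, fun x y hxy => by rw [offDiag_of_ne K hxy]; exact hC x y hxy⟩
  · refine IsRegularityBound.offDiag ⟨add_nonneg (norm_nonneg _) hcz.1, fun x x' y hxy => ?_⟩
    refine (hcz.2 x x' y hxy).trans ?_
    have h0 : 0 < ‖x - y‖ := lt_of_le_of_lt (by positivity) hxy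
    refine mul_le_mul_of_nonneg_right ?_
      (hψ.nonneg (by positivity) ((div_le_one h0).2 (by linarith [norm_nonneg (x - x')])))
    refine div_le_div_of_nonneg_right ?_ (by positivity)
    linarith [norm_nonneg T]
  · intro a l b l' _ hl' hsep
    obtain ⟨F, -, hF, hrep⟩ := h.kernel_rep
    have h1 := hrep _ (hF b l' hl' (ind 𝕜 b l') (ind_coeFn b l')) _ (ind_coeFn b l')
    rw [inner_ind]
    refine setIntegral_congr_ae (measurableSet_cubeAt a l) ?_
    filter_upwards [h1] with x hx hxa
    have h2 : x ∉ tsupport ((cubeAt b l').indicator fun _ => (1 : 𝕜)) := fun hc =>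
      hsep.notMem_closure hxa (closure_mono Set.support_indicator_subset hc)
    rw [hx h2, ← integral_indicator (measurableSet_cubeAt b l')]
    refine integral_congr_ae (Eventually.of_forall fun y => ?_)
    by_cases hy : y ∈ cubeAt b l'
    · simp [hy, offDiag_of_ne K (hsep.ne hxa hy)]
    · simp [hy]

theorem WeakCZ.exists_bound {C : ℝ} {T : L2 𝕜 d →L[𝕜] L2 𝕜 d}
    {K : (Fin d → ℝ) → (Fin d → ℝ) → 𝕜} (h : WeakCZ ψ C T K) {A B : Set (Fin d → ℝ)}
    (hAB : Separated A B) : ∃ D, ∀ x ∈ A, ∀ y ∈ B, ‖K x y‖ ≤ D := by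
  obtain ⟨C₀, hC₀⟩ := h.size
  have hne := hAB
  obtain ⟨δ, hδ, hsep⟩ := hAB
  refine ⟨|C₀| / δ ^ d, fun x hx y hy => (hC₀ x y (hne.ne hx hy)).trans ?_⟩
  calc C₀ / ‖x - y‖ ^ d ≤ |C₀| / ‖x - y‖ ^ d :=
        div_le_div_of_nonneg_right (le_abs_self _) (by positivity)
    _ ≤ |C₀| / δ ^ d := div_le_div_of_nonneg_left (abs_nonneg _) (by positivity)
        (pow_le_pow_left₀ hδ.le (hsep x hx y hy) d)

theorem WeakCZ.integrableOn {C : ℝ} {T : L2 𝕜 d →L[𝕜] L2 𝕜 d}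
    {K : (Fin d → ℝ) → (Fin d → ℝ) → 𝕜} (h : WeakCZ ψ C T K) {a b : Fin d → ℝ} {l l' : ℝ}
    (hAB : Separated (cubeAt a l) (cubeAt b l')) {x : Fin d → ℝ} (hx : x ∈ cubeAt a l) :
    IntegrableOn (K x) (cubeAt b l') := by
  obtain ⟨D, hD⟩ := h.exists_bound hAB
  refine IntegrableOn.of_bound (volume_cubeAt_ne_top b l').lt_top
    (h.meas.comp_measurable measurable_prodMk_left).aestronglyMeasurable D ?_
  exact (ae_restrict_iff' (measurableSet_cubeAt b l')).2
    (Eventually.of_forall fun y hy => hD x hx y hy)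

theorem WeakCZ.integrable_prod {C : ℝ} {T : L2 𝕜 d →L[𝕜] L2 𝕜 d}
    {K : (Fin d → ℝ) → (Fin d → ℝ) → 𝕜} (h : WeakCZ ψ C T K) {a b : Fin d → ℝ} {l l' : ℝ}
    (hAB : Separated (cubeAt a l) (cubeAt b l')) :
    Integrable (fun p : (Fin d → ℝ) × (Fin d → ℝ) => K p.1 p.2)
      ((volume.restrict (cubeAt a l)).prod (volume.restrict (cubeAt b l'))) := by
  obtain ⟨D, hD⟩ := h.exists_bound hAB
  have hs : MeasurableSet (cubeAt a l ×ˢ cubeAt b l') :=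
    (measurableSet_cubeAt a l).prod (measurableSet_cubeAt b l')
  rw [Measure.prod_restrict]
  refine IntegrableOn.of_bound ?_ h.meas.aestronglyMeasurable D ?_
  · rw [Measure.prod_prod]
    exact ENNReal.mul_lt_top (volume_cubeAt_ne_top a l).lt_top (volume_cubeAt_ne_top b l').lt_top
  · exact (ae_restrict_iff' hs).2 (Eventually.of_forall fun p hp => hD _ hp.1 _ hp.2)

/-- The adjoint has the kernel conj K(y,x), by Fubini on separated cubes. Thus every estimate for T
holds for its adjoint with the same constant. -/
theorem WeakCZ.adjoint {C : ℝ} {T : L2 𝕜 d →L[𝕜] L2 𝕜 d}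
    {K : (Fin d → ℝ) → (Fin d → ℝ) → 𝕜} (h : WeakCZ ψ C T K) :
    WeakCZ ψ C (ContinuousLinearMap.adjoint T) fun x y => starRingEnd 𝕜 (K y x) := by
  refine ⟨?_, ?_, ?_, ⟨h.reg.1, fun x x' y hxy => ?_⟩, ?_⟩
  · rw [LinearIsometryEquiv.norm_map]
    exact h.norm_le
  · exact RCLike.continuous_conj.comp_stronglyMeasurable (h.meas.comp_measurable measurable_swap)
  · obtain ⟨C₀, hC₀⟩ := h.size
    refine ⟨C₀, fun x y hxy => ?_⟩
    rw [RCLike.norm_conj, norm_sub_rev]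
    exact hC₀ y x hxy.symm
  · rw [← map_sub, ← map_sub, RCLike.norm_conj, RCLike.norm_conj, add_comm]
    exact h.reg.2 x x' y hxy
  · intro a l b l' hl hl' hsep
    have h1 := h.ker b l' a l hl' hl hsep.symm
    rw [ContinuousLinearMap.adjoint_inner_right, ← inner_conj_symm, h1, ← integral_conj]
    simp_rw [← integral_conj]
    have h2 := RCLike.continuous_conj.comp_stronglyMeasurable h.meas
    refine integral_integral_swap (f := fun x y => starRingEnd 𝕜 (K x y)) ?_
    exact (RCLike.conjCLE (K := 𝕜)).toContinuousLinearMap.integrable_comp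
      (h.integrable_prod hsep.symm)

end Kernel


/-! ### Matrix coefficients of Calderón–Zygmund operators -/

section MatrixCoefficients

variable {𝕜 : Type*} [RCLike 𝕜] {d : ℕ} {ψ : ℝ → ℝ} {C : ℝ} {T : L2 𝕜 d →L[𝕜] L2 𝕜 d}
  {K : (Fin d → ℝ) → (Fin d → ℝ) → 𝕜}

theorem mem_cubeAt {a x : Fin d → ℝ} {l : ℝ} :
    x ∈ cubeAt a l ↔ ∀ n, a n ≤ x n ∧ x n < a n + l := by
  simp [cubeAt, Set.mem_pi]

theorem norm_sub_corner_le {a x : Fin d → ℝ} {l : ℝ} (hl : 0 ≤ l) (hx : x ∈ cubeAt a l) :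
    ‖x - a‖ ≤ l := by
  rw [pi_norm_le_iff_of_nonneg hl]
  intro n
  have := mem_cubeAt.1 hx n
  rw [Pi.sub_apply, Real.norm_of_nonneg (by linarith)]
  linarith

theorem exists_norm_eq_int_vec (hd : 0 < d) (m : Fin d → ℤ) : ∃ n, ‖m‖ = |(m n : ℝ)| := by
  have : Nonempty (Fin d) := ⟨⟨0, hd⟩⟩
  obtain ⟨n, -, hn⟩ := Finset.exists_mem_eq_sup' (Finset.univ_nonempty (α := Fin d))
    (fun n => ‖m n‖₊)
  refine ⟨n, ?_⟩
  rw [← Int.norm_eq_abs, ← coe_nnnorm, ← coe_nnnorm, NNReal.coe_inj, ← hn, Finset.sup'_eq_sup]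
  exact Pi.nnnorm_def m

theorem norm_sub_ge_of_mem_cubeAt (hd : 0 < d) {a x y : Fin d → ℝ} {l : ℝ} {m : Fin d → ℤ}
    (hx : x ∈ cubeAt a l) (hy : y ∈ cubeAt (fun n => a n + l * m n) l) :
    (‖m‖ - 1) * l ≤ ‖x - y‖ := by
  obtain ⟨n, hn⟩ := exists_norm_eq_int_vec hd m
  refine le_trans ?_ (norm_le_pi_norm (x - y) n)
  rw [hn, Pi.sub_apply, Real.norm_eq_abs]
  have h1 := mem_cubeAt.1 hx n
  have h2 := mem_cubeAt.1 hy n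
  rcases le_total 0 (m n : ℝ) with h | h
  · rw [abs_of_nonneg h]
    refine le_trans ?_ (neg_abs_le _ |> fun h => neg_le.1 h)
    linarith
  · rw [abs_of_nonpos h]
    refine le_trans ?_ (le_abs_self _)
    linarith

/-- For |m| ≥ 4 points of the two cubes are at distance at least |m| l / 2, so the regularity
estimate applies with ratio at most 2/|m|. -/
theorem WeakCZ.kernel_diff_le (h : WeakCZ ψ C T K) (hψ : IsModulus ψ) (hd : 0 < d)
    {a x y : Fin d → ℝ} {l : ℝ} (hl : 0 < l) {m : Fin d → ℤ} (hm : 4 ≤ ‖m‖)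
    (hx : x ∈ cubeAt a l) (hy : y ∈ cubeAt (fun n => a n + l * m n) l) :
    ‖K x y - K a y‖ ≤ 2 ^ (d + 1) * C * decay ψ m / l ^ d := by
  have ha : a ∈ cubeAt a l := mem_cubeAt.2 fun n => ⟨le_rfl, by linarith⟩
  have h1 := norm_sub_ge_of_mem_cubeAt hd ha hy
  have h2 := norm_sub_corner_le hl.le hx
  rw [norm_sub_rev] at h2
  have hC := h.reg.1
  have h3 := h.reg.2 a x y (by nlinarith)
  have h4 : ‖K x y - K a y‖ ≤ C / ‖a - y‖ ^ d * ψ (‖a - x‖ / ‖a - y‖) := by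
    rw [norm_sub_rev]
    exact (le_add_of_nonneg_right (norm_nonneg _)).trans h3
  refine h4.trans ?_
  have h5 : ‖m‖ * l / 2 ≤ ‖a - y‖ := by nlinarith
  have h6 : 0 < ‖a - y‖ := lt_of_lt_of_le (by positivity) h5
  have h7 : ‖a - x‖ / ‖a - y‖ ≤ 1 := (div_le_one h6).2 (by nlinarith)
  have h8 : ψ (‖a - x‖ / ‖a - y‖) ≤ 2 * ψ ‖m‖⁻¹ := by
    refine hψ.le_mul (by positivity) (inv_norm_le_one m) (by positivity) h7 one_le_two ?_
    rw [div_le_iff₀ h6]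
    have h9 : 2 * ‖m‖⁻¹ * (‖m‖ * l / 2) = l := by
      field_simp
    calc ‖a - x‖ ≤ 2 * ‖m‖⁻¹ * (‖m‖ * l / 2) := by rw [h9]; exact h2
      _ ≤ _ := mul_le_mul_of_nonneg_left h5 (by positivity)
  calc C / ‖a - y‖ ^ d * ψ (‖a - x‖ / ‖a - y‖)
      ≤ C / (‖m‖ * l / 2) ^ d * (2 * ψ ‖m‖⁻¹) := by
        refine mul_le_mul ?_ h8 (hψ.nonneg (by positivity) h7) (by positivity)
        exact div_le_div_of_nonneg_left hC (by positivity)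
          (pow_le_pow_left₀ (by positivity) h5 d)
    _ = _ := by
        unfold decay
        rw [div_pow, mul_pow, pow_succ]
        field_simp

theorem WeakCZ.separated (hd : 0 < d) {a b : Fin d → ℝ} {l l' : ℝ} (hl : 0 < l)
    {m : Fin d → ℤ} (hm : 4 ≤ ‖m‖) (hb : cubeAt b l' ⊆ cubeAt (fun n => a n + l * m n) l) :
    Separated (cubeAt a l) (cubeAt b l') := by
  refine ⟨l, hl, fun x hx y hy => ?_⟩
  have := norm_sub_ge_of_mem_cubeAt hd hx (hb hy)
  nlinarith

/-- On a cube, the image of the indicator of a distant cube is the sum of a constant and a small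
function. -/
theorem WeakCZ.exists_smul_add (h : WeakCZ ψ C T K) (hψ : IsModulus ψ) (hd : 0 < d)
    {a b : Fin d → ℝ} {l l' : ℝ} (hl : 0 < l) (hl' : 0 < l') {m : Fin d → ℤ} (hm : 4 ≤ ‖m‖)
    (hb : cubeAt b l' ⊆ cubeAt (fun n => a n + l * m n) l) :
    ∃ (z : 𝕜) (u : L2 𝕜 d), ‖u‖ ≤ 2 ^ (d + 1) * C * decay ψ m * √(l ^ d) ∧
      ∀ a' l₀, 0 < l₀ → cubeAt a' l₀ ⊆ cubeAt a l →
        inner 𝕜 (ind 𝕜 a' l₀) (T (ind 𝕜 b l')) = inner 𝕜 (ind 𝕜 a' l₀) (z • ind 𝕜 a l + u) := by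
  have hsep := WeakCZ.separated hd hl hm hb
  have ha : a ∈ cubeAt a l := mem_cubeAt.2 fun n => ⟨le_rfl, by linarith⟩
  set B : ℝ := 2 ^ (d + 1) * C * decay ψ m with hB
  have hB0 : 0 ≤ B := by
    have := h.reg.1
    have := decay_nonneg hψ m
    positivity
  -- The constant part freezes the first variable of the kernel at the corner `a`. The remainder is
  -- controlled pointwise by the regularity of K.
  let z : 𝕜 := ∫ y in cubeAt b l', K a y
  let F : (Fin d → ℝ) → 𝕜 := fun x => (∫ y in cubeAt b l', K x y) - z
  have hFm : StronglyMeasurable F :=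
    (StronglyMeasurable.integral_prod_right h.meas).sub stronglyMeasurable_const
  have hFb : ∀ x ∈ cubeAt a l, ‖F x‖ ≤ B := by
    intro x hx
    have e : F x = ∫ y in cubeAt b l', (K x y - K a y) :=
      (integral_sub (h.integrableOn hsep hx) (h.integrableOn hsep ha)).symm
    rw [e]
    refine (norm_setIntegral_le_of_norm_le_const (volume_cubeAt_ne_top b l').lt_top
      (fun y hy => h.kernel_diff_le hψ hd hl hm hx (hb hy))).trans ?_
    have hv : volume.real (cubeAt b l') ≤ l ^ d := by
      rw [← volume_real_cubeAt (fun n => a n + l * m n) hl.le]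
      exact measureReal_mono hb (volume_cubeAt_ne_top _ _)
    rw [← hB]
    calc B / l ^ d * volume.real (cubeAt b l') ≤ B / l ^ d * l ^ d :=
          mul_le_mul_of_nonneg_left hv (by positivity)
      _ = B := div_mul_cancel₀ _ (by positivity)
  have hmem : MemLp ((cubeAt a l).indicator F) 2 volume := by
    refine MemLp.of_le (memLp_indicator_const 2 (measurableSet_cubeAt a l) (B : ℝ)
      (Or.inr (volume_cubeAt_ne_top a l)))
      (hFm.indicator (measurableSet_cubeAt a l)).aestronglyMeasurable
      (Eventually.of_forall fun x => ?_)
    by_cases hx : x ∈ cubeAt a l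
    · simp only [indicator_of_mem hx]
      rw [Real.norm_of_nonneg hB0]
      exact hFb x hx
    · simp [hx]
  refine ⟨z, hmem.toLp _, ?_, ?_⟩
  · have hle : ‖hmem.toLp _‖ ≤ ‖(B : 𝕜) • ind 𝕜 a l‖ := by
      refine Lp.norm_le_norm_of_ae_le ?_
      filter_upwards [hmem.coeFn_toLp, Lp.coeFn_smul (B : 𝕜) (ind 𝕜 a l), ind_coeFn (𝕜 := 𝕜) a l]
        with x h1 h2 h3
      rw [h1, h2, Pi.smul_apply, h3]
      by_cases hx : x ∈ cubeAt a l
      · simp only [indicator_of_mem hx, smul_eq_mul, mul_one]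
        rw [RCLike.norm_ofReal, abs_of_nonneg hB0]
        exact hFb x hx
      · simp [hx]
    refine hle.trans (le_of_eq ?_)
    rw [norm_smul, RCLike.norm_ofReal, abs_of_nonneg hB0, norm_ind a hl.le]
  · intro a' l₀ hl₀ hsub
    have hsep' : Separated (cubeAt a' l₀) (cubeAt b l') := by
      obtain ⟨δ, hδ, hs⟩ := hsep
      exact ⟨δ, hδ, fun x hx y hy => hs x (hsub hx) y hy⟩
    rw [h.ker a' l₀ b l' hl₀ hl' hsep', inner_ind]
    refine setIntegral_congr_ae (measurableSet_cubeAt a' l₀) ?_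
    filter_upwards [hmem.coeFn_toLp, Lp.coeFn_smul z (ind 𝕜 a l), ind_coeFn (𝕜 := 𝕜) a l,
      Lp.coeFn_add (z • ind 𝕜 a l) (hmem.toLp _)] with x h1 h2 h3 h4 hx
    rw [h4, Pi.add_apply, h1, h2, Pi.smul_apply, h3, indicator_of_mem (hsub hx),
      indicator_of_mem (hsub hx)]
    simp [F]

theorem corner_add_eq (ω : Omega d) (k : ℤ) (p q : Fin d → ℤ) :
    corner ω (k, q) = fun n => corner ω (k, p) n + side ((k, p) : DCube d) * ((q - p) n : ℤ) := by
  funext n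
  rw [corner_apply, corner_apply, side_eq, Pi.sub_apply]
  push_cast
  ring

theorem ind_eq_smul_haar (ω : Omega d) (I : DCube d) :
    ind 𝕜 (corner ω I) (side I) = ((amp I : 𝕜))⁻¹ • haar 𝕜 ω I 0 := by
  rw [haar_zero, smul_smul, inv_mul_cancel₀, one_smul]
  exact_mod_cast (amp_pos I).ne'

theorem amp_mul_sqrt (I : DCube d) : amp I * √(side I ^ d) = 1 := by
  have h1 := amp_pos I
  have h2 : 0 ≤ amp I * √(side I ^ d) := by positivity
  have h3 : (amp I * √(side I ^ d)) ^ 2 = 1 := by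
    rw [mul_pow, Real.sq_sqrt (pow_nonneg (side_pos I).le d)]
    exact amp_sq_mul I
  nlinarith

theorem anc_child (ω : Omega d) (J : DCube d) (l : ℕ) (ε : Fin d → Fin 2) :
    anc ω (l + 1) (child ω J ε) = anc ω l J := by
  rw [anc_succ', parent_child]

/-- Cancellative Haar functions below `P` see only the small part of the image of the indicator
of a cube at a distance from `P`. -/
theorem WeakCZ.exists_inner_haar_eq (h : WeakCZ ψ C T K) (hψ : IsModulus ψ) (hd : 0 < d)
    (ω : Omega d) (k : ℤ) {p q : Fin d → ℤ} (hm : 4 ≤ ‖q - p‖) {Q : DCube d}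
    (hQ : dcube ω Q ⊆ dcube ω (k, q)) :
    ∃ u : L2 𝕜 d,
      ‖u‖ ≤ 2 ^ (d + 1) * C * decay ψ (q - p) * (amp Q / amp ((k, p) : DCube d)) ∧
      ∀ l J, anc ω l J = (k, p) → ∀ η : Fin d → Fin 2, η ≠ 0 →
        inner 𝕜 (haar 𝕜 ω J η) (T (haar 𝕜 ω Q 0)) = inner 𝕜 (haar 𝕜 ω J η) u := by
  have hb : cubeAt (corner ω Q) (side Q) ⊆
      cubeAt (fun n => corner ω (k, p) n + side ((k, p) : DCube d) * ((q - p) n : ℤ))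
        (side ((k, p) : DCube d)) := by
    rw [← corner_add_eq]
    exact hQ
  obtain ⟨z, u, hu, hz⟩ := h.exists_smul_add hψ hd (side_pos ((k, p) : DCube d)) (side_pos Q) hm hb
  refine ⟨(amp Q : 𝕜) • u, ?_, ?_⟩
  · rw [norm_smul, RCLike.norm_ofReal, abs_of_pos (amp_pos Q)]
    have h1 : √(side ((k, p) : DCube d) ^ d) = 1 / amp ((k, p) : DCube d) := by
      rw [eq_div_iff (amp_pos _).ne', mul_comm]
      exact amp_mul_sqrt _
    rw [h1] at hu
    have := mul_le_mul_of_nonneg_left hu (amp_pos Q).le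
    refine this.trans (le_of_eq ?_)
    ring
  · intro l J hJ η hη
    have e1 : inner 𝕜 (haar 𝕜 ω J η) (T (ind 𝕜 (corner ω Q) (side Q))) =
        inner 𝕜 (haar 𝕜 ω J η) (z • ind 𝕜 (corner ω (k, p)) (side ((k, p) : DCube d)) + u) := by
      rw [haar_eq_sum_child ω J, sum_inner, sum_inner]
      refine Finset.sum_congr rfl fun ε _ => ?_
      rw [inner_smul_left, inner_smul_left, haar_zero, inner_smul_left, inner_smul_left]
      congr 2
      refine hz _ _ (side_pos _) ?_
      have := dcube_subset_anc ω (l + 1) (child ω J ε)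
      rwa [anc_child, hJ] at this
    -- The constant part is a multiple of the indicator of a cube containing `J`, hence orthogonal
    -- to the cancellative h_J.
    have e2 : inner 𝕜 (haar 𝕜 ω J η)
        (z • ind 𝕜 (corner ω (k, p)) (side ((k, p) : DCube d))) = 0 := by
      rw [ind_eq_smul_haar, inner_smul_right, inner_smul_right]
      have h0 : inner 𝕜 (haar 𝕜 ω (k, p) 0) (haar 𝕜 ω J η) = 0 := by
        refine inner_haar_zero_of_le ω ?_ hη
        have := anc_fst ω l J
        rw [hJ] at this
        omega
      rw [inner_eq_zero_symm.1 h0, mul_zero, mul_zero]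
    rw [haar_zero ω Q, map_smul, inner_smul_right, e1, inner_add_right, e2, zero_add,
      inner_smul_right]

theorem amp_child (ω : Omega d) (K : DCube d) (ε : Fin d → Fin 2) :
    amp K = ratio d * amp (child ω K ε) := by
  unfold amp ratio
  rw [side_child, ← mul_pow, ← mul_inv, ← Real.sqrt_mul (by norm_num)]
  congr 3
  ring

/-- For near, distinct positions the decay factor is bounded below. The trivial bound by ‖T‖ then
has the required form, with no separate treatment of neighbours. -/
theorem one_le_four_pow_mul_decay (hψ : IsModulus ψ) {m : Fin d → ℤ} (hm0 : m ≠ 0)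
    (hm : ‖m‖ < 4) : 1 ≤ 4 ^ (d + 1) * decay ψ m := by
  have h1 := one_le_norm_int_vec hm0
  have h2 : ‖m‖⁻¹ ≤ ψ ‖m‖⁻¹ := hψ.le_self (by positivity) (inv_norm_le_one m)
  have h3 : (4 : ℝ)⁻¹ ≤ ‖m‖⁻¹ := inv_anti₀ (by linarith) hm.le
  have h4 : ((4 : ℝ) ^ d)⁻¹ ≤ (‖m‖ ^ d)⁻¹ :=
    inv_anti₀ (by positivity) (pow_le_pow_left₀ (norm_nonneg m) hm.le d)
  have h5 : ((4 : ℝ) ^ d)⁻¹ * 4⁻¹ ≤ decay ψ m :=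
    mul_le_mul h4 (h3.trans h2) (by norm_num) (by positivity)
  calc (1 : ℝ) = 4 ^ (d + 1) * (((4 : ℝ) ^ d)⁻¹ * 4⁻¹) := by
        rw [pow_succ]; field_simp
    _ ≤ _ := mul_le_mul_of_nonneg_left h5 (by positivity)

theorem WeakCZ.norm_inner_haar_le (h : WeakCZ ψ C T K) (ω : Omega d) (I J : DCube d)
    (η η' : Fin d → Fin 2) : ‖(inner 𝕜 (haar 𝕜 ω J η') (T (haar 𝕜 ω I η)) : 𝕜)‖ ≤ C := by
  refine (norm_inner_le_norm _ _).trans ?_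
  rw [norm_haar, one_mul]
  refine (T.le_opNorm _).trans ?_
  rw [norm_haar, mul_one]
  exact h.norm_le

/-- Decay of the matrix coefficients between two cubes of the same size. -/
theorem WeakCZ.norm_inner_haar_le_decay (h : WeakCZ ψ C T K) (hψ : IsModulus ψ) (hd : 0 < d)
    (ω : Omega d) (k : ℤ) {p q : Fin d → ℤ} (hpq : q ≠ p) (η : Fin d → Fin 2)
    {η' : Fin d → Fin 2} (hη' : η' ≠ 0) :
    ‖(inner 𝕜 (haar 𝕜 ω (k, p) η') (T (haar 𝕜 ω (k, q) η)) : 𝕜)‖ ≤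
      4 ^ (d + 1) * C * decay ψ (q - p) := by
  have hC := h.reg.1
  have hdec := decay_nonneg hψ (q - p)
  rcases lt_or_ge ‖q - p‖ 4 with hm | hm
  · refine (h.norm_inner_haar_le ω _ _ _ _).trans ?_
    have := one_le_four_pow_mul_decay hψ (sub_ne_zero.2 hpq) hm
    nlinarith
  -- Cancellation is used on `(k, p)` only, so the function on `(k, q)` may be split into indicators
  -- of its 2^d children.
  · rw [haar_eq_sum_child ω (k, q), map_sum, inner_sum]
    have hε : ∀ ε ∈ (Finset.univ : Finset (Fin d → Fin 2)),
        ‖(inner 𝕜 (haar 𝕜 ω (k, p) η') (T (((ratio d * haarSign η ε : ℝ) : 𝕜) •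
          haar 𝕜 ω (child ω (k, q) ε) 0)) : 𝕜)‖ ≤ 2 ^ (d + 1) * C * decay ψ (q - p) := by
      intro ε _
      obtain ⟨u, hu, hu'⟩ := h.exists_inner_haar_eq hψ hd ω k hm
        (dcube_child_subset ω (k, q) ε)
      rw [map_smul, inner_smul_right, hu' 0 (k, p) rfl η' hη', norm_mul, RCLike.norm_ofReal,
        abs_mul, abs_haarSign, mul_one, abs_of_pos (ratio_pos d)]
      have h1 : ‖(inner 𝕜 (haar 𝕜 ω (k, p) η') u : 𝕜)‖ ≤ ‖u‖ := by
        refine (norm_inner_le_norm _ _).trans ?_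
        rw [norm_haar, one_mul]
      have h2 : amp (child ω (k, q) ε) / amp ((k, p) : DCube d) = (ratio d)⁻¹ := by
        have h3 : amp ((k, p) : DCube d) = amp ((k, q) : DCube d) := rfl
        rw [h3, amp_child ω (k, q) ε]
        have := amp_pos (child ω (k, q) ε)
        have := ratio_pos d
        field_simp
      rw [h2] at hu
      have h4 := mul_le_mul_of_nonneg_left (h1.trans hu) (ratio_pos d).le
      refine h4.trans (le_of_eq ?_)
      have := ratio_pos d
      field_simp
    refine (norm_sum_le_of_le _ hε).trans ?_
    rw [Finset.sum_const, Finset.card_univ, nsmul_eq_mul]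
    simp only [Fintype.card_pi, Fintype.card_fin, Finset.prod_const, Finset.card_univ]
    push_cast
    have h6 : (2 : ℝ) ^ d * 2 ^ (d + 1) ≤ 4 ^ (d + 1) := by
      rw [show (4 : ℝ) = 2 * 2 by norm_num, mul_pow]
      exact mul_le_mul_of_nonneg_right (pow_le_pow_right₀ one_le_two (Nat.le_succ d))
        (by positivity)
    have h7 : 0 ≤ C * decay ψ (q - p) := mul_nonneg hC hdec
    nlinarith

end MatrixCoefficients


/-! ### The paraproduct coefficients -/

section Paraproduct

variable {𝕜 : Type*} [RCLike 𝕜] {d : ℕ} {ψ : ℝ → ℝ} {C : ℝ} {T : L2 𝕜 d →L[𝕜] L2 𝕜 d}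
  {K : (Fin d → ℝ) → (Fin d → ℝ) → 𝕜}

/-- The paraproduct coefficient `⟨h_J^η, T1⟩`, normalized. -/
def paraB (T : L2 𝕜 d →L[𝕜] L2 𝕜 d) (ω : Omega d) (J : DCube d) (η : Fin d → Fin 2) : 𝕜 :=
  ∑' q : Fin d → ℤ, inner 𝕜 (haar 𝕜 ω J η) (T (haar 𝕜 ω (J.1, q) 0))

theorem summable_decay_sub (hψ : IsModulus ψ) (hd : 0 < d) (p : Fin d → ℤ) :
    Summable fun q : Fin d → ℤ => decay ψ (q - p) :=
  (Equiv.subRight p).summable_iff.2 (summable_decay hψ hd)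

theorem tsum_decay_sub (p : Fin d → ℤ) :
    ∑' q : Fin d → ℤ, decay ψ (q - p) = ∑' m : Fin d → ℤ, decay ψ m :=
  (Equiv.subRight p).tsum_eq (decay ψ)

/-- A summable majorant of one row of the matrix of `T`. -/
def rowBound (ψ : ℝ → ℝ) (C : ℝ) {d : ℕ} (p q : Fin d → ℤ) : ℝ :=
  4 ^ (d + 1) * C * decay ψ (q - p) + if q = p then C else 0

theorem rowBound_nonneg (hψ : IsModulus ψ) (hC : 0 ≤ C) (p q : Fin d → ℤ) :
    0 ≤ rowBound ψ C p q := by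
  have := decay_nonneg hψ (q - p)
  unfold rowBound
  split_ifs <;> positivity

theorem summable_rowBound (hψ : IsModulus ψ) (hd : 0 < d) (C : ℝ) (p : Fin d → ℤ) :
    Summable (rowBound ψ C p) :=
  ((summable_decay_sub hψ hd p).mul_left _).add
    (summable_of_ne_finset_zero (s := {p}) fun q hq => if_neg (by simpa using hq))

theorem WeakCZ.norm_inner_haar_le_rowBound (h : WeakCZ ψ C T K) (hψ : IsModulus ψ) (hd : 0 < d)
    (ω : Omega d) (k : ℤ) (p q : Fin d → ℤ) (η : Fin d → Fin 2)
    {η' : Fin d → Fin 2} (hη' : η' ≠ 0) :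
    ‖(inner 𝕜 (haar 𝕜 ω (k, p) η') (T (haar 𝕜 ω (k, q) η)) : 𝕜)‖ ≤ rowBound ψ C p q := by
  have hC := h.reg.1
  have hdec := decay_nonneg hψ (q - p)
  unfold rowBound
  split_ifs with hpq
  · have := h.norm_inner_haar_le ω (k, q) (k, p) η η'
    have h2 : 0 ≤ 4 ^ (d + 1) * C * decay ψ (q - p) := by positivity
    linarith
  · rw [add_zero]
    exact h.norm_inner_haar_le_decay hψ hd ω k hpq η hη'

theorem WeakCZ.hasSum_paraB (h : WeakCZ ψ C T K) (hψ : IsModulus ψ) (hd : 0 < d)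
    (ω : Omega d) (J : DCube d) {η : Fin d → Fin 2} (hη : η ≠ 0) :
    HasSum (fun q : Fin d → ℤ => (inner 𝕜 (haar 𝕜 ω J η) (T (haar 𝕜 ω (J.1, q) 0)) : 𝕜))
      (paraB T ω J η) :=
  (Summable.of_norm_bounded (summable_rowBound hψ hd C J.2) fun q =>
    h.norm_inner_haar_le_rowBound hψ hd ω J.1 J.2 q 0 hη).hasSum

/-- The cubes of generation `k + 1` are the children of the cubes of generation `k`. -/
def childEquiv (ω : Omega d) (k : ℤ) :
    (Fin d → ℤ) × (Fin d → Fin 2) ≃ (Fin d → ℤ) :=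
  Equiv.ofBijective (fun x => (child ω (k, x.1) x.2).2) (by
    constructor
    · rintro ⟨p, ε⟩ ⟨q, ε'⟩ hx
      have h1 : child ω (k, p) ε = child ω (k, q) ε' := Prod.ext rfl hx
      have h2 : ((k, p) : DCube d) = (k, q) := by
        rw [← parent_child ω (k, p) ε, h1, parent_child]
      have h3 : p = q := congrArg Prod.snd h2
      subst h3
      rw [child_injective ω _ h1]
    · intro q
      obtain ⟨ε, hε⟩ := exists_child_eq ω ((k + 1, q) : DCube d)
      refine ⟨((parent ω (k + 1, q)).2, ε), ?_⟩
      have h1 : ((k, (parent ω (k + 1, q)).2) : DCube d) = parent ω (k + 1, q) :=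
        Prod.ext (by simp [parent]) rfl
      show (child ω (k, (parent ω (k + 1, q)).2) ε).2 = q
      rw [h1, hε])

/-- The paraproduct coefficients can be computed with the cubes of any coarser generation. -/
theorem WeakCZ.hasSum_paraB_coarse (h : WeakCZ ψ C T K) (hψ : IsModulus ψ) (hd : 0 < d)
    (ω : Omega d) (J : DCube d) {η : Fin d → Fin 2} (hη : η ≠ 0) (l : ℕ) :
    HasSum (fun q : Fin d → ℤ => (inner 𝕜 (haar 𝕜 ω J η) (T (haar 𝕜 ω (J.1 - l, q) 0)) : 𝕜))
      (((ratio d ^ l : ℝ) : 𝕜) * paraB T ω J η) := by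
  induction l with
  | zero => simpa using h.hasSum_paraB hψ hd ω J hη
  | succ l ih =>
    have hk : J.1 - (l : ℤ) = (J.1 - ((l + 1 : ℕ) : ℤ)) + 1 := by push_cast; ring
    rw [hk] at ih
    -- The absolutely convergent series is grouped into siblings. Each group is the image of the
    -- parent's indicator up to `ratio d`, so both series compute ⟨h_J, T1⟩.
    have h1 := ((childEquiv ω (J.1 - ((l + 1 : ℕ) : ℤ))).hasSum_iff.2 ih).prod_fiberwise
      fun q => hasSum_fintype _
    have h2 := h1.mul_left ((ratio d : ℝ) : 𝕜)
    have e1 : (fun q => ((ratio d : ℝ) : 𝕜) * ∑ ε : Fin d → Fin 2,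
        inner 𝕜 (haar 𝕜 ω J η) (T (haar 𝕜 ω (child ω (J.1 - ((l + 1 : ℕ) : ℤ), q) ε) 0))) =
        fun q => inner 𝕜 (haar 𝕜 ω J η) (T (haar 𝕜 ω (J.1 - ((l + 1 : ℕ) : ℤ), q) 0)) := by
      funext q
      rw [haar_eq_sum_child ω (J.1 - ((l + 1 : ℕ) : ℤ), q), map_sum, inner_sum, Finset.mul_sum]
      refine Finset.sum_congr rfl fun ε _ => ?_
      rw [map_smul, inner_smul_right, haarSign_zero, mul_one]
    have e2 : ((ratio d ^ (l + 1) : ℝ) : 𝕜) * paraB T ω J η =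
        ((ratio d : ℝ) : 𝕜) * (((ratio d ^ l : ℝ) : 𝕜) * paraB T ω J η) := by
      rw [pow_succ]
      push_cast
      ring
    rw [e2, ← e1]
    exact h2

/-- The constant in the Carleson condition of the paraproduct coefficients. -/
def carlesonConst (d : ℕ) : ℝ := 7 ^ d + 2 ^ (d + 1) * (2 * 8 ^ (d + 1) * d)

theorem carlesonConst_pos (d : ℕ) : 0 < carlesonConst d := by
  unfold carlesonConst; positivity

/-- The vector `w` plays the part of the normalized T1 on `P`. Cubes near `P` contribute their full
image, of norm at most C each. Cubes far from `P` contribute only the small part that cancellative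
Haar functions below `P` can see, and these norms are summable. -/
theorem WeakCZ.exists_inner_eq_paraB (h : WeakCZ ψ C T K) (hψ : IsModulus ψ) (hd : 0 < d)
    (ω : Omega d) (P : DCube d) :
    ∃ w : L2 𝕜 d, ‖w‖ ≤ carlesonConst d * C * bigPsi ψ 1 ∧
      ∀ l, ∀ J ∈ desc ω P l, ∀ η : Fin d → Fin 2, η ≠ 0 →
        inner 𝕜 (haar 𝕜 ω J η) w = ((ratio d ^ l : ℝ) : 𝕜) * paraB T ω J η := by
  classical
  obtain ⟨k, p⟩ := P
  have hC := h.reg.1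
  -- The complement of this box of side 7 is exactly the set |q - p| ≥ 4 where the far estimate
  -- applies. Hence the 7^d in `carlesonConst`.
  let near : Finset (Fin d → ℤ) := Fintype.piFinset fun n => Finset.Icc (p n - 3) (p n + 3)
  have hfar : ∀ q, q ∉ near → 4 ≤ ‖q - p‖ := by
    intro q hq
    rw [Fintype.mem_piFinset] at hq
    push Not at hq
    obtain ⟨n, hn⟩ := hq
    refine le_trans ?_ (norm_le_pi_norm (q - p) n)
    rw [Int.norm_eq_abs, Pi.sub_apply]
    have h4 : (4 : ℤ) ≤ |q n - p n| := by
      rw [Finset.mem_Icc] at hn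
      rw [le_abs]
      omega
    exact_mod_cast h4
  have hu : ∀ q, ∃ u : L2 𝕜 d, ‖u‖ ≤ 2 ^ (d + 1) * C * decay ψ (q - p) ∧ (q ∈ near → u = 0) ∧
      (q ∉ near → ∀ l J, anc ω l J = (k, p) → ∀ η : Fin d → Fin 2, η ≠ 0 →
        inner 𝕜 (haar 𝕜 ω J η) (T (haar 𝕜 ω (k, q) 0)) = inner 𝕜 (haar 𝕜 ω J η) u) := by
    intro q
    by_cases hq : q ∈ near
    · refine ⟨0, ?_, fun _ => rfl, fun hc => absurd hq hc⟩
      rw [norm_zero]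
      have := decay_nonneg hψ (q - p)
      positivity
    · obtain ⟨u, h1, h2⟩ := h.exists_inner_haar_eq hψ hd ω k (hfar q hq) (Q := (k, q)) le_rfl
      have h3 : amp ((k, q) : DCube d) / amp ((k, p) : DCube d) = 1 := div_self (amp_pos _).ne'
      rw [h3, mul_one] at h1
      exact ⟨u, h1, fun hc => absurd hc hq, fun _ => h2⟩
  choose u hu1 hu2 hu3 using hu
  have hsb : Summable fun q : Fin d → ℤ => 2 ^ (d + 1) * C * decay ψ (q - p) :=
    (summable_decay_sub hψ hd p).mul_left _
  have hus : Summable u := Summable.of_norm_bounded hsb hu1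
  refine ⟨T (∑ q ∈ near, haar 𝕜 ω (k, q) 0) + ∑' q, u q, ?_, ?_⟩
  · have n1 : ‖T (∑ q ∈ near, haar 𝕜 ω (k, q) 0)‖ ≤ C * 7 ^ d := by
      have hcard : near.card = 7 ^ d := by
        rw [Fintype.card_piFinset, Finset.prod_congr rfl (g := fun _ => 7)]
        · simp
        · intro n _
          rw [Int.card_Icc]
          omega
      refine (T.le_of_opNorm_le h.norm_le _).trans (mul_le_mul_of_nonneg_left ?_ hC)
      refine (norm_sum_le _ _).trans (le_of_eq ?_)
      simp [norm_haar, hcard]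
    have n2 : ‖∑' q, u q‖ ≤ 2 ^ (d + 1) * C * (2 * 8 ^ (d + 1) * d * bigPsi ψ 1) := by
      refine (tsum_of_norm_bounded hsb.hasSum hu1).trans ?_
      rw [tsum_mul_left, tsum_decay_sub]
      exact mul_le_mul_of_nonneg_left (tsum_decay_le hψ hd) (by positivity)
    -- The near part is free of ψ. Since Ψ(1) ≥ ψ(1) = 1, it can be absorbed into a multiple of Ψ(1)
    -- = τ(0,0).
    have hP : 1 ≤ bigPsi ψ 1 := by
      have := le_bigPsi hψ one_pos le_rfl
      rwa [hψ.map_one] at this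
    have n3 : C * 7 ^ d ≤ C * 7 ^ d * bigPsi ψ 1 :=
      le_mul_of_one_le_right (by positivity) hP
    refine (norm_add_le _ _).trans ((add_le_add (n1.trans n3) n2).trans (le_of_eq ?_))
    unfold carlesonConst
    ring
  · intro l J hJ η hη
    rw [mem_desc] at hJ
    have hk : J.1 - (l : ℤ) = k := by rw [← anc_fst ω l J, hJ]
    have h1 := h.hasSum_paraB_coarse hψ hd ω J hη l
    rw [hk] at h1
    have h2 : HasSum (fun q => if q ∈ near then
        (inner 𝕜 (haar 𝕜 ω J η) (T (haar 𝕜 ω (k, q) 0)) : 𝕜) else 0)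
        (∑ q ∈ near, inner 𝕜 (haar 𝕜 ω J η) (T (haar 𝕜 ω (k, q) 0))) := by
      have h6 : HasSum (fun q => if q ∈ near then
          (inner 𝕜 (haar 𝕜 ω J η) (T (haar 𝕜 ω (k, q) 0)) : 𝕜) else 0)
          (∑ q ∈ near, if q ∈ near then
            (inner 𝕜 (haar 𝕜 ω J η) (T (haar 𝕜 ω (k, q) 0)) : 𝕜) else 0) :=
        hasSum_sum_of_ne_finset_zero fun q hq => if_neg hq
      rwa [Finset.sum_congr rfl fun q hq => if_pos hq] at h6
    have h3 : HasSum (fun q => (inner 𝕜 (haar 𝕜 ω J η) (u q) : 𝕜))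
        (inner 𝕜 (haar 𝕜 ω J η) (∑' q, u q)) := (innerSL 𝕜 (haar 𝕜 ω J η)).hasSum hus.hasSum
    have h4 := h2.add h3
    have h5 : (fun q => (if q ∈ near then
        (inner 𝕜 (haar 𝕜 ω J η) (T (haar 𝕜 ω (k, q) 0)) : 𝕜) else 0) +
          inner 𝕜 (haar 𝕜 ω J η) (u q)) =
        fun q => inner 𝕜 (haar 𝕜 ω J η) (T (haar 𝕜 ω (k, q) 0)) := by
      funext q
      split_ifs with hq
      · rw [hu2 q hq, inner_zero_right, add_zero]
      · rw [zero_add, hu3 q hq l J hJ η hη]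
    rw [h5] at h4
    rw [inner_add_right, map_sum, inner_sum]
    exact h4.unique h1

/-- The weights 2^{-dl} of the Carleson sum are the squares of the factors `ratio d ^ l`. The sum is
therefore Bessel's sum for the vector `w` of `exists_inner_eq_paraB`. -/
theorem WeakCZ.isCarleson (h : WeakCZ ψ C T K) (hψ : IsModulus ψ) (hd : 0 < d) (ω : Omega d) :
    IsCarleson ω (paraB T ω) (carlesonConst d * C * bigPsi ψ 1) := by
  classical
  intro n P
  obtain ⟨w, hw, hJ⟩ := h.exists_inner_eq_paraB hψ hd ω P
  refine le_trans ?_ (pow_le_pow_left₀ (norm_nonneg w) hw 2)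
  refine le_trans (le_of_eq ?_)
    (sum_inner_haar_sq_le ω ((Finset.range (n + 1)).biUnion fun l => desc ω P l) w)
  rw [Finset.sum_biUnion]
  · unfold carlesonSum
    refine Finset.sum_congr rfl fun l _ => ?_
    rw [Finset.mul_sum]
    refine Finset.sum_congr rfl fun J hJl => ?_
    rw [Finset.mul_sum]
    refine Finset.sum_congr rfl fun η hη => ?_
    rw [hJ l J hJl η (mem_cancTypes.1 hη), norm_mul, RCLike.norm_ofReal, mul_pow, sq_abs,
      ← ratio_sq]
    ring
  · intro l _ l' _ hne
    refine Finset.disjoint_left.2 fun J h1 h2 => hne ?_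
    have a1 := anc_fst ω l J
    have a2 := anc_fst ω l' J
    rw [mem_desc.1 h1] at a1
    rw [mem_desc.1 h2] at a2
    omega

end Paraproduct


/-! ### Probability of the good event -/

section Probability

open ProbabilityTheory

variable {d : ℕ}

instance isProbabilityMeasure_prob : IsProbabilityMeasure (prob d) := by
  unfold prob; infer_instance

/-- Flip all the bits of level `l`. -/
def flipAt (l : ℤ) (ω : Omega d) : Omega d := fun j => if j = l then fun n => ω j n + 1 else ω j

theorem measurePreserving_flipAt (l : ℤ) : MeasurePreserving (flipAt l) (prob d) (prob d) := by
  let e : (Fin d → Fin 2) ≃ (Fin d → Fin 2) := Equiv.piCongrRight fun _ => Equiv.addRight 1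
  let f : ℤ → (Fin d → Fin 2) → (Fin d → Fin 2) := fun j => if j = l then e else id
  have hf : ∀ j, Measurable (f j) := fun j => measurable_of_finite _
  have h1 : (flipAt l : Omega d → Omega d) = fun ω j => f j (ω j) := by
    funext ω j
    simp only [flipAt, f]
    split_ifs <;> rfl
  have h2 : ∀ j, ((PMF.uniformOfFintype (Fin d → Fin 2)).toMeasure).map (f j) =
      (PMF.uniformOfFintype (Fin d → Fin 2)).toMeasure := by
    intro j
    simp only [f]
    split_ifs
    · rw [PMF.toMeasure_map (hf := measurable_of_finite _)]
      congr 1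
      ext x
      rw [PMF.map_apply, tsum_eq_single (e.symm x)]
      · simp
      · intro y hy
        rw [if_neg]
        rintro rfl
        simp at hy
    · exact Measure.map_id
  rw [h1]
  refine ⟨by fun_prop, ?_⟩
  unfold prob
  rw [Measure.infinitePi_map_pi _ hf]
  congr 1
  funext j
  exact h2 j

theorem anc_succ_snd (ω : Omega d) (N : ℕ) (I : DCube d) (n : Fin d) :
    (anc ω (N + 1) I).2 n = ((anc ω N I).2 n - ((ω (I.1 - N) n : ℕ) : ℤ)) / 2 := by
  rw [anc_succ, parent, anc_fst]

theorem measurable_anc_snd (N : ℕ) (I : DCube d) (n : Fin d) :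
    Measurable fun ω : Omega d => (anc ω N I).2 n := by
  induction N with
  | zero => simp only [anc_zero]; exact measurable_const
  | succ N ih =>
    simp only [anc_succ_snd]
    have h1 : Measurable fun ω : Omega d => ((ω (I.1 - N) n : ℕ) : ℤ) :=
      (measurable_of_finite fun b : Fin 2 => ((b : ℕ) : ℤ)).comp
        ((measurable_pi_apply n).comp (measurable_pi_apply (I.1 - (N : ℤ))))
    exact (Measurable.of_discrete (f := fun z : ℤ => z / 2)).comp (ih.sub h1)

/-- The ancestors of generation at least `I.1 - N` only depend on the levels above `I.1 - N`. -/
theorem anc_congr {ω ω' : Omega d} {N : ℕ} {I : DCube d}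
    (h : ∀ j, I.1 - N < j → j ≤ I.1 → ω j = ω' j) : anc ω N I = anc ω' N I := by
  induction N with
  | zero => rfl
  | succ N ih =>
    have h1 := ih fun j hj hj' => h j (by push_cast; omega) hj'
    rw [anc_succ, anc_succ, h1, parent, parent, anc_fst, h _ (by push_cast; omega) (by omega)]

/-- The `ℓ¹` distance of the `N`-th ancestors. -/
def ancDist (ω : Omega d) (N : ℕ) (I J : DCube d) : ℕ :=
  ∑ n, ((anc ω N J).2 n - (anc ω N I).2 n).natAbs

theorem measurable_ancDist (N : ℕ) (I J : DCube d) :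
    Measurable fun ω : Omega d => ancDist ω N I J :=
  Finset.measurable_sum _ fun n _ => (Measurable.of_discrete (f := Int.natAbs)).comp
    ((measurable_anc_snd N J n).sub (measurable_anc_snd N I n))

/-- For integers a, b the differences ⌊(a-w)/2⌋ - ⌊(b-w)/2⌋ with w = 0 and w = 1 add up to a - b,
and neither has the opposite sign. So the absolute values add up as well. -/
theorem ancDist_add_flipAt (ω : Omega d) (N : ℕ) {I J : DCube d} (h : I.1 = J.1) :
    ancDist ω (N + 1) I J + ancDist (flipAt (I.1 - N) ω) (N + 1) I J = ancDist ω N I J := by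
  have hc : ∀ I' : DCube d, I'.1 = I.1 → anc (flipAt (I.1 - N) ω) N I' = anc ω N I' := by
    intro I' hI'
    refine anc_congr fun j hj _ => ?_
    unfold flipAt
    rw [if_neg (by omega)]
  unfold ancDist
  rw [← Finset.sum_add_distrib]
  refine Finset.sum_congr rfl fun n _ => ?_
  simp only [anc_succ_snd]
  rw [hc I rfl, hc J h.symm, ← h]
  have h2 : ((flipAt (I.1 - N) ω (I.1 - N) n : ℕ) : ℤ) = 1 - ((ω (I.1 - N) n : ℕ) : ℤ) := by
    unfold flipAt
    rw [if_pos rfl]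
    generalize ω (I.1 - N) n = b
    fin_cases b <;> rfl
  rw [h2]
  have h3 := (ω (I.1 - N) n).2
  omega

/-- Flipping one level preserves the measure, so the distance and its flipped version have the same
mean. Each generation therefore halves the expectation exactly. -/
theorem lintegral_ancDist (N : ℕ) {I J : DCube d} (h : I.1 = J.1) :
    2 ^ N * ∫⁻ ω, (ancDist ω N I J : ENNReal) ∂(prob d) =
      ((∑ n, (J.2 n - I.2 n).natAbs : ℕ) : ENNReal) := by
  induction N with
  | zero => simp [ancDist]
  | succ N ih =>
    rw [← ih, pow_succ, mul_assoc]
    congr 1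
    have hm : Measurable fun ω : Omega d => (ancDist ω (N + 1) I J : ENNReal) :=
      Measurable.of_discrete.comp (measurable_ancDist (N + 1) I J)
    have h1 := (measurePreserving_flipAt (d := d) (I.1 - N)).lintegral_comp hm
    rw [two_mul]
    nth_rewrite 2 [← h1]
    rw [← lintegral_add_left hm]
    refine lintegral_congr fun ω => ?_
    rw [← ancDist_add_flipAt ω N h]
    push_cast
    rfl

/-- The probability that the cubes `(k, p)` and `(k, q)` have a common ancestor `N` generations
above. -/
def commonProb (N : ℕ) (I J : DCube d) : ℝ := (prob d).real {ω | anc ω N I = anc ω N J}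

theorem anc_eq_iff (ω : Omega d) (N : ℕ) {I J : DCube d} (h : I.1 = J.1) :
    anc ω N I = anc ω N J ↔ ∀ n, (anc ω N I).2 n = (anc ω N J).2 n := by
  constructor
  · intro h n; rw [h]
  · intro h'
    refine Prod.ext ?_ (funext h')
    rw [anc_fst, anc_fst, h]

theorem measurableSet_anc_eq (N : ℕ) {I J : DCube d} (h : I.1 = J.1) :
    MeasurableSet {ω : Omega d | anc ω N I = anc ω N J} := by
  have : {ω : Omega d | anc ω N I = anc ω N J} =
      ⋂ n, {ω | (anc ω N I).2 n = (anc ω N J).2 n} := by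
    ext ω
    simp [anc_eq_iff ω N h]
  rw [this]
  exact MeasurableSet.iInter fun n =>
    measurableSet_eq_fun (measurable_anc_snd N I n) (measurable_anc_snd N J n)

/-- Markov's inequality for the integer-valued distance: it is at least 1 when the ancestors differ,
and its mean is at most d|m| 2^{-N} ≤ 1/2. -/
theorem half_le_commonProb {N : ℕ} {I J : DCube d} (h : I.1 = J.1)
    (hN : 2 * d * ‖J.2 - I.2‖ ≤ 2 ^ N) : 1 / 2 ≤ commonProb N I J := by
  have hms := measurableSet_anc_eq (d := d) N h
  have h1 : (prob d) {ω | anc ω N I = anc ω N J}ᶜ ≤ ∫⁻ ω, (ancDist ω N I J : ENNReal) ∂(prob d) := by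
    rw [← lintegral_indicator_one hms.compl]
    refine lintegral_mono fun ω => ?_
    by_cases hω : anc ω N I = anc ω N J
    · rw [indicator_of_notMem (by simpa using hω)]
      exact zero_le
    · rw [indicator_of_mem (by simpa using hω)]
      rw [anc_eq_iff ω N h] at hω
      push Not at hω
      obtain ⟨n, hn⟩ := hω
      have h2 : 1 ≤ ancDist ω N I J := by
        refine le_trans ?_ (Finset.single_le_sum (fun _ _ => Nat.zero_le _) (Finset.mem_univ n))
        omega
      exact Nat.one_le_cast.2 h2
  have h3 : (2 * (∑ n, (J.2 n - I.2 n).natAbs) : ℕ) ≤ 2 ^ N := by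
    have h4 : ((2 * (∑ n, (J.2 n - I.2 n).natAbs) : ℕ) : ℝ) ≤ 2 ^ N := by
      refine le_trans ?_ hN
      push_cast
      rw [mul_assoc]
      refine mul_le_mul_of_nonneg_left ?_ (by norm_num)
      refine (Finset.sum_le_sum (g := fun _ => ‖J.2 - I.2‖) fun n _ => ?_).trans (by simp)
      refine le_trans (le_of_eq ?_) (norm_le_pi_norm (J.2 - I.2) n)
      rw [Int.norm_eq_abs, Pi.sub_apply, Nat.cast_natAbs]
      push_cast
      rfl
    exact_mod_cast h4
  have h5 : 2 * (prob d) {ω | anc ω N I = anc ω N J}ᶜ ≤ 1 := by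
    have h6 := lintegral_ancDist (d := d) N h
    have h7 : 2 ^ N * (2 * (prob d) {ω | anc ω N I = anc ω N J}ᶜ) ≤ 2 ^ N * 1 := by
      calc _ ≤ 2 * (2 ^ N * ∫⁻ ω, (ancDist ω N I J : ENNReal) ∂(prob d)) := by
            rw [mul_left_comm]; gcongr
        _ ≤ _ := by
            rw [h6, mul_one]
            exact_mod_cast h3
    exact (ENNReal.mul_le_mul_iff_right (by simp) (by simp)).1 h7
  have h8 : 2 * (prob d).real {ω | anc ω N I = anc ω N J}ᶜ ≤ 1 := by
    have := ENNReal.toReal_mono (by simp) h5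
    rwa [ENNReal.toReal_mul, ENNReal.toReal_one] at this
  rw [probReal_compl_eq_one_sub hms] at h8
  unfold commonProb
  linarith

/-! ### Independence of the scales -/

/-- Keep the levels up to `k`. -/
def lowPart (k : ℤ) (ω : Omega d) : Omega d := fun j => if j ≤ k then ω j else 0

/-- Keep the levels above `k`. -/
def highPart (k : ℤ) (ω : Omega d) : Omega d := fun j => if k < j then ω j else 0

theorem shiftVec_highPart (ω : Omega d) (k : ℤ) : shiftVec (highPart k ω) k = shiftVec ω k := by
  funext n
  unfold shiftVec highPart
  refine tsum_congr fun l => ?_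
  rw [if_pos (by omega)]

/-- Ancestors of a cube of generation k read only levels up to k, whereas the positions of cubes of
generation k read only levels above k. -/
theorem anc_lowPart (ω : Omega d) (N : ℕ) (I : DCube d) : anc (lowPart I.1 ω) N I = anc ω N I :=
  anc_congr fun _ _ hj => if_pos hj

theorem indepFun_lowPart_highPart (k : ℤ) :
    IndepFun (lowPart (d := d) k) (highPart k) (prob d) := by
  have h0 : iIndepFun (fun (j : ℤ) (ω : Omega d) => ω j) (prob d) :=
    iIndepFun_infinitePi (X := fun (_ : ℤ) (x : Fin d → Fin 2) => x)
      fun _ => measurable_id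
  have h1 := indep_iSup_of_disjoint (fun j => (measurable_pi_apply j).comap_le) h0
    (S := {j : ℤ | j ≤ k}) (T := {j : ℤ | k < j})
    (Set.disjoint_left.2 fun j (hj : j ≤ k) (hj' : k < j) => absurd hj' hj.not_gt)
  have key : ∀ (S : Set ℤ) (f : Omega d → Omega d), (∀ j, j ∈ S → ∀ ω, f ω j = ω j) →
      (∀ j, j ∉ S → ∀ ω, f ω j = 0) →
      MeasurableSpace.comap f inferInstance ≤
        ⨆ j ∈ S, MeasurableSpace.comap (fun ω : Omega d => ω j) inferInstance := by
    intro S f hf hf'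
    rw [← measurable_iff_comap_le]
    refine @measurable_pi_lambda _ _ _ (_) _ _ fun j => ?_
    by_cases hj : j ∈ S
    · rw [show (fun ω => f ω j) = fun ω : Omega d => ω j from funext (hf j hj)]
      rw [measurable_iff_comap_le]
      exact le_iSup₂_of_le j hj le_rfl
    · rw [show (fun ω => f ω j) = fun _ : Omega d => 0 from funext (hf' j hj)]
      exact measurable_const
  exact indep_of_indep_of_le_left (indep_of_indep_of_le_right h1
    (key _ _ (fun j hj ω => if_pos hj) fun j hj ω => if_neg hj))
    (key _ _ (fun j hj ω => if_pos hj) fun j hj ω => if_neg hj)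

variable {𝕜 : Type*} [RCLike 𝕜]

/-- The normalized indicator of the event that `I` and `J` have a common ancestor `N` generations
above. -/
def commonWeight (N : ℕ) (I J : DCube d) (ω : Omega d) : ℝ :=
  if anc ω N I = anc ω N J then (commonProb N I J)⁻¹ else 0

/-- The weight and the function of the translation depend on disjoint sets of independent levels.
The expectation of the product factors, and the weight has mean 1. -/
theorem integral_commonWeight_mul {N : ℕ} {k : ℤ} {p q : Fin d → ℤ}
    (hN : 2 * d * ‖q - p‖ ≤ 2 ^ N) {G : (Fin d → ℝ) → 𝕜} (hG : Continuous G) :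
    ∫ ω, ((commonWeight N (k, p) (k, q) ω : ℝ) : 𝕜) * G (shiftVec ω k) ∂(prob d) =
      ∫ ω, G (shiftVec ω k) ∂(prob d) := by
  have hP := half_le_commonProb (I := (k, p)) (J := (k, q)) rfl hN
  have hms := measurableSet_anc_eq (d := d) N (I := (k, p)) (J := (k, q)) rfl
  have hw : Measurable (commonWeight (d := d) N (k, p) (k, q)) :=
    Measurable.ite hms measurable_const measurable_const
  have hlow : ∀ ω : Omega d,
      commonWeight N (k, p) (k, q) (lowPart k ω) = commonWeight N (k, p) (k, q) ω := by
    intro ω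
    unfold commonWeight
    have e1 := anc_lowPart ω N (k, p)
    have e2 := anc_lowPart ω N (k, q)
    simp only at e1 e2
    simp only [e1, e2]
  have hi : IndepFun (fun ω : Omega d => ((commonWeight N (k, p) (k, q) ω : ℝ) : 𝕜))
      (fun ω => G (shiftVec ω k)) (prob d) := by
    have h1 := (indepFun_lowPart_highPart (d := d) k).comp
      (φ := fun ω => ((commonWeight N (k, p) (k, q) ω : ℝ) : 𝕜)) (ψ := fun ω => G (shiftVec ω k))
      (RCLike.measurable_ofReal.comp hw) (hG.measurable.comp (measurable_shiftVec k))
    have e1 : (fun ω : Omega d => ((commonWeight N (k, p) (k, q) ω : ℝ) : 𝕜)) ∘ lowPart k =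
        fun ω => ((commonWeight N (k, p) (k, q) ω : ℝ) : 𝕜) := by
      funext ω
      simp only [Function.comp, hlow]
    have e2 : (fun ω : Omega d => G (shiftVec ω k)) ∘ highPart k = fun ω => G (shiftVec ω k) := by
      funext ω
      simp only [Function.comp, shiftVec_highPart]
    rwa [e1, e2] at h1
  rw [hi.integral_fun_mul_eq_mul_integral
    (RCLike.measurable_ofReal.comp hw).aestronglyMeasurable
    (hG.measurable.comp (measurable_shiftVec k)).aestronglyMeasurable]
  have h2 : ∫ ω, ((commonWeight N (k, p) (k, q) ω : ℝ) : 𝕜) ∂(prob d) = 1 := by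
    rw [integral_ofReal]
    have : ∫ ω, commonWeight N (k, p) (k, q) ω ∂(prob d) = 1 := by
      have e1 : commonWeight N (k, p) (k, q) = {ω : Omega d | anc ω N (k, p) =
          anc ω N (k, q)}.indicator fun _ => (commonProb N (k, p) (k, q))⁻¹ := by
        funext ω
        simp [commonWeight, indicator_apply]
      rw [e1, integral_indicator_const _ hms, smul_eq_mul]
      exact mul_inv_cancel₀ (by unfold commonProb at hP; linarith)
    rw [this, RCLike.ofReal_one]
  rw [h2, one_mul]

theorem measurable_commonWeight (N : ℕ) {I J : DCube d} (h : I.1 = J.1) :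
    Measurable (commonWeight N I J) := Measurable.ite (measurableSet_anc_eq N h) measurable_const measurable_const

theorem commonWeight_of_ne {N : ℕ} {I J : DCube d} {ω : Omega d} (h : anc ω N I ≠ anc ω N J) :
    commonWeight N I J ω = 0 := if_neg h

theorem commonWeight_nonneg (N : ℕ) (I J : DCube d) (ω : Omega d) : 0 ≤ commonWeight N I J ω := by
  unfold commonWeight
  split_ifs
  · exact inv_nonneg.2 measureReal_nonneg
  · exact le_rfl

theorem commonWeight_le_two {N : ℕ} {I J : DCube d} (h : I.1 = J.1)
    (hN : 2 * d * ‖J.2 - I.2‖ ≤ 2 ^ N) (ω : Omega d) : commonWeight N I J ω ≤ 2 := by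
  have hP := half_le_commonProb h hN
  unfold commonWeight
  split_ifs
  · rw [inv_le_comm₀ (by linarith) (by norm_num)]
    linarith
  · norm_num

end Probability

/-! ### The coefficients of the shifts -/

section RawCoeff

variable {𝕜 : Type*} [RCLike 𝕜] {d : ℕ} {φ ψ : ℝ → ℝ} {C : ℝ} {T : L2 𝕜 d →L[𝕜] L2 𝕜 d}
  {K : (Fin d → ℝ) → (Fin d → ℝ) → 𝕜}

theorem two_mul_norm_le_two_pow_ancGen (hφ : IsModulus φ)
    (hφ' : Tendsto (fun t => φ t / t) (𝓝[>] 0) atTop) (m : Fin d → ℤ) :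
    2 * d * ‖m‖ ≤ 2 ^ ancGen φ m := by
  refine (ancGen_spec hφ' m).trans (mul_le_of_le_one_left (by positivity) (hφ.le_one ?_ ?_))
  · positivity
  · exact pow_le_one₀ (by norm_num) (by norm_num)

/-- The weight of the pair of cubes `J`, `Q`. -/
def pairWeight (φ : ℝ → ℝ) (ω : Omega d) (J Q : DCube d) : ℝ :=
  if Q.2 = J.2 then 0 else commonWeight (ancGen φ (Q.2 - J.2)) J Q ω

theorem pairWeight_self (φ : ℝ → ℝ) (ω : Omega d) (J : DCube d) : pairWeight φ ω J J = 0 :=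
  if_pos rfl

theorem pairWeight_of_ne {ω : Omega d} {J Q : DCube d}
    (h : anc ω (ancGen φ (Q.2 - J.2)) J ≠ anc ω (ancGen φ (Q.2 - J.2)) Q) :
    pairWeight φ ω J Q = 0 := by
  unfold pairWeight
  split_ifs
  · rfl
  · exact commonWeight_of_ne h

theorem norm_pairWeight_le (hφ : IsModulus φ) (hφ' : Tendsto (fun t => φ t / t) (𝓝[>] 0) atTop)
    (ω : Omega d) {J Q : DCube d} (h : J.1 = Q.1) :
    ‖((pairWeight φ ω J Q : ℝ) : 𝕜)‖ ≤ 2 := by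
  rw [RCLike.norm_ofReal]
  unfold pairWeight
  split_ifs
  · simp
  · rw [abs_of_nonneg (commonWeight_nonneg _ _ _ _)]
    exact commonWeight_le_two h (two_mul_norm_le_two_pow_ancGen hφ hφ' _) ω

/-- The coefficient of `⟨h_I^η, f⟩`, where `I` is the `r`-th ancestor of `Q`, in the contribution
of the pair `J`, `Q`. -/
def coeffX (T : L2 𝕜 d →L[𝕜] L2 𝕜 d) (ω : Omega d) (J Q : DCube d) (r : ℕ)
    (η η' : Fin d → Fin 2) : 𝕜 :=
  if r = 0 then 2⁻¹ * inner 𝕜 (haar 𝕜 ω J η') (T (haar 𝕜 ω Q η))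
  else inner 𝕜 (haar 𝕜 ω J η') (T (haar 𝕜 ω Q 0)) *
    inner 𝕜 (haar 𝕜 ω Q 0) (haar 𝕜 ω (anc ω r Q) η)

/-- The coefficient of `⟨h_I^η, f⟩`, where `I` is the `j`-th ancestor of `J`, in the contribution
of the pair `J`, `Q`. -/
def coeffY (T : L2 𝕜 d →L[𝕜] L2 𝕜 d) (ω : Omega d) (J Q : DCube d) (j : ℕ)
    (η η' : Fin d → Fin 2) : 𝕜 :=
  -(inner 𝕜 (haar 𝕜 ω J η') (T (haar 𝕜 ω Q 0)) *
    inner 𝕜 (haar 𝕜 ω J 0) (haar 𝕜 ω (anc ω j J) η))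

theorem WeakCZ.norm_coeffX_le (h : WeakCZ ψ C T K) (hψ : IsModulus ψ) (hd : 0 < d)
    (ω : Omega d) {J Q : DCube d} (hJQ : J.1 = Q.1) (hne : Q.2 ≠ J.2) (r : ℕ)
    (η : Fin d → Fin 2) {η' : Fin d → Fin 2} (hη' : η' ≠ 0) :
    ‖coeffX T ω J Q r η η'‖ ≤ 4 ^ (d + 1) * C * decay ψ (Q.2 - J.2) * ratio d ^ r := by
  obtain ⟨k, p⟩ := J
  obtain ⟨k', q⟩ := Q
  obtain rfl : k = k' := hJQ
  have h1 := fun η => h.norm_inner_haar_le_decay hψ hd ω k hne η hη'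
  unfold coeffX
  split_ifs with hr
  · subst hr
    rw [norm_mul, norm_inv, RCLike.norm_ofNat, pow_zero, mul_one]
    have := h1 η
    have h0 := norm_nonneg (inner 𝕜 (haar 𝕜 ω (k, p) η') (T (haar 𝕜 ω (k, q) η)) : 𝕜)
    linarith
  · obtain ⟨s, rfl⟩ := Nat.exists_eq_succ_of_ne_zero hr
    rw [norm_mul, norm_inner_haar_anc]
    exact mul_le_mul_of_nonneg_right (h1 0) (pow_nonneg (ratio_pos d).le _)

theorem WeakCZ.norm_coeffY_le (h : WeakCZ ψ C T K) (hψ : IsModulus ψ) (hd : 0 < d)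
    (ω : Omega d) {J Q : DCube d} (hJQ : J.1 = Q.1) (hne : Q.2 ≠ J.2) {j : ℕ} (hj : j ≠ 0)
    (η : Fin d → Fin 2) {η' : Fin d → Fin 2} (hη' : η' ≠ 0) :
    ‖coeffY T ω J Q j η η'‖ ≤ 4 ^ (d + 1) * C * decay ψ (Q.2 - J.2) * ratio d ^ j := by
  have h1 := h.norm_coeffX_le hψ hd ω hJQ hne j η hη'
  obtain ⟨s, rfl⟩ := Nat.exists_eq_succ_of_ne_zero hj
  rw [coeffX, if_neg hj, norm_mul, norm_inner_haar_anc] at h1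
  rwa [coeffY, norm_neg, norm_mul, norm_inner_haar_anc]

/-- The weighted `coeffX`. -/
def weightX (φ : ℝ → ℝ) (T : L2 𝕜 d →L[𝕜] L2 𝕜 d) (ω : Omega d) (J Q : DCube d) (r : ℕ)
    (η η' : Fin d → Fin 2) : 𝕜 := ((pairWeight φ ω J Q : ℝ) : 𝕜) * coeffX T ω J Q r η η'

/-- The weighted `coeffY`. -/
def weightY (φ : ℝ → ℝ) (T : L2 𝕜 d →L[𝕜] L2 𝕜 d) (ω : Omega d) (J Q : DCube d) (j : ℕ)
    (η η' : Fin d → Fin 2) : 𝕜 := ((pairWeight φ ω J Q : ℝ) : 𝕜) * coeffY T ω J Q j η η'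

theorem WeakCZ.norm_weightX_le (h : WeakCZ ψ C T K) (hφ : IsModulus φ)
    (hφ' : Tendsto (fun t => φ t / t) (𝓝[>] 0) atTop) (hψ : IsModulus ψ) (hd : 0 < d)
    (ω : Omega d) {J Q : DCube d} (hJQ : J.1 = Q.1) (r : ℕ)
    (η : Fin d → Fin 2) {η' : Fin d → Fin 2} (hη' : η' ≠ 0) :
    ‖weightX φ T ω J Q r η η'‖ ≤ 2 * 4 ^ (d + 1) * C * ratio d ^ r *
      if Q.2 = J.2 then 0 else decay ψ (Q.2 - J.2) := by
  unfold weightX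
  split_ifs with hq
  · simp [pairWeight, hq]
  · rw [norm_mul]
    refine (mul_le_mul (norm_pairWeight_le hφ hφ' ω hJQ)
      (h.norm_coeffX_le hψ hd ω hJQ hq r η hη') (norm_nonneg _) (by norm_num)).trans (le_of_eq ?_)
    ring

theorem WeakCZ.norm_weightY_le (h : WeakCZ ψ C T K) (hφ : IsModulus φ)
    (hφ' : Tendsto (fun t => φ t / t) (𝓝[>] 0) atTop) (hψ : IsModulus ψ) (hd : 0 < d)
    (ω : Omega d) {J Q : DCube d} (hJQ : J.1 = Q.1) {j : ℕ} (hj : j ≠ 0)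
    (η : Fin d → Fin 2) {η' : Fin d → Fin 2} (hη' : η' ≠ 0) :
    ‖weightY φ T ω J Q j η η'‖ ≤ 2 * 4 ^ (d + 1) * C * ratio d ^ j *
      if Q.2 = J.2 then 0 else decay ψ (Q.2 - J.2) := by
  unfold weightY
  split_ifs with hq
  · simp [pairWeight, hq]
  · rw [norm_mul]
    refine (mul_le_mul (norm_pairWeight_le hφ hφ' ω hJQ)
      (h.norm_coeffY_le hψ hd ω hJQ hq hj η hη') (norm_nonneg _) (by norm_num)).trans (le_of_eq ?_)
    ring

/-- The part of the coefficients with the cubes `Q` inside `I`. -/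
def sumX (φ : ℝ → ℝ) (T : L2 𝕜 d →L[𝕜] L2 𝕜 d) (ω : Omega d) (i j : ℕ) (I J : DCube d)
    (η η' : Fin d → Fin 2) : 𝕜 :=
  ∑ Q ∈ desc ω I (j - i), if ancGen φ (Q.2 - J.2) = j then weightX φ T ω J Q (j - i) η η' else 0

/-- The part of the coefficients where `I` is an ancestor of `J`. -/
def sumY (φ : ℝ → ℝ) (T : L2 𝕜 d →L[𝕜] L2 𝕜 d) (ω : Omega d) (j : ℕ) (J : DCube d)
    (η η' : Fin d → Fin 2) : 𝕜 :=
  ∑' q : Fin d → ℤ, if j ≤ ancGen φ (q - J.2) then weightY φ T ω J (J.1, q) j η η' else 0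

/-- The cancellative coefficients of the shift with parameters `(i, j)` that comes from the pairs
of cubes of which the second carries a cancellative Haar function. -/
def rawCoeff (φ : ℝ → ℝ) (T : L2 𝕜 d →L[𝕜] L2 𝕜 d) (ω : Omega d) (i j : ℕ) : ShiftCoeff 𝕜 d :=
  fun I J _ η η' =>
    if η = 0 ∨ η' = 0 then 0
    else if j = 0 then
      if i = 0 then 2⁻¹ * inner 𝕜 (haar 𝕜 ω J η') (T (haar 𝕜 ω J η)) else 0
    else if i ≤ j then sumX φ T ω i j I J η η' + if i = 0 then sumY φ T ω j J η η' else 0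
    else 0

theorem isCancellative_rawCoeff (φ : ℝ → ℝ) (T : L2 𝕜 d →L[𝕜] L2 𝕜 d) (ω : Omega d) (i j : ℕ) :
    (rawCoeff φ T ω i j).IsCancellative := fun _ _ _ _ _ h => if_pos h

theorem sum_ite_decay_le (hφ : IsModulus φ) (hψ : IsModulus ψ) (hd : 0 < d) (j : ℕ)
    (p : Fin d → ℤ) (s : Finset (Fin d → ℤ)) :
    ∑ q ∈ s, (if j ≤ ancGen φ (q - p) then if q = p then 0 else decay ψ (q - p) else 0) ≤
      2 * 8 ^ (d + 1) * d * tau d φ ψ 0 j := by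
  classical
  rw [tau_zero_left]
  let s' := s.filter fun q => j ≤ ancGen φ (q - p) ∧ q ≠ p
  refine le_trans (le_of_eq ?_) (sum_decay_le hφ hψ hd j (s'.image fun q => q - p) ?_)
  · rw [Finset.sum_image (fun x _ y _ hxy => sub_left_injective hxy), Finset.sum_filter]
    refine Finset.sum_congr rfl fun q _ => ?_
    by_cases h1 : j ≤ ancGen φ (q - p) <;> by_cases h2 : q = p <;> simp [h1, h2]
  · intro m hm
    obtain ⟨q, hq, rfl⟩ := Finset.mem_image.1 hm
    have := (Finset.mem_filter.1 hq).2
    exact ⟨sub_ne_zero.2 this.2, this.1⟩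

/-- For i = 0 all cubes Q in the common ancestor enter. Counting them with the worst entry would be
wasteful, so their decays are added up, giving Ψ. -/
theorem WeakCZ.norm_sumX_zero_le (h : WeakCZ ψ C T K) (hφ : IsModulus φ)
    (hφ' : Tendsto (fun t => φ t / t) (𝓝[>] 0) atTop) (hψ : IsModulus ψ) (hd : 0 < d)
    (ω : Omega d) (j : ℕ) {I J : DCube d} (hIJ : J.1 = I.1 + j) (η : Fin d → Fin 2)
    {η' : Fin d → Fin 2} (hη' : η' ≠ 0) :
    ‖sumX φ T ω 0 j I J η η'‖ ≤
      2 * 4 ^ (d + 1) * C * (2 * 8 ^ (d + 1) * d) * (tau d φ ψ 0 j * ratio d ^ j) := by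
  classical
  have hC := h.reg.1
  have hfst : ∀ Q ∈ desc ω I j, J.1 = Q.1 := by
    intro Q hQ
    have := anc_fst ω j Q
    rw [mem_desc.1 hQ] at this
    omega
  have hr := pow_nonneg (ratio_pos d).le j
  unfold sumX
  rw [Nat.sub_zero]
  refine (norm_sum_le _ _).trans ?_
  have h1 : ∀ Q ∈ desc ω I j,
      ‖if ancGen φ (Q.2 - J.2) = j then weightX φ T ω J Q j η η' else 0‖ ≤
      2 * 4 ^ (d + 1) * C * ratio d ^ j * if j ≤ ancGen φ (Q.2 - J.2) then
        if Q.2 = J.2 then 0 else decay ψ (Q.2 - J.2) else 0 := by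
    intro Q hQ
    have h2 := h.norm_weightX_le hφ hφ' hψ hd ω (hfst Q hQ) j η hη'
    by_cases h3 : ancGen φ (Q.2 - J.2) = j
    · rw [if_pos h3, if_pos h3.ge]
      exact h2
    · rw [if_neg h3, norm_zero]
      refine mul_nonneg (by positivity) ?_
      split_ifs
      · exact le_rfl
      · exact decay_nonneg hψ _
      · exact le_rfl
  refine (Finset.sum_le_sum h1).trans ?_
  rw [← Finset.mul_sum]
  have h4 : ∑ Q ∈ desc ω I j, (if j ≤ ancGen φ (Q.2 - J.2) then
        if Q.2 = J.2 then 0 else decay ψ (Q.2 - J.2) else 0) =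
      ∑ q ∈ (desc ω I j).image Prod.snd, (if j ≤ ancGen φ (q - J.2) then
        if q = J.2 then 0 else decay ψ (q - J.2) else 0) := by
    rw [Finset.sum_image]
    intro Q hQ Q' hQ' hE
    exact Prod.ext ((hfst Q hQ).symm.trans (hfst Q' hQ')) hE
  rw [h4]
  refine (mul_le_mul_of_nonneg_left (sum_ite_decay_le hφ hψ hd j J.2 _) (by positivity)).trans
    (le_of_eq ?_)
  ring

/-- There are 2^{d(j-i)} cubes Q in I, each contributing at most a multiple of 2^{-dj} τ times the
factor 2^{-d(j-i)/2} of ⟨h_Q^0, h_I⟩. The exponents combine to -d(i+j)/2. -/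
theorem WeakCZ.norm_sumX_pos_le (h : WeakCZ ψ C T K) (hφ : IsModulus φ)
    (hφ' : Tendsto (fun t => φ t / t) (𝓝[>] 0) atTop) (hψ : IsModulus ψ) (hd : 0 < d)
    (ω : Omega d) {i j : ℕ} (hi : 0 < i) (hij : i ≤ j) {I J : DCube d} (hIJ : J.1 + i = I.1 + j)
    (η : Fin d → Fin 2) {η' : Fin d → Fin 2} (hη' : η' ≠ 0) :
    ‖sumX φ T ω i j I J η η'‖ ≤
      2 * 4 ^ (d + 1) * C * (4 * d) ^ (d + 1) * (tau d φ ψ i j * ratio d ^ (i + j)) := by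
  have hC := h.reg.1
  have hτ := (tau_pos (d := d) hφ hψ i j).le
  have hρ := (ratio_pos d).le
  have h1 : ∀ Q ∈ desc ω I (j - i),
      ‖if ancGen φ (Q.2 - J.2) = j then weightX φ T ω J Q (j - i) η η' else 0‖ ≤
      2 * 4 ^ (d + 1) * C * ratio d ^ (j - i) *
        ((4 * d) ^ (d + 1) * (((2 : ℝ) ^ d)⁻¹ ^ j * tau d φ ψ i j)) := by
    intro Q hQ
    have hfst : J.1 = Q.1 := by
      have := anc_fst ω (j - i) Q
      rw [mem_desc.1 hQ] at this
      omega
    have h2 := h.norm_weightX_le hφ hφ' hψ hd ω hfst (j - i) η hη'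
    split_ifs with h3
    · refine h2.trans (mul_le_mul_of_nonneg_left ?_ (by positivity))
      split_ifs with h4
      · positivity
      · exact decay_le hφ hψ hd (sub_ne_zero.2 h4) hi hij h3.ge
    · rw [norm_zero]
      positivity
  refine (norm_sum_le _ _).trans ((Finset.sum_le_card_nsmul _ _ _ h1).trans (le_of_eq ?_))
  rw [card_desc, nsmul_eq_mul]
  obtain ⟨r, rfl⟩ := Nat.exists_eq_add_of_le hij
  rw [Nat.add_sub_cancel_left, ← ratio_sq]
  push_cast
  have h5 : ((2 : ℝ) ^ d) ^ r * (ratio d * ratio d) ^ r = 1 := by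
    rw [← mul_pow, mul_comm, ratio_sq_mul, one_pow]
  calc _ = 2 * 4 ^ (d + 1) * C * (4 * d) ^ (d + 1) * (tau d φ ψ i (i + r) *
        ((ratio d * ratio d) ^ i * ratio d ^ r)) *
        (((2 : ℝ) ^ d) ^ r * (ratio d * ratio d) ^ r) := by rw [pow_add]; ring
    _ = _ := by
      rw [h5]
      ring

/-- The term on the j-th ancestor of J is present for every Q that has to climb at least j
generations. These infinitely many positions are summed by Dini summation. -/
theorem WeakCZ.summable_sumY_and_norm_le (h : WeakCZ ψ C T K) (hφ : IsModulus φ)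
    (hφ' : Tendsto (fun t => φ t / t) (𝓝[>] 0) atTop) (hψ : IsModulus ψ) (hd : 0 < d)
    (ω : Omega d) {j : ℕ} (hj : j ≠ 0) (J : DCube d) (η : Fin d → Fin 2)
    {η' : Fin d → Fin 2} (hη' : η' ≠ 0) :
    (Summable fun q : Fin d → ℤ =>
      if j ≤ ancGen φ (q - J.2) then weightY φ T ω J (J.1, q) j η η' else 0) ∧
    ‖sumY φ T ω j J η η'‖ ≤
      2 * 4 ^ (d + 1) * C * (2 * 8 ^ (d + 1) * d) * (tau d φ ψ 0 j * ratio d ^ j) := by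
  have hC := h.reg.1
  have hr := pow_nonneg (ratio_pos d).le j
  have h1 : ∀ q : Fin d → ℤ,
      ‖if j ≤ ancGen φ (q - J.2) then weightY φ T ω J (J.1, q) j η η' else 0‖ ≤
      2 * 4 ^ (d + 1) * C * ratio d ^ j * if j ≤ ancGen φ (q - J.2) then
        if q = J.2 then 0 else decay ψ (q - J.2) else 0 := by
    intro q
    have h2 := h.norm_weightY_le hφ hφ' hψ hd ω (J := J) (Q := (J.1, q)) rfl hj η hη'
    by_cases h3 : j ≤ ancGen φ (q - J.2)
    · rw [if_pos h3, if_pos h3]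
      exact h2
    · rw [if_neg h3, if_neg h3, norm_zero, mul_zero]
  have h5 : ∀ s : Finset (Fin d → ℤ),
      ∑ q ∈ s, ‖if j ≤ ancGen φ (q - J.2) then weightY φ T ω J (J.1, q) j η η' else 0‖ ≤
      2 * 4 ^ (d + 1) * C * (2 * 8 ^ (d + 1) * d) * (tau d φ ψ 0 j * ratio d ^ j) := by
    intro s
    refine (Finset.sum_le_sum fun q _ => h1 q).trans ?_
    rw [← Finset.mul_sum]
    refine (mul_le_mul_of_nonneg_left (sum_ite_decay_le hφ hψ hd j J.2 s) (by positivity)).trans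
      (le_of_eq ?_)
    ring
  have h6 := summable_of_sum_le (fun q => norm_nonneg _) h5
  exact ⟨h6.of_norm, (norm_tsum_le_tsum_norm h6).trans (h6.tsum_le_of_sum_le h5)⟩

/-- The constant in the size bound of the coefficients. -/
def rawConst (d : ℕ) : ℝ :=
  4 ^ d * (1 + 2 * 4 ^ (d + 1) * (4 * d) ^ (d + 1) + 2 * (2 * 4 ^ (d + 1) * (2 * 8 ^ (d + 1) * d)))

theorem rawConst_pos (d : ℕ) : 0 < rawConst d := by unfold rawConst; positivity

/-- The relation between generations is that of i-th and j-th descendants of one cube. For i = j = 0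
the trivial bound by C suffices because τ(0,0) ≥ 1. -/
theorem WeakCZ.norm_rawCoeff_le (h : WeakCZ ψ C T K) (hφ : IsModulus φ)
    (hφ' : Tendsto (fun t => φ t / t) (𝓝[>] 0) atTop) (hψ : IsModulus ψ) (hd : 0 < d)
    (ω : Omega d) (i j : ℕ) {I J : DCube d} (hIJ : J.1 + i = I.1 + j) (P : DCube d)
    (η η' : Fin d → Fin 2) :
    ‖rawCoeff φ T ω i j I J P η η'‖ ≤
      (1 + 2 * 4 ^ (d + 1) * (4 * d) ^ (d + 1) +
        2 * (2 * 4 ^ (d + 1) * (2 * 8 ^ (d + 1) * d))) * C * (tau d φ ψ i j * ratio d ^ (i + j)) := by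
  have hC := h.reg.1
  have hτ := (tau_pos (d := d) hφ hψ i j).le
  have hρ := pow_nonneg (ratio_pos d).le (i + j)
  have hd0 : (0 : ℝ) ≤ d := Nat.cast_nonneg d
  have hD : 0 ≤ C * (tau d φ ψ i j * ratio d ^ (i + j)) := by positivity
  have c1 : (0 : ℝ) ≤ 2 * 4 ^ (d + 1) * (4 * d) ^ (d + 1) := by positivity
  have c2 : (0 : ℝ) ≤ 2 * 4 ^ (d + 1) * (2 * 8 ^ (d + 1) * d) := by positivity
  generalize ha : (2 * 4 ^ (d + 1) * (4 * d) ^ (d + 1) : ℝ) = a at c1 ⊢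
  generalize hb : (2 * 4 ^ (d + 1) * (2 * 8 ^ (d + 1) * d) : ℝ) = b at c2 ⊢
  have k1 := mul_nonneg c1 hD
  have k2 := mul_nonneg c2 hD
  have hfin : ∀ x : ℝ, x ≤ (1 + a + 2 * b) * (C * (tau d φ ψ i j * ratio d ^ (i + j))) →
      x ≤ (1 + a + 2 * b) * C * (tau d φ ψ i j * ratio d ^ (i + j)) := fun x hx => by
    rwa [mul_assoc]
  refine hfin _ ?_
  have hzero : (0 : ℝ) ≤ (1 + a + 2 * b) * (C * (tau d φ ψ i j * ratio d ^ (i + j))) := by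
    positivity
  unfold rawCoeff
  split_ifs with h0 hj hi hij hi
  · rwa [norm_zero]
  · subst hj hi
    rw [norm_mul, norm_inv, RCLike.norm_ofNat]
    have e1 := h.norm_inner_haar_le ω J J η η'
    have e2 := one_le_tau_zero_zero (d := d) hφ hψ
    simp only [add_zero, pow_zero, mul_one] at hD k1 k2 ⊢
    have e3 : C ≤ C * tau d φ ψ 0 0 := le_mul_of_one_le_right hC e2
    nlinarith
  · rwa [norm_zero]
  · subst hi
    have hη' : η' ≠ 0 := fun hc => h0 (Or.inr hc)
    have e1 := h.norm_sumX_zero_le hφ hφ' hψ hd ω j (I := I) (J := J)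
      (by simpa using hIJ) η hη'
    have e2 := (h.summable_sumY_and_norm_le hφ hφ' hψ hd ω hj J η hη').2
    refine (norm_add_le _ _).trans ((add_le_add e1 e2).trans ?_)
    rw [zero_add] at hD k1 k2 ⊢
    rw [show 2 * 4 ^ (d + 1) * C * (2 * 8 ^ (d + 1) * d) * (tau d φ ψ 0 j * ratio d ^ j) =
      b * (C * (tau d φ ψ 0 j * ratio d ^ j)) by rw [← hb]; ring]
    linarith
  · have hη' : η' ≠ 0 := fun hc => h0 (Or.inr hc)
    rw [add_zero]
    refine (h.norm_sumX_pos_le hφ hφ' hψ hd ω (Nat.pos_of_ne_zero hi) hij hIJ η hη').trans ?_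
    rw [show 2 * 4 ^ (d + 1) * C * (4 * d) ^ (d + 1) * (tau d φ ψ i j * ratio d ^ (i + j)) =
      a * (C * (tau d φ ψ i j * ratio d ^ (i + j))) by rw [← ha]; ring]
    linarith
  · rwa [norm_zero]

theorem WeakCZ.rawCoeff_bound (h : WeakCZ ψ C T K) (hφ : IsModulus φ)
    (hφ' : Tendsto (fun t => φ t / t) (𝓝[>] 0) atTop) (hψ : IsModulus ψ) (hd : 0 < d)
    (ω : Omega d) (i j : ℕ) :
    ∀ P, ∀ I ∈ descendants ω P i, ∀ J ∈ descendants ω P j,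
      ∑ η : Fin d → Fin 2, ∑ η' : Fin d → Fin 2, ‖rawCoeff φ T ω i j I J P η η'‖ ≤
        rawConst d * C * tau d φ ψ i j * ratio d ^ (i + j) := by
  intro P I hI J hJ
  rw [mem_descendants] at hI hJ
  have hIJ : J.1 + i = I.1 + j := by
    have h1 := anc_fst ω i I
    have h2 := anc_fst ω j J
    rw [hI] at h1
    rw [hJ] at h2
    omega
  refine (Finset.sum_le_sum fun η _ => Finset.sum_le_card_nsmul _ _ _ fun η' _ =>
    h.norm_rawCoeff_le hφ hφ' hψ hd ω i j hIJ P η η').trans (le_of_eq ?_)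
  -- The factor 4^d of `rawConst` counts the pairs of types η, η'.
  have e4 : (4 : ℝ) ^ d = 2 ^ d * 2 ^ d := by rw [← mul_pow]; norm_num
  simp only [Finset.sum_const, nsmul_eq_mul, Finset.card_univ, Fintype.card_fun, Fintype.card_fin,
    rawConst, e4]
  push_cast
  ring

end RawCoeff

/-! ### Regrouping the coefficients -/

section Regroup

variable {𝕜 : Type*} [RCLike 𝕜] {d : ℕ} {φ ψ : ℝ → ℝ} {C : ℝ} {T : L2 𝕜 d →L[𝕜] L2 𝕜 d}
  {K : (Fin d → ℝ) → (Fin d → ℝ) → 𝕜}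

/-- The contribution of the pair `J`, `Q`. -/
def pairTerm (T : L2 𝕜 d →L[𝕜] L2 𝕜 d) (ω : Omega d) (J Q : DCube d) (η' : Fin d → Fin 2)
    (f : L2 𝕜 d) : 𝕜 :=
  inner 𝕜 (haar 𝕜 ω J η') (T (haar 𝕜 ω Q 0)) *
      (inner 𝕜 (haar 𝕜 ω Q 0) f - inner 𝕜 (haar 𝕜 ω J 0) f) +
    2⁻¹ * ∑ η ∈ cancTypes d, inner 𝕜 (haar 𝕜 ω J η') (T (haar 𝕜 ω Q η)) *
      inner 𝕜 (haar 𝕜 ω Q η) f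

/-- The part of the contribution of `J`, `Q` on the `r`-th ancestor of `Q`. -/
def termX (φ : ℝ → ℝ) (T : L2 𝕜 d →L[𝕜] L2 𝕜 d) (ω : Omega d) (J Q : DCube d) (r : ℕ)
    (η' : Fin d → Fin 2) (f : L2 𝕜 d) : 𝕜 :=
  ∑ η ∈ cancTypes d, weightX φ T ω J Q r η η' * inner 𝕜 (haar 𝕜 ω (anc ω r Q) η) f

/-- The part of the contribution of `J`, `Q` on the `j`-th ancestor of `J`. -/
def termY (φ : ℝ → ℝ) (T : L2 𝕜 d →L[𝕜] L2 𝕜 d) (ω : Omega d) (J Q : DCube d) (j : ℕ)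
    (η' : Fin d → Fin 2) (f : L2 𝕜 d) : 𝕜 :=
  ∑ η ∈ cancTypes d, weightY φ T ω J Q j η η' * inner 𝕜 (haar 𝕜 ω (anc ω j J) η) f

/-- Off the event of a common ancestor both sides vanish. On it the two expansions end with the same
average over that ancestor, so the noncancellative remainders cancel. The term r = 0 is half of the
martingale difference on Q itself. -/
theorem pairWeight_mul_pairTerm (φ : ℝ → ℝ) (T : L2 𝕜 d →L[𝕜] L2 𝕜 d) (ω : Omega d)
    (J Q : DCube d) (η' : Fin d → Fin 2) (f : L2 𝕜 d) :
    ((pairWeight φ ω J Q : ℝ) : 𝕜) * pairTerm T ω J Q η' f =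
      ∑ r ∈ Finset.range (ancGen φ (Q.2 - J.2) + 1), termX φ T ω J Q r η' f +
        ∑ r ∈ Finset.range (ancGen φ (Q.2 - J.2)), termY φ T ω J Q (r + 1) η' f := by
  by_cases h : anc ω (ancGen φ (Q.2 - J.2)) J = anc ω (ancGen φ (Q.2 - J.2)) Q
  · unfold pairTerm
    rw [inner_haar_zero_telescope ω Q (ancGen φ (Q.2 - J.2)) f,
      inner_haar_zero_telescope ω J (ancGen φ (Q.2 - J.2)) f, h, add_sub_add_right_eq_sub,
      Finset.sum_range_succ', mul_add, add_right_comm, mul_sub, mul_sub, sub_eq_add_neg]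
    congr 2
    · simp only [termX, weightX, coeffX, Nat.add_eq_zero_iff, one_ne_zero, and_false, if_false,
        Finset.mul_sum, mul_assoc]
    · simp only [termY, weightY, coeffY, Finset.mul_sum, ← Finset.sum_neg_distrib, neg_mul,
        mul_neg, mul_assoc]
    · simp only [termX, weightX, coeffX, if_true, Finset.mul_sum, mul_assoc, anc_zero]
  · have h0 := pairWeight_of_ne h
    simp [termX, termY, weightX, weightY, h0]

/-- Cubes without a common ancestor j generations up have zero weight, so the sum over all positions
reduces to the j-th descendants of that ancestor. Grouping them by their (j-i)-th ancestor I gives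
the entries of the shift (i,j). -/
theorem hasSum_sumX (φ : ℝ → ℝ) (T : L2 𝕜 d →L[𝕜] L2 𝕜 d) (ω : Omega d) {i j : ℕ} (hij : i ≤ j)
    (J : DCube d) (η' : Fin d → Fin 2) (f : L2 𝕜 d) :
    HasSum (fun q : Fin d → ℤ =>
        if ancGen φ (q - J.2) = j then termX φ T ω J (J.1, q) (j - i) η' f else 0)
      (∑ I ∈ desc ω (anc ω j J) i, ∑ η ∈ cancTypes d,
        sumX φ T ω i j I J η η' * inner 𝕜 (haar 𝕜 ω I η) f) := by
  classical
  have h1 : ∑ I ∈ desc ω (anc ω j J) i, ∑ η ∈ cancTypes d,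
        sumX φ T ω i j I J η η' * inner 𝕜 (haar 𝕜 ω I η) f =
      ∑ Q ∈ desc ω (anc ω j J) j,
        if ancGen φ (Q.2 - J.2) = j then termX φ T ω J Q (j - i) η' f else 0 := by
    conv_rhs => rw [← Nat.add_sub_cancel' hij, sum_desc_add]
    rw [Nat.add_sub_cancel' hij]
    refine Finset.sum_congr rfl fun I _ => ?_
    simp only [sumX, Finset.sum_mul]
    rw [Finset.sum_comm]
    refine Finset.sum_congr rfl fun Q hQ => ?_
    rw [mem_desc] at hQ
    split_ifs
    · simp only [termX, hQ]
    · simp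
  have hfst : ∀ Q ∈ desc ω (anc ω j J) j, Q.1 = J.1 := by
    intro Q hQ
    have := anc_fst ω j Q
    rw [mem_desc.1 hQ, anc_fst] at this
    omega
  have h2 : ∑ Q ∈ desc ω (anc ω j J) j,
        (if ancGen φ (Q.2 - J.2) = j then termX φ T ω J Q (j - i) η' f else 0) =
      ∑ q ∈ (desc ω (anc ω j J) j).image Prod.snd,
        if ancGen φ (q - J.2) = j then termX φ T ω J (J.1, q) (j - i) η' f else 0 := by
    rw [Finset.sum_image]
    · refine Finset.sum_congr rfl fun Q hQ => ?_
      have : Q = (J.1, Q.2) := Prod.ext (hfst Q hQ) rfl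
      rw [← this]
    · intro Q hQ Q' hQ' hE
      exact Prod.ext ((hfst Q hQ).trans (hfst Q' hQ').symm) hE
  rw [h1, h2]
  refine hasSum_sum_of_ne_finset_zero fun q hq => ?_
  split_ifs with hN
  · have h3 : anc ω (ancGen φ (q - J.2)) J ≠ anc ω (ancGen φ (q - J.2)) (J.1, q) := by
      intro hc
      refine hq (Finset.mem_image.2 ⟨(J.1, q), mem_desc.2 ?_, rfl⟩)
      rw [← hN]
      exact hc.symm
    have h4 := pairWeight_of_ne (Q := (J.1, q)) h3
    simp [termX, weightX, h4]
  · rfl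

theorem WeakCZ.hasSum_sumY (h : WeakCZ ψ C T K) (hφ : IsModulus φ)
    (hφ' : Tendsto (fun t => φ t / t) (𝓝[>] 0) atTop) (hψ : IsModulus ψ) (hd : 0 < d)
    (ω : Omega d) {j : ℕ} (hj : j ≠ 0) (J : DCube d) {η' : Fin d → Fin 2} (hη' : η' ≠ 0)
    (f : L2 𝕜 d) :
    HasSum (fun q : Fin d → ℤ =>
        if j ≤ ancGen φ (q - J.2) then termY φ T ω J (J.1, q) j η' f else 0)
      (∑ η ∈ cancTypes d, sumY φ T ω j J η η' * inner 𝕜 (haar 𝕜 ω (anc ω j J) η) f) := by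
  have h1 := hasSum_sum (s := cancTypes d) fun η _ =>
    ((h.summable_sumY_and_norm_le hφ hφ' hψ hd ω hj J η hη').1.hasSum.mul_right
      (inner 𝕜 (haar 𝕜 ω (anc ω j J) η) f : 𝕜))
  have h2 : (fun q : Fin d → ℤ => ∑ η ∈ cancTypes d,
      (if j ≤ ancGen φ (q - J.2) then weightY φ T ω J (J.1, q) j η η' else 0) *
        inner 𝕜 (haar 𝕜 ω (anc ω j J) η) f) =
      fun q => if j ≤ ancGen φ (q - J.2) then termY φ T ω J (J.1, q) j η' f else 0 := by
    funext q
    split_ifs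
    · rfl
    · simp
  rw [h2] at h1
  exact h1

/-- The coefficients of the shift with parameters `(i, j)` that comes from the pairs of cubes of
which the second carries a cancellative Haar function. -/
def halfCoeff (φ : ℝ → ℝ) (T : L2 𝕜 d →L[𝕜] L2 𝕜 d) (ω : Omega d) (i j : ℕ) : ShiftCoeff 𝕜 d :=
  if i = 0 ∧ j = 0 then rawCoeff φ T ω 0 0 + paraCoeff (paraB T ω) else rawCoeff φ T ω i j

/-- The row of the shift that belongs to the Haar function `h_J^η'`. -/
def rowTerm (φ : ℝ → ℝ) (T : L2 𝕜 d →L[𝕜] L2 𝕜 d) (ω : Omega d) (i j : ℕ) (J : DCube d)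
    (η' : Fin d → Fin 2) (f : L2 𝕜 d) : 𝕜 :=
  ∑ I ∈ desc ω (anc ω j J) i, ∑ η, halfCoeff φ T ω i j I J (anc ω j J) η η' *
    inner 𝕜 (haar 𝕜 ω I η) f

theorem halfCoeff_zero_right (φ : ℝ → ℝ) (T : L2 𝕜 d →L[𝕜] L2 𝕜 d) (ω : Omega d) (i j : ℕ)
    (I J P : DCube d) (η : Fin d → Fin 2) : halfCoeff φ T ω i j I J P η 0 = 0 := by
  unfold halfCoeff
  split_ifs
  · simp [rawCoeff, paraCoeff]
  · simp [rawCoeff]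

theorem rowTerm_zero_right (φ : ℝ → ℝ) (T : L2 𝕜 d →L[𝕜] L2 𝕜 d) (ω : Omega d) (i j : ℕ)
    (J : DCube d) (f : L2 𝕜 d) : rowTerm φ T ω i j J 0 f = 0 := by
  simp [rowTerm, halfCoeff_zero_right]

theorem inner_averagingOp_halfCoeff (φ : ℝ → ℝ) (T : L2 𝕜 d →L[𝕜] L2 𝕜 d) (ω : Omega d)
    (i j : ℕ) (P : DCube d) (f g : L2 𝕜 d) :
    inner 𝕜 g (averagingOp ω i j (halfCoeff φ T ω i j) P f) =
      ∑ J ∈ desc ω P j, ∑ η' ∈ cancTypes d,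
        inner 𝕜 g (haar 𝕜 ω J η') * rowTerm φ T ω i j J η' f := by
  rw [inner_averagingOp, Finset.sum_comm]
  refine Finset.sum_congr rfl fun J hJ => ?_
  have e1 : ∑ η' ∈ cancTypes d, inner 𝕜 g (haar 𝕜 ω J η') * rowTerm φ T ω i j J η' f =
      ∑ η', inner 𝕜 g (haar 𝕜 ω J η') * rowTerm φ T ω i j J η' f := by
    rw [sum_univ_eq_add_cancTypes, rowTerm_zero_right, mul_zero, zero_add]
  rw [e1]
  simp only [rowTerm, mem_desc.1 hJ, Finset.mul_sum]
  rw [Finset.sum_comm (s := Finset.univ)]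
  refine Finset.sum_congr rfl fun I _ => ?_
  rw [Finset.sum_comm]
  exact Finset.sum_congr rfl fun η' _ => Finset.sum_congr rfl fun η _ => by ring

theorem rowTerm_of_lt (φ : ℝ → ℝ) (T : L2 𝕜 d →L[𝕜] L2 𝕜 d) (ω : Omega d) {i j : ℕ} (h : j < i)
    (J : DCube d) (η' : Fin d → Fin 2) (f : L2 𝕜 d) : rowTerm φ T ω i j J η' f = 0 := by
  have h2 : i ≠ 0 := by omega
  have h3 : ¬ i ≤ j := by omega
  simp [rowTerm, halfCoeff, rawCoeff, h2, h3]

theorem rowTerm_zero_zero (φ : ℝ → ℝ) (T : L2 𝕜 d →L[𝕜] L2 𝕜 d) (ω : Omega d)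
    (J : DCube d) {η' : Fin d → Fin 2} (hη' : η' ≠ 0) (f : L2 𝕜 d) :
    rowTerm φ T ω 0 0 J η' f =
      paraB T ω J η' * inner 𝕜 (haar 𝕜 ω J 0) f + pairTerm T ω J J η' f := by
  rw [rowTerm, anc_zero, desc_zero, Finset.sum_singleton, sum_univ_eq_add_cancTypes]
  congr 1
  · simp [halfCoeff, rawCoeff, paraCoeff, hη']
  · rw [pairTerm, sub_self, mul_zero, zero_add, Finset.mul_sum]
    refine Finset.sum_congr rfl fun η hη => ?_
    rw [mem_cancTypes] at hη
    simp [halfCoeff, rawCoeff, paraCoeff, hη', hη, mul_assoc]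

theorem rowTerm_of_ne (φ : ℝ → ℝ) (T : L2 𝕜 d →L[𝕜] L2 𝕜 d) (ω : Omega d) {i j : ℕ} (hj : j ≠ 0)
    (hij : i ≤ j) (J : DCube d) {η' : Fin d → Fin 2} (hη' : η' ≠ 0) (f : L2 𝕜 d) :
    rowTerm φ T ω i j J η' f =
      ∑ I ∈ desc ω (anc ω j J) i, ∑ η ∈ cancTypes d,
        sumX φ T ω i j I J η η' * inner 𝕜 (haar 𝕜 ω I η) f +
      if i = 0 then
        ∑ η ∈ cancTypes d, sumY φ T ω j J η η' * inner 𝕜 (haar 𝕜 ω (anc ω j J) η) f else 0 := by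
  have h1 : ¬ (i = 0 ∧ j = 0) := by omega
  have e1 : rowTerm φ T ω i j J η' f = ∑ I ∈ desc ω (anc ω j J) i, ∑ η ∈ cancTypes d,
      (sumX φ T ω i j I J η η' + if i = 0 then sumY φ T ω j J η η' else 0) *
        inner 𝕜 (haar 𝕜 ω I η) f := by
    unfold rowTerm
    refine Finset.sum_congr rfl fun I _ => ?_
    rw [sum_univ_eq_add_cancTypes, show halfCoeff φ T ω i j I J (anc ω j J) 0 η' = 0 by
      simp [halfCoeff, h1, rawCoeff], zero_mul, zero_add]
    refine Finset.sum_congr rfl fun η hη => ?_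
    rw [mem_cancTypes] at hη
    simp [halfCoeff, rawCoeff, hη, hη', hj, hij]
  rw [e1]
  split_ifs with hi
  · subst hi
    rw [desc_zero, Finset.sum_singleton, Finset.sum_singleton, ← Finset.sum_add_distrib]
    exact Finset.sum_congr rfl fun η _ => add_mul _ _ _
  · simp

theorem ratio_lt_one (hd : 0 < d) : ratio d < 1 := by
  unfold ratio
  refine pow_lt_one₀ (by positivity) (inv_lt_one_of_one_lt₀ ?_) hd.ne'
  rw [Real.lt_sqrt zero_le_one]
  norm_num

theorem sum_range_ratio_le (hd : 0 < d) (n : ℕ) :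
    ∑ r ∈ Finset.range n, ratio d ^ r ≤ (1 - ratio d)⁻¹ := by
  have h := hasSum_geometric_of_lt_one (ratio_pos d).le (ratio_lt_one hd)
  exact sum_le_hasSum _ (fun r _ => pow_nonneg (ratio_pos d).le r) h

/-- The constant in the bounds of `termX` and `termY`. -/
def termConst (d : ℕ) (C : ℝ) : ℝ := 2 ^ d * (2 * 4 ^ (d + 1) * C)

theorem norm_sum_cancTypes_mul_inner_le (ω : Omega d) (I : DCube d) (v : (Fin d → Fin 2) → 𝕜)
    {M : ℝ} (hv : ∀ η, ‖v η‖ ≤ M) (f : L2 𝕜 d) :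
    ‖∑ η ∈ cancTypes d, v η * inner 𝕜 (haar 𝕜 ω I η) f‖ ≤ 2 ^ d * (M * ‖f‖) := by
  have hM : 0 ≤ M := (norm_nonneg _).trans (hv 0)
  have h1 : ∀ η ∈ cancTypes d, ‖v η * inner 𝕜 (haar 𝕜 ω I η) f‖ ≤ M * ‖f‖ := by
    intro η _
    rw [norm_mul]
    refine mul_le_mul (hv η) ?_ (norm_nonneg _) hM
    refine (norm_inner_le_norm _ _).trans (le_of_eq ?_)
    rw [norm_haar, one_mul]
  refine (norm_sum_le _ _).trans ((Finset.sum_le_card_nsmul _ _ _ h1).trans ?_)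
  rw [nsmul_eq_mul]
  refine mul_le_mul_of_nonneg_right ?_ (by positivity)
  exact_mod_cast card_cancTypes_le d

theorem WeakCZ.norm_termX_le (h : WeakCZ ψ C T K) (hφ : IsModulus φ)
    (hφ' : Tendsto (fun t => φ t / t) (𝓝[>] 0) atTop) (hψ : IsModulus ψ) (hd : 0 < d)
    (ω : Omega d) (J : DCube d) (q : Fin d → ℤ) (r : ℕ) {η' : Fin d → Fin 2} (hη' : η' ≠ 0)
    (f : L2 𝕜 d) :
    ‖termX φ T ω J (J.1, q) r η' f‖ ≤ termConst d C * ‖f‖ * decay ψ (q - J.2) * ratio d ^ r := by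
  have hC := h.reg.1
  have hdec := decay_nonneg hψ (q - J.2)
  have hρ := pow_nonneg (ratio_pos d).le r
  refine (norm_sum_cancTypes_mul_inner_le ω _ _ (fun η =>
    (h.norm_weightX_le hφ hφ' hψ hd ω (J := J) (Q := (J.1, q)) rfl r η hη').trans
      (mul_le_mul_of_nonneg_left (b := if q = J.2 then 0 else decay ψ (q - J.2))
        (c := decay ψ (q - J.2)) ?_ (by positivity))) f).trans (le_of_eq ?_)
  · split_ifs
    · exact hdec
    · exact le_rfl
  · unfold termConst
    ring

theorem WeakCZ.norm_termY_le (h : WeakCZ ψ C T K) (hφ : IsModulus φ)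
    (hφ' : Tendsto (fun t => φ t / t) (𝓝[>] 0) atTop) (hψ : IsModulus ψ) (hd : 0 < d)
    (ω : Omega d) (J : DCube d) (q : Fin d → ℤ) {j : ℕ} (hj : j ≠ 0) {η' : Fin d → Fin 2}
    (hη' : η' ≠ 0) (f : L2 𝕜 d) :
    ‖termY φ T ω J (J.1, q) j η' f‖ ≤ termConst d C * ‖f‖ * decay ψ (q - J.2) * ratio d ^ j := by
  have hC := h.reg.1
  have hdec := decay_nonneg hψ (q - J.2)
  have hρ := pow_nonneg (ratio_pos d).le j
  refine (norm_sum_cancTypes_mul_inner_le ω _ _ (fun η =>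
    (h.norm_weightY_le hφ hφ' hψ hd ω (J := J) (Q := (J.1, q)) rfl hj η hη').trans
      (mul_le_mul_of_nonneg_left (b := if q = J.2 then 0 else decay ψ (q - J.2))
        (c := decay ψ (q - J.2)) ?_ (by positivity))) f).trans (le_of_eq ?_)
  · split_ifs
    · exact hdec
    · exact le_rfl
  · unfold termConst
    ring

/-- The part of the pair `J`, `q` that belongs to the generation `j` above `J`. -/
def genTerm (φ : ℝ → ℝ) (T : L2 𝕜 d →L[𝕜] L2 𝕜 d) (ω : Omega d) (j : ℕ) (J : DCube d)
    (q : Fin d → ℤ) (η' : Fin d → Fin 2) (f : L2 𝕜 d) : 𝕜 :=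
  (if ancGen φ (q - J.2) = j then
      ∑ r ∈ Finset.range (j + 1), termX φ T ω J (J.1, q) r η' f else 0) +
    if j ≤ ancGen φ (q - J.2) then termY φ T ω J (J.1, q) j η' f else 0

theorem WeakCZ.hasSum_genTerm (h : WeakCZ ψ C T K) (hφ : IsModulus φ)
    (hφ' : Tendsto (fun t => φ t / t) (𝓝[>] 0) atTop) (hψ : IsModulus ψ) (hd : 0 < d)
    (ω : Omega d) {j : ℕ} (hj : j ≠ 0) (J : DCube d) {η' : Fin d → Fin 2} (hη' : η' ≠ 0)
    (f : L2 𝕜 d) :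
    HasSum (fun q : Fin d → ℤ => genTerm φ T ω j J q η' f)
      (∑ i ∈ Finset.range (j + 1), rowTerm φ T ω i j J η' f) := by
  have h1 := (hasSum_sum (s := Finset.range (j + 1)) fun i hi =>
    hasSum_sumX φ T ω (Nat.lt_succ_iff.1 (Finset.mem_range.1 hi)) J η' f).add
    (h.hasSum_sumY hφ hφ' hψ hd ω hj J hη' f)
  have e1 : ∑ i ∈ Finset.range (j + 1), rowTerm φ T ω i j J η' f =
      ∑ i ∈ Finset.range (j + 1), (∑ I ∈ desc ω (anc ω j J) i, ∑ η ∈ cancTypes d,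
        sumX φ T ω i j I J η η' * inner 𝕜 (haar 𝕜 ω I η) f) +
      ∑ η ∈ cancTypes d, sumY φ T ω j J η η' * inner 𝕜 (haar 𝕜 ω (anc ω j J) η) f := by
    rw [Finset.sum_congr rfl fun i hi =>
      rowTerm_of_ne φ T ω hj (Nat.lt_succ_iff.1 (Finset.mem_range.1 hi)) J hη' f,
      Finset.sum_add_distrib]
    simp
  have e2 : (fun q : Fin d → ℤ => genTerm φ T ω j J q η' f) = fun q =>
      ∑ i ∈ Finset.range (j + 1),
        (if ancGen φ (q - J.2) = j then termX φ T ω J (J.1, q) (j - i) η' f else 0) +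
      if j ≤ ancGen φ (q - J.2) then termY φ T ω J (J.1, q) j η' f else 0 := by
    funext q
    unfold genTerm
    congr 1
    split_ifs
    -- The climb of r generations from Q corresponds to i = j - r, so the order of summation is
    -- reversed.
    · rw [← Finset.sum_range_reflect]
      rfl
    · simp
  rw [e1, e2]
  exact h1

theorem sum_range_genTerm (hφ' : Tendsto (fun t => φ t / t) (𝓝[>] 0) atTop)
    (T : L2 𝕜 d →L[𝕜] L2 𝕜 d) (ω : Omega d) (J : DCube d)
    (q : Fin d → ℤ) (η' : Fin d → Fin 2) (f : L2 𝕜 d) {n : ℕ} (hn : ancGen φ (q - J.2) ≤ n) :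
    ∑ m ∈ Finset.range n, genTerm φ T ω (m + 1) J q η' f =
      ((pairWeight φ ω J (J.1, q) : ℝ) : 𝕜) * pairTerm T ω J (J.1, q) η' f := by
  rw [pairWeight_mul_pairTerm]
  obtain ⟨N, hN⟩ := Nat.exists_eq_succ_of_ne_zero (Nat.one_le_iff_ne_zero.1 (one_le_ancGen hφ' (q - J.2)))
  simp only [genTerm, hN, Nat.succ_eq_add_one] at hn ⊢
  rw [Finset.sum_add_distrib]
  congr 1
  · simp only [Nat.add_right_cancel_iff, Finset.sum_ite_eq, Finset.mem_range]
    rw [if_pos (by omega)]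
  · rw [← Finset.sum_subset (Finset.range_subset_range.2 hn)]
    · exact Finset.sum_congr rfl fun m hm => if_pos (by simpa using Finset.mem_range.1 hm)
    · intro m _ hm
      rw [if_neg]
      simpa using hm

/-- Each generation of climbing brings a factor `ratio d` < 1, so the bound is uniform in `n` and
summable over positions. It is the majorant for the limit n → ∞. -/
theorem WeakCZ.norm_sum_range_genTerm_le (h : WeakCZ ψ C T K) (hφ : IsModulus φ)
    (hφ' : Tendsto (fun t => φ t / t) (𝓝[>] 0) atTop) (hψ : IsModulus ψ) (hd : 0 < d)
    (ω : Omega d) (J : DCube d) (q : Fin d → ℤ) {η' : Fin d → Fin 2} (hη' : η' ≠ 0)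
    (f : L2 𝕜 d) (n : ℕ) :
    ‖∑ m ∈ Finset.range n, genTerm φ T ω (m + 1) J q η' f‖ ≤
      2 * (termConst d C * ‖f‖ * (1 - ratio d)⁻¹) * decay ψ (q - J.2) := by
  have hC := h.reg.1
  have hdec := decay_nonneg hψ (q - J.2)
  have hρ := ratio_lt_one hd
  have hB : 0 ≤ termConst d C * ‖f‖ * decay ψ (q - J.2) := by unfold termConst; positivity
  obtain ⟨N, hN⟩ := Nat.exists_eq_succ_of_ne_zero (Nat.one_le_iff_ne_zero.1 (one_le_ancGen hφ' (q - J.2)))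
  have hgeo : 0 ≤ termConst d C * ‖f‖ * decay ψ (q - J.2) * (1 - ratio d)⁻¹ :=
    mul_nonneg hB (inv_nonneg.2 (by linarith))
  have h1 : ‖∑ m ∈ Finset.range n, (if ancGen φ (q - J.2) = m + 1 then
      ∑ r ∈ Finset.range (m + 1 + 1), termX φ T ω J (J.1, q) r η' f else 0)‖ ≤
      termConst d C * ‖f‖ * decay ψ (q - J.2) * (1 - ratio d)⁻¹ := by
    simp only [hN, Nat.succ_eq_add_one, Nat.add_right_cancel_iff, Finset.sum_ite_eq,
      Finset.mem_range]
    split_ifs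
    · refine (norm_sum_le _ _).trans ((Finset.sum_le_sum fun r _ =>
        h.norm_termX_le hφ hφ' hψ hd ω J q r hη' f).trans ?_)
      rw [← Finset.mul_sum]
      exact mul_le_mul_of_nonneg_left (sum_range_ratio_le hd _) hB
    · rwa [norm_zero]
  have h2 : ‖∑ m ∈ Finset.range n, (if m + 1 ≤ ancGen φ (q - J.2) then
      termY φ T ω J (J.1, q) (m + 1) η' f else 0)‖ ≤
      termConst d C * ‖f‖ * decay ψ (q - J.2) * (1 - ratio d)⁻¹ := by
    refine (norm_sum_le _ _).trans ?_
    refine (Finset.sum_le_sum (g := fun m =>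
      termConst d C * ‖f‖ * decay ψ (q - J.2) * ratio d ^ m) fun m _ => ?_).trans ?_
    · split_ifs
      · refine (h.norm_termY_le hφ hφ' hψ hd ω J q (Nat.succ_ne_zero m) hη' f).trans
          (mul_le_mul_of_nonneg_left ?_ hB)
        exact pow_le_pow_of_le_one (ratio_pos d).le hρ.le (Nat.le_succ m)
      · rw [norm_zero]
        exact mul_nonneg hB (pow_nonneg (ratio_pos d).le _)
    · rw [← Finset.mul_sum]
      exact mul_le_mul_of_nonneg_left (sum_range_ratio_le hd _) hB
  simp only [genTerm, Finset.sum_add_distrib]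
  refine (norm_add_le _ _).trans ((add_le_add h1 h2).trans (le_of_eq ?_))
  ring

/-- The sum of the weighted contributions of all the cubes of the generation of `J`. -/
theorem WeakCZ.tendsto_sum_rowTerm (h : WeakCZ ψ C T K) (hφ : IsModulus φ)
    (hφ' : Tendsto (fun t => φ t / t) (𝓝[>] 0) atTop) (hψ : IsModulus ψ) (hd : 0 < d)
    (ω : Omega d) (J : DCube d) {η' : Fin d → Fin 2} (hη' : η' ≠ 0) (f : L2 𝕜 d) :
    Tendsto (fun n => ∑ m ∈ Finset.range n, ∑ i ∈ Finset.range (m + 1 + 1),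
      rowTerm φ T ω i (m + 1) J η' f) atTop
      (𝓝 (∑' q : Fin d → ℤ,
        ((pairWeight φ ω J (J.1, q) : ℝ) : 𝕜) * pairTerm T ω J (J.1, q) η' f)) := by
  have h1 : ∀ n, ∑ m ∈ Finset.range n, ∑ i ∈ Finset.range (m + 1 + 1),
      rowTerm φ T ω i (m + 1) J η' f =
      ∑' q : Fin d → ℤ, ∑ m ∈ Finset.range n, genTerm φ T ω (m + 1) J q η' f := fun n =>
    (hasSum_sum fun m _ => h.hasSum_genTerm hφ hφ' hψ hd ω (Nat.succ_ne_zero m) J hη'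
      f).tsum_eq.symm
  simp only [h1]
  refine tendsto_tsum_of_dominated_convergence
    ((summable_decay_sub hψ hd J.2).mul_left
      (2 * (termConst d C * ‖f‖ * (1 - ratio d)⁻¹))) (fun q => ?_)
    (Eventually.of_forall fun n q => h.norm_sum_range_genTerm_le hφ hφ' hψ hd ω J q hη' f n)
  refine tendsto_const_nhds.congr' ?_
  filter_upwards [eventually_ge_atTop (ancGen φ (q - J.2))] with n hn
  exact (sum_range_genTerm hφ' T ω J q η' f hn).symm

end Regroup

/-! ### Summation over the generations -/

section Summation

variable {𝕜 : Type*} [RCLike 𝕜] {d : ℕ} {φ ψ : ℝ → ℝ} {C : ℝ} {T : L2 𝕜 d →L[𝕜] L2 𝕜 d}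
  {K : (Fin d → ℝ) → (Fin d → ℝ) → 𝕜}

/-- The constant in the norm bound of the shifts. -/
def halfConst (d : ℕ) : ℝ := rawConst d + 2 ^ (d + 1) * carlesonConst d

theorem halfConst_pos (d : ℕ) : 0 < halfConst d := by
  have h1 := rawConst_pos d
  have h2 := carlesonConst_pos d
  unfold halfConst
  positivity

theorem WeakCZ.shiftBd_halfCoeff (h : WeakCZ ψ C T K) (hφ : IsModulus φ)
    (hφ' : Tendsto (fun t => φ t / t) (𝓝[>] 0) atTop) (hψ : IsModulus ψ) (hd : 0 < d)
    (hC : 0 < C) (ω : Omega d) (i j : ℕ) :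
    ShiftBd ω i j (halfCoeff φ T ω i j) (halfConst d * C * tau d φ ψ i j) := by
  have hτ := tau_pos (d := d) hφ hψ i j
  have h1 : ShiftBd ω i j (rawCoeff φ T ω i j) (rawConst d * C * tau d φ ψ i j) :=
    shiftBd_of_isCancellative ω (by have := rawConst_pos d; positivity)
      (isCancellative_rawCoeff φ T ω i j) (h.rawCoeff_bound hφ hφ' hψ hd ω i j)
  unfold halfCoeff
  split_ifs with hij
  · obtain ⟨rfl, rfl⟩ := hij
    have e1 : bigPsi ψ 1 = tau d φ ψ 0 0 := by rw [tau_zero_left, relScale_zero hφ]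
    have h2 := h.isCarleson hψ hd ω
    rw [e1] at h2
    have h3 := shiftBd_paraCoeff ω h2 (by have := carlesonConst_pos d; positivity)
    refine (h1.add h3).mono (le_of_eq ?_)
    unfold halfConst
    ring
  · refine h1.mono ?_
    unfold halfConst
    have := carlesonConst_pos d
    gcongr
    exact le_add_of_nonneg_right (by positivity)

theorem isCancellative_halfCoeff (φ : ℝ → ℝ) (T : L2 𝕜 d →L[𝕜] L2 𝕜 d) (ω : Omega d) {i j : ℕ}
    (hij : (i, j) ≠ (0, 0)) : (halfCoeff φ T ω i j).IsCancellative := by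
  unfold halfCoeff
  rw [if_neg (by simpa using hij)]
  exact isCancellative_rawCoeff φ T ω i j

theorem ShiftBd.norm_averagingOp_le {ω : Omega d} {i j : ℕ} {a : ShiftCoeff 𝕜 d} {M : ℝ}
    (h : ShiftBd ω i j a M) (P : DCube d) (f : L2 𝕜 d) : ‖averagingOp ω i j a P f‖ ≤ M * ‖f‖ := by
  obtain ⟨S, hS, hsum⟩ := h.subshift {P}
  have h1 : S f = averagingOp ω i j a P f := by
    have h2 := (hsum f).tsum_eq
    rw [← h2, tsum_fintype]
    simp
  rw [← h1]
  exact S.le_of_opNorm_le hS f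

/-- By orthonormality a row is one Haar coefficient of a single averaging operator. Its bound is
thus the norm bound of a one-cube subshift. -/
theorem inner_haar_averagingOp (φ : ℝ → ℝ) (T : L2 𝕜 d →L[𝕜] L2 𝕜 d) (ω : Omega d)
    (i j : ℕ) (J : DCube d) {η' : Fin d → Fin 2} (hη' : η' ≠ 0) (f : L2 𝕜 d) :
    inner 𝕜 (haar 𝕜 ω J η') (averagingOp ω i j (halfCoeff φ T ω i j) (anc ω j J) f) =
      rowTerm φ T ω i j J η' f := by
  classical
  rw [inner_averagingOp_halfCoeff, Finset.sum_eq_single J, Finset.sum_eq_single η']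
  · rw [inner_haar_haar_same ω rfl, if_pos ⟨rfl, rfl⟩, one_mul]
  · intro η _ hne
    rw [inner_haar_haar_same ω rfl, if_neg (fun hc => hne hc.2.symm), zero_mul]
  · intro hc
    exact absurd (mem_cancTypes.2 hη') hc
  · intro J' hJ' hne
    have h1 : J.1 = J'.1 := by
      have := anc_fst ω j J'
      rw [mem_desc.1 hJ', anc_fst] at this
      omega
    refine Finset.sum_eq_zero fun η _ => ?_
    rw [inner_haar_haar_same ω h1, if_neg (fun hc => hne hc.1.symm), zero_mul]
  · intro hc
    exact absurd (mem_desc.2 rfl) hc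

theorem WeakCZ.norm_rowTerm_le (h : WeakCZ ψ C T K) (hφ : IsModulus φ)
    (hφ' : Tendsto (fun t => φ t / t) (𝓝[>] 0) atTop) (hψ : IsModulus ψ) (hd : 0 < d)
    (hC : 0 < C) (ω : Omega d) (i j : ℕ) (J : DCube d) {η' : Fin d → Fin 2} (hη' : η' ≠ 0)
    (f : L2 𝕜 d) :
    ‖rowTerm φ T ω i j J η' f‖ ≤ halfConst d * C * tau d φ ψ i j * ‖f‖ := by
  rw [← inner_haar_averagingOp φ T ω i j J hη' f]
  refine (norm_inner_le_norm _ _).trans ?_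
  rw [norm_haar, one_mul]
  exact (h.shiftBd_halfCoeff hφ hφ' hψ hd hC ω i j).norm_averagingOp_le _ f

/-- The sum of the contributions of all pairs `J`, `Q`. -/
def rowTotal (φ : ℝ → ℝ) (T : L2 𝕜 d →L[𝕜] L2 𝕜 d) (ω : Omega d) (J : DCube d)
    (η' : Fin d → Fin 2) (f : L2 𝕜 d) : 𝕜 :=
  paraB T ω J η' * inner 𝕜 (haar 𝕜 ω J 0) f + pairTerm T ω J J η' f +
    ∑' q : Fin d → ℤ, ((pairWeight φ ω J (J.1, q) : ℝ) : 𝕜) * pairTerm T ω J (J.1, q) η' f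

/-- Summability is already known, so the sum may be identified along columns. The column j = 0 has
the single entry `F 0 0`, which is split off. -/
theorem hasSum_of_tendsto_triangle {F : ℕ → ℕ → 𝕜} (hs : Summable fun x : ℕ × ℕ => F x.1 x.2)
    (h0 : ∀ i j, j < i → F i j = 0) {s : 𝕜}
    (ht : Tendsto (fun n => ∑ m ∈ Finset.range n, ∑ i ∈ Finset.range (m + 1 + 1), F i (m + 1))
      atTop (𝓝 s)) : HasSum (fun x : ℕ × ℕ => F x.1 x.2) (F 0 0 + s) := by
  have h1 : HasSum (fun x : ℕ × ℕ => F x.2 x.1) (∑' x : ℕ × ℕ, F x.1 x.2) :=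
    (Equiv.prodComm ℕ ℕ).hasSum_iff.2 hs.hasSum
  have h2 : ∀ j, HasSum (fun i => F i j) (∑ i ∈ Finset.range (j + 1), F i j) := fun j =>
    hasSum_sum_of_ne_finset_zero fun i hi => h0 i j (by simpa [Nat.lt_succ_iff] using hi)
  have h3 : HasSum (fun j => ∑ i ∈ Finset.range (j + 1), F i j) (∑' x : ℕ × ℕ, F x.1 x.2) :=
    h1.prod_fiberwise h2
  have h4 := ((hasSum_nat_add_iff' 1).2 h3).tendsto_sum_nat
  have h5 := tendsto_nhds_unique h4 ht
  rw [Finset.sum_range_one, zero_add, Finset.sum_range_one, sub_eq_iff_eq_add'] at h5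
  rw [← h5]
  exact hs.hasSum

theorem WeakCZ.hasSum_rowTerm (h : WeakCZ ψ C T K) (hφ : IsModulus φ)
    (hφ' : Tendsto (fun t => φ t / t) (𝓝[>] 0) atTop) (hψ : IsModulus ψ) (hd : 0 < d)
    (hC : 0 < C) (hτ : Summable fun x : ℕ × ℕ => tau d φ ψ x.1 x.2)
    (ω : Omega d) (J : DCube d) {η' : Fin d → Fin 2} (hη' : η' ≠ 0) (f : L2 𝕜 d) :
    HasSum (fun x : ℕ × ℕ => rowTerm φ T ω x.1 x.2 J η' f) (rowTotal φ T ω J η' f) := by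
  have hs : Summable fun x : ℕ × ℕ => rowTerm φ T ω x.1 x.2 J η' f :=
    Summable.of_norm_bounded ((hτ.mul_left (halfConst d * C)).mul_right ‖f‖) fun x =>
      h.norm_rowTerm_le hφ hφ' hψ hd hC ω x.1 x.2 J hη' f
  have h1 := hasSum_of_tendsto_triangle (F := fun i j => rowTerm φ T ω i j J η' f) hs
    (fun i j hij => rowTerm_of_lt φ T ω hij J η' f)
    (h.tendsto_sum_rowTerm hφ hφ' hψ hd ω J hη' f)
  simp only [rowTerm_zero_zero φ T ω J hη' f] at h1
  unfold rowTotal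
  exact h1

/-- The cubes of generation k are grouped by their j-th ancestors. It matches sums over J with sums
over the cubes K that index a shift. -/
theorem HasSum.sum_desc {ω : Omega d} {k : ℤ} {F : DCube d → 𝕜} {s : 𝕜}
    (h : HasSum (fun q : Fin d → ℤ => F (k, q)) s) (j : ℕ) :
    HasSum (fun p : Fin d → ℤ => ∑ J ∈ desc ω (k - j, p) j, F J) s := by
  induction j with
  | zero => simpa [desc_zero] using h
  | succ j ih =>
    have hk : k - (j : ℤ) = (k - ((j + 1 : ℕ) : ℤ)) + 1 := by push_cast; ring
    rw [hk] at ih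
    have h1 := ((childEquiv ω (k - ((j + 1 : ℕ) : ℤ))).hasSum_iff.2 ih).prod_fiberwise
      fun q => hasSum_fintype _
    have e1 : (fun p : Fin d → ℤ => ∑ J ∈ desc ω (k - ((j + 1 : ℕ) : ℤ), p) (j + 1), F J) =
        fun p => ∑ ε, ∑ J ∈ desc ω (child ω (k - ((j + 1 : ℕ) : ℤ), p) ε) j, F J := by
      funext p
      rw [sum_desc_succ]
    rw [e1]
    exact h1

/-- The part of a shift that belongs to the Haar functions of generation `k`. -/
def genPart (φ : ℝ → ℝ) (T : L2 𝕜 d →L[𝕜] L2 𝕜 d) (ω : Omega d) (B : ℤ → Finset (Fin d → ℤ))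
    (i j : ℕ) (f g : L2 𝕜 d) (k : ℤ) : 𝕜 :=
  ∑ p ∈ B k, ∑ η' ∈ cancTypes d,
    inner 𝕜 g (haar 𝕜 ω (k, p) η') * rowTerm φ T ω i j (k, p) η' f

/-- The part of the sum of the shifts that belongs to the Haar functions of generation `k`. -/
def genTotal (φ : ℝ → ℝ) (T : L2 𝕜 d →L[𝕜] L2 𝕜 d) (ω : Omega d) (B : ℤ → Finset (Fin d → ℤ))
    (f g : L2 𝕜 d) (k : ℤ) : 𝕜 :=
  ∑ p ∈ B k, ∑ η' ∈ cancTypes d,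
    inner 𝕜 g (haar 𝕜 ω (k, p) η') * rowTotal φ T ω (k, p) η' f

/-- The bilinear form of the shift with the coefficients `halfCoeff`. -/
def halfForm (φ : ℝ → ℝ) (T : L2 𝕜 d →L[𝕜] L2 𝕜 d) (ω : Omega d) (i j : ℕ) (f g : L2 𝕜 d) : 𝕜 :=
  ∑' P, inner 𝕜 g (averagingOp ω i j (halfCoeff φ T ω i j) P f)

variable {B : ℤ → Finset (Fin d → ℤ)} {ω : Omega d} {f g : L2 𝕜 d}

theorem hasSum_genPart (φ : ℝ → ℝ) (T : L2 𝕜 d →L[𝕜] L2 𝕜 d)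
    (hB : ∀ k p η, p ∉ B k → inner 𝕜 g (haar 𝕜 ω (k, p) η) = 0) (i j : ℕ) (k : ℤ) :
    HasSum (fun p : Fin d → ℤ =>
        inner 𝕜 g (averagingOp ω i j (halfCoeff φ T ω i j) (k - j, p) f))
      (genPart φ T ω B i j f g k) := by
  have h1 : HasSum (fun p : Fin d → ℤ => ∑ η' ∈ cancTypes d,
      inner 𝕜 g (haar 𝕜 ω (k, p) η') * rowTerm φ T ω i j (k, p) η' f)
      (genPart φ T ω B i j f g k) :=
    hasSum_sum_of_ne_finset_zero fun p hp => Finset.sum_eq_zero fun η' _ => by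
      rw [hB k p η' hp, zero_mul]
  have h2 := HasSum.sum_desc (ω := ω) (F := fun J => ∑ η' ∈ cancTypes d,
      inner 𝕜 g (haar 𝕜 ω J η') * rowTerm φ T ω i j J η' f) h1 j
  simp only [inner_averagingOp_halfCoeff]
  exact h2

/-- Restricting the generation of h_J to R restricts K to those with `K.1 + j ∈ R`, which is a
subshift. This gives norm bounds uniform in R, the reason for controlling all subshifts. -/
theorem WeakCZ.exists_hasSum_indicator_genPart (h : WeakCZ ψ C T K) (hφ : IsModulus φ)
    (hφ' : Tendsto (fun t => φ t / t) (𝓝[>] 0) atTop) (hψ : IsModulus ψ) (hd : 0 < d)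
    (hC : 0 < C) (hB : ∀ k p η, p ∉ B k → inner 𝕜 g (haar 𝕜 ω (k, p) η) = 0) (i j : ℕ)
    (R : Set ℤ) :
    ∃ S : L2 𝕜 d →L[𝕜] L2 𝕜 d, ‖S‖ ≤ halfConst d * C * tau d φ ψ i j ∧
      HasSum (R.indicator (genPart φ T ω B i j f g)) (inner 𝕜 g (S f)) ∧
      (R = univ → halfForm φ T ω i j f g = inner 𝕜 g (S f)) := by
  classical
  obtain ⟨S, hS, hsum⟩ := (h.shiftBd_halfCoeff hφ hφ' hψ hd hC ω i j).subshift
    {P | P.1 + j ∈ R}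
  have h1 := (innerSL 𝕜 g).hasSum (hsum f)
  have h2 : HasSum ({P : DCube d | P.1 + j ∈ R}.indicator fun P =>
      inner 𝕜 g (averagingOp ω i j (halfCoeff φ T ω i j) P f)) (inner 𝕜 g (S f)) :=
    hasSum_subtype_iff_indicator.1 h1
  refine ⟨S, hS, ?_, fun hR => ?_⟩
  · have h3 := h2.prod_fiberwise (g := fun k => R.indicator (genPart φ T ω B i j f g) (k + j))
      fun k => by
        have h4 := hasSum_genPart (f := f) φ T hB i j (k + j)
        rw [add_sub_cancel_right] at h4
        by_cases hk : k + j ∈ R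
        · simpa [indicator, hk] using h4
        · simp [indicator, hk]
    exact (Equiv.addRight (j : ℤ)).hasSum_iff.1 h3
  · subst hR
    have h5 := h2.tsum_eq
    simp only [mem_univ, ofPred_true, indicator_univ] at h5
    exact h5

theorem WeakCZ.hasSum_genPart_halfForm (h : WeakCZ ψ C T K) (hφ : IsModulus φ)
    (hφ' : Tendsto (fun t => φ t / t) (𝓝[>] 0) atTop) (hψ : IsModulus ψ) (hd : 0 < d)
    (hC : 0 < C) (hB : ∀ k p η, p ∉ B k → inner 𝕜 g (haar 𝕜 ω (k, p) η) = 0) (i j : ℕ) :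
    HasSum (genPart φ T ω B i j f g) (halfForm φ T ω i j f g) := by
  obtain ⟨S, -, h1, h2⟩ := h.exists_hasSum_indicator_genPart (f := f) hφ hφ' hψ hd hC hB i j univ
  rw [h2 rfl]
  rwa [indicator_univ] at h1

theorem WeakCZ.norm_sum_genPart_le (h : WeakCZ ψ C T K) (hφ : IsModulus φ)
    (hφ' : Tendsto (fun t => φ t / t) (𝓝[>] 0) atTop) (hψ : IsModulus ψ) (hd : 0 < d)
    (hC : 0 < C) (hB : ∀ k p η, p ∉ B k → inner 𝕜 g (haar 𝕜 ω (k, p) η) = 0) (i j : ℕ)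
    (s : Finset ℤ) :
    ‖∑ k ∈ s, genPart φ T ω B i j f g k‖ ≤ halfConst d * C * ‖f‖ * ‖g‖ * tau d φ ψ i j := by
  obtain ⟨S, hS, h1, -⟩ :=
    h.exists_hasSum_indicator_genPart (f := f) hφ hφ' hψ hd hC hB i j (s : Set ℤ)
  have h2 : HasSum ((s : Set ℤ).indicator (genPart φ T ω B i j f g))
      (∑ k ∈ s, (s : Set ℤ).indicator (genPart φ T ω B i j f g) k) :=
    hasSum_sum_of_ne_finset_zero fun k hk => indicator_of_notMem (by simpa using hk) _
  rw [Finset.sum_congr rfl fun k hk => indicator_of_mem (Finset.mem_coe.2 hk) _] at h2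
  rw [h2.unique h1]
  refine (norm_inner_le_norm _ _).trans ?_
  refine (mul_le_mul_of_nonneg_left (S.le_of_opNorm_le hS f) (norm_nonneg g)).trans (le_of_eq ?_)
  ring

theorem WeakCZ.hasSum_genPart_genTotal (h : WeakCZ ψ C T K) (hφ : IsModulus φ)
    (hφ' : Tendsto (fun t => φ t / t) (𝓝[>] 0) atTop) (hψ : IsModulus ψ) (hd : 0 < d)
    (hC : 0 < C) (hτ : Summable fun x : ℕ × ℕ => tau d φ ψ x.1 x.2) (s : Finset ℤ) :
    HasSum (fun x : ℕ × ℕ => ∑ k ∈ s, genPart φ T ω B x.1 x.2 f g k)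
      (∑ k ∈ s, genTotal φ T ω B f g k) :=
  hasSum_sum fun k _ => hasSum_sum fun p _ => hasSum_sum fun _ hη' =>
    (h.hasSum_rowTerm hφ hφ' hψ hd hC hτ ω (k, p) (mem_cancTypes.1 hη') f).mul_left _

theorem WeakCZ.norm_sum_genTotal_le (h : WeakCZ ψ C T K) (hφ : IsModulus φ)
    (hφ' : Tendsto (fun t => φ t / t) (𝓝[>] 0) atTop) (hψ : IsModulus ψ) (hd : 0 < d)
    (hC : 0 < C) (hτ : Summable fun x : ℕ × ℕ => tau d φ ψ x.1 x.2)
    (hB : ∀ k p η, p ∉ B k → inner 𝕜 g (haar 𝕜 ω (k, p) η) = 0) (s : Finset ℤ) :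
    ‖∑ k ∈ s, genTotal φ T ω B f g k‖ ≤
      halfConst d * C * ‖f‖ * ‖g‖ * ∑' x : ℕ × ℕ, tau d φ ψ x.1 x.2 := by
  rw [← (h.hasSum_genPart_genTotal hφ hφ' hψ hd hC hτ s).tsum_eq]
  exact tsum_of_norm_bounded (hτ.hasSum.mul_left _) fun x =>
    h.norm_sum_genPart_le hφ hφ' hψ hd hC hB x.1 x.2 s

theorem WeakCZ.norm_halfForm_le (h : WeakCZ ψ C T K) (hφ : IsModulus φ)
    (hφ' : Tendsto (fun t => φ t / t) (𝓝[>] 0) atTop) (hψ : IsModulus ψ) (hd : 0 < d)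
    (hC : 0 < C) (hB : ∀ k p η, p ∉ B k → inner 𝕜 g (haar 𝕜 ω (k, p) η) = 0) (i j : ℕ) :
    ‖halfForm φ T ω i j f g‖ ≤ halfConst d * C * ‖f‖ * ‖g‖ * tau d φ ψ i j :=
  le_of_tendsto (h.hasSum_genPart_halfForm hφ hφ' hψ hd hC hB i j).norm
    (Eventually.of_forall fun s => h.norm_sum_genPart_le hφ hφ' hψ hd hC hB i j s)

theorem WeakCZ.summable_halfForm (h : WeakCZ ψ C T K) (hφ : IsModulus φ)
    (hφ' : Tendsto (fun t => φ t / t) (𝓝[>] 0) atTop) (hψ : IsModulus ψ) (hd : 0 < d)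
    (hC : 0 < C) (hτ : Summable fun x : ℕ × ℕ => tau d φ ψ x.1 x.2)
    (hB : ∀ k p η, p ∉ B k → inner 𝕜 g (haar 𝕜 ω (k, p) η) = 0) :
    Summable fun x : ℕ × ℕ => halfForm φ T ω x.1 x.2 f g :=
  Summable.of_norm_bounded (hτ.mul_left _) fun x =>
    h.norm_halfForm_le hφ hφ' hψ hd hC hB x.1 x.2

/-- Exchange of the sum over generations with the sum over (i,j). The partial sums over any finite
set of generations are dominated by a multiple of τ(i,j), so dominated convergence for series
applies. -/
theorem WeakCZ.hasSum_genTotal (h : WeakCZ ψ C T K) (hφ : IsModulus φ)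
    (hφ' : Tendsto (fun t => φ t / t) (𝓝[>] 0) atTop) (hψ : IsModulus ψ) (hd : 0 < d)
    (hC : 0 < C) (hτ : Summable fun x : ℕ × ℕ => tau d φ ψ x.1 x.2)
    (hB : ∀ k p η, p ∉ B k → inner 𝕜 g (haar 𝕜 ω (k, p) η) = 0) :
    HasSum (genTotal φ T ω B f g) (∑' x : ℕ × ℕ, halfForm φ T ω x.1 x.2 f g) := by
  have h1 : Tendsto (fun s : Finset ℤ => ∑' x : ℕ × ℕ, ∑ k ∈ s, genPart φ T ω B x.1 x.2 f g k)
      atTop (𝓝 (∑' x : ℕ × ℕ, halfForm φ T ω x.1 x.2 f g)) :=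
    tendsto_tsum_of_dominated_convergence
      (hτ.mul_left (halfConst d * C * ‖f‖ * ‖g‖))
      (fun x => h.hasSum_genPart_halfForm hφ hφ' hψ hd hC hB x.1 x.2)
      (Eventually.of_forall fun s x => h.norm_sum_genPart_le hφ hφ' hψ hd hC hB x.1 x.2 s)
  refine h1.congr fun s => ?_
  exact (h.hasSum_genPart_genTotal hφ hφ' hψ hd hC hτ s).tsum_eq

end Summation

/-! ### The telescoping decomposition -/

section Telescope

variable {𝕜 : Type*} [RCLike 𝕜] {d : ℕ} {φ ψ : ℝ → ℝ} {C : ℝ} {T : L2 𝕜 d →L[𝕜] L2 𝕜 d}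
  {K : (Fin d → ℝ) → (Fin d → ℝ) → 𝕜}

/-- At every generation `k`, the Haar functions of the cubes outside `B k` are orthogonal to `f`. -/
def HaarSupported (ω : Omega d) (B : ℤ → Finset (Fin d → ℤ)) (f : L2 𝕜 d) : Prop :=
  ∀ k p η, p ∉ B k → inner 𝕜 (haar 𝕜 ω (k, p) η) f = 0

/-- The orthogonal projection on the functions that are constant on the cubes of generation `k`. -/
def condExpGen (ω : Omega d) (B : ℤ → Finset (Fin d → ℤ)) (k : ℤ) (f : L2 𝕜 d) : L2 𝕜 d :=
  ∑ p ∈ B k, inner 𝕜 (haar 𝕜 ω (k, p) 0) f • haar 𝕜 ω (k, p) 0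

/-- The martingale difference of generation `k`. -/
def diffGen (ω : Omega d) (B : ℤ → Finset (Fin d → ℤ)) (k : ℤ) (f : L2 𝕜 d) : L2 𝕜 d :=
  ∑ p ∈ B k, ∑ η ∈ cancTypes d, inner 𝕜 (haar 𝕜 ω (k, p) η) f • haar 𝕜 ω (k, p) η

variable {B : ℤ → Finset (Fin d → ℤ)} {ω : Omega d} {f g : L2 𝕜 d}

theorem condExpGen_succ (hf : HaarSupported ω B f) (k : ℤ) :
    condExpGen ω B (k + 1) f = condExpGen ω B k f + diffGen ω B k f := by
  have h1 : HasSum (fun q : Fin d → ℤ =>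
      inner 𝕜 (haar 𝕜 ω (k + 1, q) 0) f • haar 𝕜 ω (k + 1, q) 0) (condExpGen ω B (k + 1) f) :=
    hasSum_sum_of_ne_finset_zero fun q hq => by rw [hf _ _ _ hq, zero_smul]
  have h2 : HasSum (fun p : Fin d → ℤ => ∑ η,
      inner 𝕜 (haar 𝕜 ω (k, p) η) f • haar 𝕜 ω (k, p) η)
      (∑ p ∈ B k, ∑ η, inner 𝕜 (haar 𝕜 ω (k, p) η) f • haar 𝕜 ω (k, p) η) :=
    hasSum_sum_of_ne_finset_zero fun p hp => Finset.sum_eq_zero fun η _ => by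
      rw [hf _ _ _ hp, zero_smul]
  have h3 := ((childEquiv ω k).hasSum_iff.2 h1).prod_fiberwise fun p => hasSum_fintype _
  have e1 : (fun p : Fin d → ℤ => ∑ η, inner 𝕜 (haar 𝕜 ω (k, p) η) f • haar 𝕜 ω (k, p) η) =
      fun p => ∑ ε, inner 𝕜 (haar 𝕜 ω (child ω (k, p) ε) 0) f • haar 𝕜 ω (child ω (k, p) ε) 0 := by
    funext p
    rw [sum_child_inner_smul]
  have h5 : HasSum (fun p : Fin d → ℤ => ∑ η,
      inner 𝕜 (haar 𝕜 ω (k, p) η) f • haar 𝕜 ω (k, p) η) (condExpGen ω B (k + 1) f) := by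
    rw [e1]
    exact h3
  have h4 : condExpGen ω B (k + 1) f =
      ∑ p ∈ B k, ∑ η, inner 𝕜 (haar 𝕜 ω (k, p) η) f • haar 𝕜 ω (k, p) η := h5.unique h2
  rw [h4, condExpGen, diffGen, ← Finset.sum_add_distrib]
  exact Finset.sum_congr rfl fun p _ => sum_univ_eq_add_cancTypes _

theorem norm_condExpGen_sq (ω : Omega d) (B : ℤ → Finset (Fin d → ℤ)) (k : ℤ) (f : L2 𝕜 d) :
    ‖condExpGen ω B k f‖ ^ 2 = ∑ p ∈ B k, ‖(inner 𝕜 (haar 𝕜 ω (k, p) 0) f : 𝕜)‖ ^ 2 :=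
  norm_sq_sum_smul_orthonormal (orthonormal_haar_zero (𝕜 := 𝕜) ω k) (B k) _

theorem norm_condExpGen_le (ω : Omega d) (B : ℤ → Finset (Fin d → ℤ)) (k : ℤ) (f : L2 𝕜 d) :
    ‖condExpGen ω B k f‖ ≤ ‖f‖ := by
  refine le_of_sq_le_sq ?_ (norm_nonneg f)
  rw [norm_condExpGen_sq]
  exact (orthonormal_haar_zero (𝕜 := 𝕜) ω k).sum_inner_products_le f

/-- The bilinear form of generation `k`. -/
def genForm (T : L2 𝕜 d →L[𝕜] L2 𝕜 d) (ω : Omega d) (B : ℤ → Finset (Fin d → ℤ)) (f g : L2 𝕜 d)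
    (k : ℤ) : 𝕜 :=
  inner 𝕜 (diffGen ω B k g) (T (condExpGen ω B k f + (2⁻¹ : 𝕜) • diffGen ω B k f))

/-- In the expansion of the increment the mixed terms are divided between T and its adjoint, and the
diagonal term with both differences is split into equal halves. -/
theorem genForm_add_conj (hf : HaarSupported ω B f) (hg : HaarSupported ω B g) (k : ℤ) :
    genForm T ω B f g k + starRingEnd 𝕜 (genForm (ContinuousLinearMap.adjoint T) ω B g f k) =
      inner 𝕜 (condExpGen ω B (k + 1) g) (T (condExpGen ω B (k + 1) f)) -
        inner 𝕜 (condExpGen ω B k g) (T (condExpGen ω B k f)) := by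
  rw [condExpGen_succ hf, condExpGen_succ hg]
  unfold genForm
  rw [ContinuousLinearMap.adjoint_inner_right, inner_conj_symm]
  simp only [map_add, map_smul, inner_add_left, inner_add_right, inner_smul_left, inner_smul_right,
    map_inv₀, map_ofNat]
  have h2 : (2⁻¹ : 𝕜) + 2⁻¹ = 1 := by norm_num
  linear_combination (inner 𝕜 (diffGen ω B k g) (T (diffGen ω B k f)) : 𝕜) * h2

theorem sum_Ico_genForm (hf : HaarSupported ω B f) (hg : HaarSupported ω B g) (n : ℕ) :
    ∑ k ∈ Finset.Ico (-n : ℤ) n, (genForm T ω B f g k +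
        starRingEnd 𝕜 (genForm (ContinuousLinearMap.adjoint T) ω B g f k)) =
      inner 𝕜 (condExpGen ω B n g) (T (condExpGen ω B n f)) -
        inner 𝕜 (condExpGen ω B (-n) g) (T (condExpGen ω B (-n) f)) := by
  simp only [genForm_add_conj hf hg]
  generalize hF : (fun k : ℤ => (inner 𝕜 (condExpGen ω B k g) (T (condExpGen ω B k f)) : 𝕜)) = F
  have hF' : ∀ k : ℤ, (inner 𝕜 (condExpGen ω B k g) (T (condExpGen ω B k f)) : 𝕜) = F k :=
    fun k => by rw [← hF]
  simp only [hF']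
  clear hF hF'
  induction n with
  | zero => simp
  | succ n ih =>
    have h1 : Finset.Ico (-((n + 1 : ℕ) : ℤ)) ((n + 1 : ℕ) : ℤ) =
        insert (-((n + 1 : ℕ) : ℤ)) (insert (n : ℤ) (Finset.Ico (-n : ℤ) n)) := by
      ext k
      simp only [Finset.mem_Ico, Finset.mem_insert]
      omega
    rw [h1, Finset.sum_insert (by simp), Finset.sum_insert (by simp), ih]
    push_cast
    rw [show (-((n : ℤ) + 1) + 1) = -n by ring]
    ring

theorem inner_diffGen_left (ω : Omega d) (B : ℤ → Finset (Fin d → ℤ)) (k : ℤ) (g x : L2 𝕜 d) :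
    inner 𝕜 (diffGen ω B k g) x = ∑ p ∈ B k, ∑ η ∈ cancTypes d,
      inner 𝕜 g (haar 𝕜 ω (k, p) η) * inner 𝕜 (haar 𝕜 ω (k, p) η) x := by
  simp only [diffGen, sum_inner, inner_smul_left, inner_conj_symm]

theorem WeakCZ.norm_pairTerm_le (h : WeakCZ ψ C T K) (hψ : IsModulus ψ) (hd : 0 < d)
    (ω : Omega d) (k : ℤ) (p q : Fin d → ℤ) {η' : Fin d → Fin 2} (hη' : η' ≠ 0) (f : L2 𝕜 d) :
    ‖pairTerm T ω (k, p) (k, q) η' f‖ ≤ (2 + 2 ^ d) * ‖f‖ * rowBound ψ C p q := by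
  have hR := rowBound_nonneg hψ h.reg.1 p q
  have h1 := fun η => h.norm_inner_haar_le_rowBound hψ hd ω k p q η hη'
  have h2 : ∀ J : DCube d, ‖(inner 𝕜 (haar 𝕜 ω J 0) f : 𝕜)‖ ≤ ‖f‖ := fun J => by
    refine (norm_inner_le_norm _ _).trans (le_of_eq ?_)
    rw [norm_haar, one_mul]
  unfold pairTerm
  refine (norm_add_le _ _).trans ?_
  have h3 := norm_sum_cancTypes_mul_inner_le ω (k, q) _ h1 f
  have h4 : ‖(inner 𝕜 (haar 𝕜 ω (k, q) 0) f - inner 𝕜 (haar 𝕜 ω (k, p) 0) f : 𝕜)‖ ≤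
      ‖f‖ + ‖f‖ := (norm_sub_le _ _).trans (add_le_add (h2 _) (h2 _))
  rw [norm_mul, norm_mul, norm_inv, RCLike.norm_ofNat]
  have h5 := mul_le_mul (h1 0) h4 (norm_nonneg _) hR
  have h6 : 0 ≤ (2 : ℝ) ^ d * (rowBound ψ C p q * ‖f‖) := by positivity
  linarith

/-- The value of `rowTotal` with all weights equal to one. -/
theorem WeakCZ.inner_haar_condExpGen_add (h : WeakCZ ψ C T K) (hψ : IsModulus ψ) (hd : 0 < d)
    (hf : HaarSupported ω B f) (k : ℤ) (p : Fin d → ℤ) {η' : Fin d → Fin 2} (hη' : η' ≠ 0) :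
    inner 𝕜 (haar 𝕜 ω (k, p) η') (T (condExpGen ω B k f + (2⁻¹ : 𝕜) • diffGen ω B k f)) =
      paraB T ω (k, p) η' * inner 𝕜 (haar 𝕜 ω (k, p) 0) f +
        ∑' q : Fin d → ℤ, pairTerm T ω (k, p) (k, q) η' f := by
  have h1 := (h.hasSum_paraB hψ hd ω (k, p) hη').mul_right (inner 𝕜 (haar 𝕜 ω (k, p) 0) f : 𝕜)
  have h2 : Summable fun q : Fin d → ℤ => pairTerm T ω (k, p) (k, q) η' f :=
    Summable.of_norm_bounded ((summable_rowBound hψ hd C p).mul_left _) fun q =>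
      h.norm_pairTerm_le hψ hd ω k p q hη' f
  have h3 := h1.add h2.hasSum
  have e1 : ∀ q : Fin d → ℤ, (inner 𝕜 (haar 𝕜 ω (k, p) η') (T (haar 𝕜 ω (k, q) 0)) : 𝕜) *
      inner 𝕜 (haar 𝕜 ω (k, p) 0) f + pairTerm T ω (k, p) (k, q) η' f =
      inner 𝕜 (haar 𝕜 ω (k, p) η') (T (inner 𝕜 (haar 𝕜 ω (k, q) 0) f • haar 𝕜 ω (k, q) 0 +
        (2⁻¹ : 𝕜) • ∑ η ∈ cancTypes d,
          inner 𝕜 (haar 𝕜 ω (k, q) η) f • haar 𝕜 ω (k, q) η)) := by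
    intro q
    simp only [pairTerm, map_add, map_smul, map_sum, inner_add_right, inner_smul_right, inner_sum,
      Finset.mul_sum]
    rw [Finset.sum_congr rfl fun η _ => by
      rw [mul_comm (inner 𝕜 (haar 𝕜 ω (k, p) η') (T (haar 𝕜 ω (k, q) η)) : 𝕜)]]
    ring
  have h4 : HasSum (fun q : Fin d → ℤ =>
      (inner 𝕜 (haar 𝕜 ω (k, p) η') (T (inner 𝕜 (haar 𝕜 ω (k, q) 0) f • haar 𝕜 ω (k, q) 0 +
        (2⁻¹ : 𝕜) • ∑ η ∈ cancTypes d,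
          inner 𝕜 (haar 𝕜 ω (k, q) η) f • haar 𝕜 ω (k, q) η)) : 𝕜))
      (∑ q ∈ B k, inner 𝕜 (haar 𝕜 ω (k, p) η')
        (T (inner 𝕜 (haar 𝕜 ω (k, q) 0) f • haar 𝕜 ω (k, q) 0 +
        (2⁻¹ : 𝕜) • ∑ η ∈ cancTypes d,
          inner 𝕜 (haar 𝕜 ω (k, q) η) f • haar 𝕜 ω (k, q) η))) :=
    hasSum_sum_of_ne_finset_zero fun q hq => by
      simp only [hf k q _ hq, zero_smul, Finset.sum_const_zero, smul_zero, add_zero, map_zero,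
        inner_zero_right]
  simp only [← e1] at h4
  rw [← h4.unique h3]
  simp only [e1]
  rw [← inner_sum, ← map_sum, Finset.sum_add_distrib, ← Finset.smul_sum]
  rfl

end Telescope

/-! ### Averaging over the dyadic systems -/

section Averaging

variable {𝕜 : Type*} [RCLike 𝕜] {d : ℕ} {φ ψ : ℝ → ℝ} {C : ℝ} {T : L2 𝕜 d →L[𝕜] L2 𝕜 d}
  {K : (Fin d → ℝ) → (Fin d → ℝ) → 𝕜}

/-- The translation vector stays in the compact box [0, 2^{-k}]^d, so a continuous function of it is
bounded. -/
theorem integrable_comp_shiftVec {G : (Fin d → ℝ) → 𝕜} (hG : Continuous G) (k : ℤ) :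
    Integrable (fun ω => G (shiftVec ω k)) (prob d) := by
  obtain ⟨M, hM⟩ := (isCompact_Icc (a := (0 : Fin d → ℝ))
    (b := fun _ => (2 : ℝ) ^ (-k))).exists_bound_of_continuousOn hG.continuousOn
  exact Integrable.of_bound (hG.measurable.comp (measurable_shiftVec k)).aestronglyMeasurable M
    (Eventually.of_forall fun ω => hM _ ⟨shiftVec_nonneg ω k, shiftVec_le ω k⟩)

theorem integrable_tsum_and_integral_eq_zero {ι : Type*} [Countable ι] {R : ι → Omega d → 𝕜}
    {b : ι → ℝ} (hR : ∀ q, AEStronglyMeasurable (R q) (prob d)) (hb : Summable b)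
    (hRb : ∀ q ω, ‖R q ω‖ ≤ b q) (h0 : ∀ q, ∫ ω, R q ω ∂(prob d) = 0) :
    Integrable (fun ω => ∑' q, R q ω) (prob d) ∧ ∫ ω, ∑' q, R q ω ∂(prob d) = 0 := by
  have hs : ∀ ω, Summable fun q => R q ω := fun ω => Summable.of_norm_bounded hb fun q => hRb q ω
  have hi : ∀ q, Integrable (R q) (prob d) := fun q =>
    Integrable.of_bound (hR q) (b q) (Eventually.of_forall (hRb q))
  have hm : AEStronglyMeasurable (fun ω => ∑' q, R q ω) (prob d) := by
    refine aestronglyMeasurable_of_tendsto_ae (f := fun (s : Finset ι) ω => ∑ q ∈ s, R q ω) atTop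
      (fun s => ?_) (Eventually.of_forall fun ω => (hs ω).hasSum)
    exact Finset.aestronglyMeasurable_fun_sum s fun q _ => hR q
  refine ⟨Integrable.of_bound hm (∑' q, b q) (Eventually.of_forall fun ω =>
    tsum_of_norm_bounded hb.hasSum fun q => hRb q ω), ?_⟩
  have h1 := hasSum_integral_of_summable_integral_norm hi (Summable.of_nonneg_of_le
    (fun q => integral_nonneg fun ω => norm_nonneg _) (fun q => ?_) hb)
  · simp only [h0] at h1
    exact h1.unique hasSum_zero
  · refine (integral_mono (hi q).norm (integrable_const (b q)) (hRb q)).trans (le_of_eq ?_)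
    simp

variable {B : ℤ → Finset (Fin d → ℤ)} {f g : L2 𝕜 d}

theorem continuous_inner_haarAt_left (I : DCube d) (η : Fin d → Fin 2) (x : L2 𝕜 d) :
    Continuous fun s => (inner 𝕜 (haarAt 𝕜 I η s) x : 𝕜) :=
  (continuous_haarAt I η).inner continuous_const

theorem continuous_inner_haarAt_right (I : DCube d) (η : Fin d → Fin 2) (x : L2 𝕜 d) :
    Continuous fun s => (inner 𝕜 x (haarAt 𝕜 I η s) : 𝕜) :=
  continuous_const.inner (continuous_haarAt I η)

theorem continuous_inner_haarAt_apply (T : L2 𝕜 d →L[𝕜] L2 𝕜 d) (I J : DCube d)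
    (η η' : Fin d → Fin 2) :
    Continuous fun s => (inner 𝕜 (haarAt 𝕜 J η' s) (T (haarAt 𝕜 I η s)) : 𝕜) :=
  (continuous_haarAt J η').inner (T.continuous.comp (continuous_haarAt I η))

theorem exists_continuous_pairTerm (T : L2 𝕜 d →L[𝕜] L2 𝕜 d) (k : ℤ) (p q : Fin d → ℤ)
    (η' : Fin d → Fin 2) (f g : L2 𝕜 d) :
    ∃ G : (Fin d → ℝ) → 𝕜, Continuous G ∧ ∀ ω,
      inner 𝕜 g (haar 𝕜 ω (k, p) η') * pairTerm T ω (k, p) (k, q) η' f = G (shiftVec ω k) := by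
  refine ⟨fun s => inner 𝕜 g (haarAt 𝕜 (k, p) η' s) *
    (inner 𝕜 (haarAt 𝕜 (k, p) η' s) (T (haarAt 𝕜 (k, q) 0 s)) *
      (inner 𝕜 (haarAt 𝕜 (k, q) 0 s) f - inner 𝕜 (haarAt 𝕜 (k, p) 0 s) f) +
    2⁻¹ * ∑ η ∈ cancTypes d, inner 𝕜 (haarAt 𝕜 (k, p) η' s) (T (haarAt 𝕜 (k, q) η s)) *
      inner 𝕜 (haarAt 𝕜 (k, q) η s) f), ?_, fun ω => ?_⟩
  · refine (continuous_inner_haarAt_right _ _ _).mul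
      (((continuous_inner_haarAt_apply _ _ _ _ _).mul
        ((continuous_inner_haarAt_left _ _ _).sub (continuous_inner_haarAt_left _ _ _))).add
      (continuous_const.mul (continuous_finsetSum _ fun η _ =>
        (continuous_inner_haarAt_apply _ _ _ _ _).mul (continuous_inner_haarAt_left _ _ _))))
  · simp only [pairTerm, haar_eq_haarAt]

theorem exists_continuous_genForm (T : L2 𝕜 d →L[𝕜] L2 𝕜 d) (B : ℤ → Finset (Fin d → ℤ)) (k : ℤ)
    (p : Fin d → ℤ) (η' : Fin d → Fin 2) (f g : L2 𝕜 d) :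
    ∃ G : (Fin d → ℝ) → 𝕜, Continuous G ∧ ∀ ω, inner 𝕜 g (haar 𝕜 ω (k, p) η') *
      inner 𝕜 (haar 𝕜 ω (k, p) η') (T (condExpGen ω B k f + (2⁻¹ : 𝕜) • diffGen ω B k f)) =
        G (shiftVec ω k) := by
  -- All Haar functions involved have generation k, so the expression is a continuous function of
  -- the common translation vector.
  refine ⟨fun s => inner 𝕜 g (haarAt 𝕜 (k, p) η' s) * inner 𝕜 (haarAt 𝕜 (k, p) η' s)
    (T ((∑ q ∈ B k, inner 𝕜 (haarAt 𝕜 (k, q) 0 s) f • haarAt 𝕜 (k, q) 0 s) +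
      (2⁻¹ : 𝕜) • ∑ q ∈ B k, ∑ η ∈ cancTypes d,
        inner 𝕜 (haarAt 𝕜 (k, q) η s) f • haarAt 𝕜 (k, q) η s)), ?_, fun ω => ?_⟩
  · have h1 : ∀ (q : Fin d → ℤ) (η : Fin d → Fin 2), Continuous fun s =>
        (inner 𝕜 (haarAt 𝕜 (k, q) η s) f : 𝕜) • haarAt 𝕜 (k, q) η s := fun q η =>
      Continuous.smul (f := fun s => (inner 𝕜 (haarAt 𝕜 (k, q) η s) f : 𝕜))
        (continuous_inner_haarAt_left _ _ _) (continuous_haarAt _ _)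
    have h2 : Continuous fun s =>
        (∑ q ∈ B k, (inner 𝕜 (haarAt 𝕜 (k, q) 0 s) f : 𝕜) • haarAt 𝕜 (k, q) 0 s) +
      (2⁻¹ : 𝕜) • ∑ q ∈ B k, ∑ η ∈ cancTypes d,
        (inner 𝕜 (haarAt 𝕜 (k, q) η s) f : 𝕜) • haarAt 𝕜 (k, q) η s :=
      (continuous_finsetSum _ fun q _ => h1 q 0).add ((continuous_const_smul (Γ := 𝕜) _).comp
        (continuous_finsetSum _ fun q _ => continuous_finsetSum _ fun η _ => h1 q η))
    exact (continuous_inner_haarAt_right _ _ _).mul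
      ((continuous_haarAt _ _).inner (T.continuous.comp h2))
  · simp only [condExpGen, diffGen, haar_eq_haarAt]

/-- The deviation of the weights from one. -/
def excess (𝕜 : Type*) [RCLike 𝕜] {d : ℕ} (φ : ℝ → ℝ) (k : ℤ) (p q : Fin d → ℤ) (ω : Omega d) : 𝕜 :=
  ((pairWeight φ ω (k, p) (k, q) : ℝ) : 𝕜) + (if q = p then 1 else 0) - 1

theorem measurable_excess (k : ℤ) (p q : Fin d → ℤ) : Measurable (excess 𝕜 φ k p q) := by
  have h1 : Measurable fun ω : Omega d => pairWeight φ ω (k, p) (k, q) := by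
    unfold pairWeight
    split_ifs
    · exact measurable_const
    · exact measurable_commonWeight _ rfl
  exact ((RCLike.measurable_ofReal.comp h1).add_const _).sub_const _

theorem norm_excess_le (hφ : IsModulus φ) (hφ' : Tendsto (fun t => φ t / t) (𝓝[>] 0) atTop)
    (k : ℤ) (p q : Fin d → ℤ) (ω : Omega d) : ‖excess 𝕜 φ k p q ω‖ ≤ 4 := by
  have h1 := norm_pairWeight_le (𝕜 := 𝕜) hφ hφ' ω (J := (k, p)) (Q := (k, q)) rfl
  have h2 : ‖(if q = p then 1 else 0 : 𝕜)‖ ≤ 1 := by split_ifs <;> simp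
  have h3 : ‖(1 : 𝕜)‖ = 1 := norm_one
  refine (norm_sub_le _ _).trans ?_
  have h5 := norm_add_le ((pairWeight φ ω (k, p) (k, q) : ℝ) : 𝕜) (if q = p then 1 else 0)
  rw [h3]
  linarith

/-- On the diagonal the excess vanishes identically. Elsewhere it is a weight of mean 1, minus 1,
independent of the translation vector. -/
theorem integral_excess_mul (hφ : IsModulus φ)
    (hφ' : Tendsto (fun t => φ t / t) (𝓝[>] 0) atTop) (k : ℤ) (p q : Fin d → ℤ)
    {G : (Fin d → ℝ) → 𝕜} (hG : Continuous G) :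
    ∫ ω, excess 𝕜 φ k p q ω * G (shiftVec ω k) ∂(prob d) = 0 := by
  by_cases hq : q = p
  · subst hq
    have h0 : ∀ ω, excess 𝕜 φ k q q ω = 0 := fun ω => by simp [excess, pairWeight_self]
    simp [h0]
  · have hN := two_mul_norm_le_two_pow_ancGen hφ hφ' (q - p)
    have e1 : ∀ ω, excess 𝕜 φ k p q ω * G (shiftVec ω k) =
        ((commonWeight (ancGen φ (q - p)) (k, p) (k, q) ω : ℝ) : 𝕜) * G (shiftVec ω k) -
          G (shiftVec ω k) := fun ω => by
      rw [excess, pairWeight, if_neg hq, if_neg hq]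
      ring
    have hwm := (RCLike.measurable_ofReal (𝕜 := 𝕜)).comp (measurable_commonWeight (d := d)
      (ancGen φ (q - p)) (I := (k, p)) (J := (k, q)) rfl)
    have hwb : ∀ ω : Omega d, ‖((commonWeight (ancGen φ (q - p)) (k, p) (k, q) ω : ℝ) : 𝕜)‖ ≤ 2 := by
      intro ω
      have h1 := commonWeight_nonneg (ancGen φ (q - p)) (k, p) (k, q) ω
      rw [RCLike.norm_ofReal, abs_of_nonneg h1]
      exact commonWeight_le_two (I := (k, p)) (J := (k, q)) rfl hN ω
    have hwi : Integrable (fun ω => ((commonWeight (ancGen φ (q - p)) (k, p) (k, q) ω : ℝ) : 𝕜) *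
        G (shiftVec ω k)) (prob d) :=
      (integrable_comp_shiftVec hG k).bdd_mul (c := 2) hwm.aestronglyMeasurable
        (Eventually.of_forall hwb)
    simp only [e1]
    rw [integral_sub hwi (integrable_comp_shiftVec hG k), integral_commonWeight_mul hN hG, sub_self]

/-- Isolates the effect of the random weights: with all weights equal to 1 the row is the matrix
entry against E_k f + D_k f / 2. The rest is a series of terms with mean zero. -/
theorem WeakCZ.rowTotal_eq_add_tsum (h : WeakCZ ψ C T K) (hφ : IsModulus φ)
    (hφ' : Tendsto (fun t => φ t / t) (𝓝[>] 0) atTop) (hψ : IsModulus ψ) (hd : 0 < d)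
    {ω : Omega d} (hf : HaarSupported ω B f) (k : ℤ) (p : Fin d → ℤ) {η' : Fin d → Fin 2}
    (hη' : η' ≠ 0) :
    rowTotal φ T ω (k, p) η' f =
      inner 𝕜 (haar 𝕜 ω (k, p) η') (T (condExpGen ω B k f + (2⁻¹ : 𝕜) • diffGen ω B k f)) +
        ∑' q : Fin d → ℤ, excess 𝕜 φ k p q ω *
          pairTerm T ω (k, p) (k, q) η' f := by
  have hb := (summable_rowBound hψ hd C p).mul_left ((2 + 2 ^ d) * ‖f‖)
  have h1 : Summable fun q : Fin d → ℤ => pairTerm T ω (k, p) (k, q) η' f :=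
    Summable.of_norm_bounded hb fun q => h.norm_pairTerm_le hψ hd ω k p q hη' f
  have h2 : Summable fun q : Fin d → ℤ =>
      ((pairWeight φ ω (k, p) (k, q) : ℝ) : 𝕜) * pairTerm T ω (k, p) (k, q) η' f := by
    refine Summable.of_norm_bounded (hb.mul_left 2) fun q => ?_
    rw [norm_mul]
    exact mul_le_mul (norm_pairWeight_le hφ hφ' ω rfl) (h.norm_pairTerm_le hψ hd ω k p q hη' f)
      (norm_nonneg _) (by norm_num)
  have h3 : HasSum (fun q => if q = p then pairTerm T ω (k, p) (k, p) η' f else 0)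
      (pairTerm T ω (k, p) (k, p) η' f) := hasSum_ite_eq p _
  have h4 := ((h2.hasSum.add h3).sub h1.hasSum).tsum_eq
  have e1 : (fun q : Fin d → ℤ => excess 𝕜 φ k p q ω * pairTerm T ω (k, p) (k, q) η' f) =
      fun q => ((pairWeight φ ω (k, p) (k, q) : ℝ) : 𝕜) * pairTerm T ω (k, p) (k, q) η' f +
        (if q = p then pairTerm T ω (k, p) (k, p) η' f else 0) -
        pairTerm T ω (k, p) (k, q) η' f := by
    funext q
    unfold excess
    split_ifs with hq
    · subst hq; ring
    · ring
  rw [e1, h4, h.inner_haar_condExpGen_add hψ hd hf k p hη', rowTotal]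
  ring

theorem WeakCZ.integrable_and_integral_rowTotal (h : WeakCZ ψ C T K) (hφ : IsModulus φ)
    (hφ' : Tendsto (fun t => φ t / t) (𝓝[>] 0) atTop) (hψ : IsModulus ψ) (hd : 0 < d)
    (hf : ∀ ω, HaarSupported ω B f) (g : L2 𝕜 d) (k : ℤ) (p : Fin d → ℤ) {η' : Fin d → Fin 2}
    (hη' : η' ≠ 0) :
    Integrable (fun ω => inner 𝕜 g (haar 𝕜 ω (k, p) η') * rowTotal φ T ω (k, p) η' f) (prob d) ∧
    ∫ ω, inner 𝕜 g (haar 𝕜 ω (k, p) η') * rowTotal φ T ω (k, p) η' f ∂(prob d) =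
      ∫ ω, inner 𝕜 g (haar 𝕜 ω (k, p) η') * inner 𝕜 (haar 𝕜 ω (k, p) η')
        (T (condExpGen ω B k f + (2⁻¹ : 𝕜) • diffGen ω B k f)) ∂(prob d) := by
  obtain ⟨G₀, hG₀, hG₀'⟩ := exists_continuous_genForm T B k p η' f g
  have hex := fun q => exists_continuous_pairTerm T k p q η' f g
  choose G hG hG' using hex
  -- The majorant does not depend on ω, so the mean may be taken term by term, and every term has
  -- mean zero by independence.
  have hR := integrable_tsum_and_integral_eq_zero (R := fun q ω => excess 𝕜 φ k p q ω * G q (shiftVec ω k))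
    (b := fun q => 4 * (‖g‖ * ((2 + 2 ^ d) * ‖f‖ * rowBound ψ C p q)))
    (fun q => ((measurable_excess k p q).mul ((hG q).measurable.comp (measurable_shiftVec k))).aestronglyMeasurable)
    ((((summable_rowBound hψ hd C p).mul_left _).mul_left _).mul_left _)
    (fun q ω => by
      rw [norm_mul, ← hG', norm_mul]
      refine mul_le_mul (norm_excess_le hφ hφ' k p q ω) (mul_le_mul ?_ (h.norm_pairTerm_le hψ hd ω k p q hη' f)
        (norm_nonneg _) (norm_nonneg _)) (by positivity) (by norm_num)
      refine (norm_inner_le_norm _ _).trans (le_of_eq ?_)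
      rw [norm_haar, mul_one]) (fun q => integral_excess_mul hφ hφ' k p q (hG q))
  have e2 : ∀ ω, inner 𝕜 g (haar 𝕜 ω (k, p) η') * rowTotal φ T ω (k, p) η' f =
      G₀ (shiftVec ω k) + ∑' q, excess 𝕜 φ k p q ω * G q (shiftVec ω k) := by
    intro ω
    rw [h.rowTotal_eq_add_tsum hφ hφ' hψ hd (hf ω) k p hη', mul_add, hG₀', ← tsum_mul_left]
    congr 1
    refine tsum_congr fun q => ?_
    rw [← hG', mul_left_comm]
  simp only [e2, hG₀']
  refine ⟨(integrable_comp_shiftVec hG₀ k).add hR.1, ?_⟩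
  rw [integral_add (integrable_comp_shiftVec hG₀ k) hR.1, hR.2, add_zero]

theorem WeakCZ.integrable_genTotal (h : WeakCZ ψ C T K) (hφ : IsModulus φ)
    (hφ' : Tendsto (fun t => φ t / t) (𝓝[>] 0) atTop) (hψ : IsModulus ψ) (hd : 0 < d)
    (hf : ∀ ω, HaarSupported ω B f) (g : L2 𝕜 d) (k : ℤ) :
    Integrable (fun ω => genTotal φ T ω B f g k) (prob d) := by
  unfold genTotal
  exact integrable_finsetSum _ fun p _ => integrable_finsetSum _ fun η' hη' =>
    (h.integrable_and_integral_rowTotal hφ hφ' hψ hd hf g k p (mem_cancTypes.1 hη')).1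

theorem integrable_genForm (T : L2 𝕜 d →L[𝕜] L2 𝕜 d) (B : ℤ → Finset (Fin d → ℤ)) (f g : L2 𝕜 d)
    (k : ℤ) : Integrable (fun ω => genForm T ω B f g k) (prob d) := by
  simp only [genForm, inner_diffGen_left]
  refine integrable_finsetSum _ fun p _ => integrable_finsetSum _ fun η' _ => ?_
  obtain ⟨G₀, hG₀, hG₀'⟩ := exists_continuous_genForm T B k p η' f g
  simp only [hG₀']
  exact integrable_comp_shiftVec hG₀ k

theorem WeakCZ.integral_genTotal (h : WeakCZ ψ C T K) (hφ : IsModulus φ)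
    (hφ' : Tendsto (fun t => φ t / t) (𝓝[>] 0) atTop) (hψ : IsModulus ψ) (hd : 0 < d)
    (hf : ∀ ω, HaarSupported ω B f) (g : L2 𝕜 d) (k : ℤ) :
    ∫ ω, genTotal φ T ω B f g k ∂(prob d) = ∫ ω, genForm T ω B f g k ∂(prob d) := by
  have h1 := fun p η' (hη' : η' ∈ cancTypes d) => h.integrable_and_integral_rowTotal hφ hφ' hψ hd hf g k p
    (η' := η') (mem_cancTypes.1 hη')
  have h2 : ∀ (p : Fin d → ℤ) (η' : Fin d → Fin 2), Integrable (fun ω =>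
      inner 𝕜 g (haar 𝕜 ω (k, p) η') * inner 𝕜 (haar 𝕜 ω (k, p) η')
        (T (condExpGen ω B k f + (2⁻¹ : 𝕜) • diffGen ω B k f))) (prob d) := by
    intro p η'
    obtain ⟨G₀, hG₀, hG₀'⟩ := exists_continuous_genForm T B k p η' f g
    simp only [hG₀']
    exact integrable_comp_shiftVec hG₀ k
  simp only [genTotal, genForm, inner_diffGen_left]
  rw [integral_finsetSum _ fun p _ => integrable_finsetSum _ fun η' hη' => (h1 p η' hη').1,
    integral_finsetSum _ fun p _ => integrable_finsetSum _ fun η' hη' => h2 p η']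
  refine Finset.sum_congr rfl fun p _ => ?_
  rw [integral_finsetSum _ fun η' hη' => (h1 p η' hη').1,
    integral_finsetSum _ fun η' hη' => h2 p η']
  exact Finset.sum_congr rfl fun η' hη' => (h1 p η' hη').2

end Averaging

/-! ### Continuous functions with compact support -/

section CompactSupport

variable {𝕜 : Type*} [RCLike 𝕜] {d : ℕ} {B : ℤ → Finset (Fin d → ℤ)} {f : L2 𝕜 d} {R : ℝ}
  {f₀ : (Fin d → ℝ) → 𝕜}

/-- The positions of the cubes of generation `k` that may meet the ball of radius `R`. -/
def boxIdx (d : ℕ) (R : ℝ) (k : ℤ) : Finset (Fin d → ℤ) :=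
  Fintype.piFinset fun _ => Finset.Icc (-(⌈R * 2 ^ k⌉ + 2)) (⌈R * 2 ^ k⌉ + 2)

/-- The translation lies between 0 and one side length and the cube has one side length of extent.
This accounts for the margin 2 around R 2^k. -/
theorem mem_boxIdx {ω : Omega d} {k : ℤ} {p : Fin d → ℤ} {x : Fin d → ℝ}
    (hx : x ∈ dcube ω (k, p)) (hxR : ‖x‖ ≤ R) : p ∈ boxIdx d R k := by
  rw [boxIdx, Fintype.mem_piFinset]
  intro n
  have h1 := mem_dcube.1 hx n
  rw [corner_apply] at h1
  have h2 := abs_le.1 ((norm_le_pi_norm x n).trans hxR)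
  have h3 := shiftVec_nonneg ω k n
  have h4 := shiftVec_le ω k n
  have h5 := two_zpow_pos k
  have h6 : (2 : ℝ) ^ (-k) * 2 ^ k = 1 := by
    rw [← zpow_add₀ (by norm_num)]
    simp
  have h7 := Int.le_ceil (R * 2 ^ k)
  have h8 : side ((k, p) : DCube d) = 2 ^ (-k) := rfl
  rw [h8] at h1
  have h9 : (p n : ℝ) ≤ R * 2 ^ k := by
    have : (2 : ℝ) ^ (-k) * p n ≤ R := by linarith
    calc (p n : ℝ) = ((2 : ℝ) ^ (-k) * p n) * 2 ^ k := by linear_combination (-(p n : ℝ)) * h6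
      _ ≤ R * 2 ^ k := mul_le_mul_of_nonneg_right this h5.le
  have h10 : -(R * 2 ^ k) ≤ (p n : ℝ) + 2 := by
    have : -R ≤ (2 : ℝ) ^ (-k) * (p n + 2) := by linarith
    calc -(R * 2 ^ k) = -R * 2 ^ k := by ring
      _ ≤ (2 : ℝ) ^ (-k) * (p n + 2) * 2 ^ k := mul_le_mul_of_nonneg_right this h5.le
      _ = (p n : ℝ) + 2 := by linear_combination ((p n : ℝ) + 2) * h6
  rw [Finset.mem_Icc]
  constructor
  · have : (-(⌈R * 2 ^ k⌉ + 2 : ℤ) : ℝ) ≤ p n := by push_cast; linarith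
    exact_mod_cast this
  · have : (p n : ℝ) ≤ ((⌈R * 2 ^ k⌉ + 2 : ℤ) : ℝ) := by push_cast; linarith
    exact_mod_cast this

theorem exists_mem_dcube (ω : Omega d) (k : ℤ) (x : Fin d → ℝ) :
    ∃ p : Fin d → ℤ, x ∈ dcube ω (k, p) := by
  refine ⟨fun n => ⌊(x n - shiftVec ω k n) * 2 ^ k⌋, mem_dcube.2 fun n => ?_⟩
  rw [corner_apply, side_eq]
  have h5 := two_zpow_pos (-k)
  have h6 : (2 : ℝ) ^ (-k) * 2 ^ k = 1 := by
    rw [← zpow_add₀ (by norm_num)]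
    simp
  have h1 := Int.floor_le ((x n - shiftVec ω k n) * 2 ^ k)
  have h2 := Int.lt_floor_add_one ((x n - shiftVec ω k n) * 2 ^ k)
  have h3 : (2 : ℝ) ^ (-k) * ((x n - shiftVec ω k n) * 2 ^ k) = x n - shiftVec ω k n := by
    linear_combination (x n - shiftVec ω k n) * h6
  have h1' := mul_le_mul_of_nonneg_left h1 h5.le
  have h2' := mul_lt_mul_of_pos_left h2 h5
  rw [h3] at h1' h2'
  simp only
  constructor
  · linarith
  · linarith

theorem inner_haar_zero_eq_integral (ω : Omega d) (I : DCube d) (f : L2 𝕜 d) :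
    inner 𝕜 (haar 𝕜 ω I 0) f = (amp I : 𝕜) * ∫ x in dcube ω I, f x := by
  rw [haar_zero, inner_smul_left, RCLike.conj_ofReal, inner_ind]
  rfl

theorem haarSupported_boxIdx (hf : f =ᵐ[volume] f₀) (h0 : ∀ x, R < ‖x‖ → f₀ x = 0)
    (ω : Omega d) : HaarSupported ω (boxIdx d R) f := by
  intro k p η hp
  have h1 : ∀ I : DCube d, dcube ω I ⊆ dcube ω (k, p) → inner 𝕜 (haar 𝕜 ω I 0) f = 0 := by
    intro I hI
    rw [inner_haar_zero_eq_integral]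
    have : ∫ x in dcube ω I, f x = ∫ x in dcube ω I, (0 : 𝕜) := by
      refine setIntegral_congr_ae (measurableSet_cubeAt _ _) ?_
      filter_upwards [hf] with x hx hxI
      rw [hx]
      refine h0 x (lt_of_not_ge fun hc => hp (mem_boxIdx (hI hxI) hc))
    rw [this]
    simp
  rw [haar_eq_sum_child, sum_inner]
  refine Finset.sum_eq_zero fun ε _ => ?_
  rw [inner_smul_left, h1 _ (dcube_child_subset ω _ ε), mul_zero]

theorem condExpGen_sub (ω : Omega d) (B : ℤ → Finset (Fin d → ℤ)) (k : ℤ) (f g : L2 𝕜 d) :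
    condExpGen ω B k (f - g) = condExpGen ω B k f - condExpGen ω B k g := by
  simp only [condExpGen, inner_sub_right, sub_smul, Finset.sum_sub_distrib]

theorem condExpGen_sum_smul (ω : Omega d) (B : ℤ → Finset (Fin d → ℤ)) (k : ℤ)
    (c : (Fin d → ℤ) → 𝕜) :
    condExpGen ω B k (∑ p ∈ B k, c p • haar 𝕜 ω (k, p) 0) =
      ∑ p ∈ B k, c p • haar 𝕜 ω (k, p) 0 := by
  unfold condExpGen
  refine Finset.sum_congr rfl fun p hp => ?_
  rw [(orthonormal_haar_zero (𝕜 := 𝕜) ω k).inner_right_sum c hp]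

/-- The step function takes the value of `f₀` at the corner of each cube. Cubes have side at most 1,
so the error is supported in the ball of radius R + 1. -/
theorem exists_norm_sub_sum_haar_le (hf : f =ᵐ[volume] f₀) (h0 : ∀ x, R < ‖x‖ → f₀ x = 0)
    (ω : Omega d) {n : ℕ} {ε : ℝ} (hε : 0 ≤ ε)
    (hc : ∀ x y, ‖x - y‖ ≤ (2 : ℝ) ^ (-(n : ℤ)) → ‖f₀ x - f₀ y‖ ≤ ε) :
    ∃ c : (Fin d → ℤ) → 𝕜, ‖f - ∑ p ∈ boxIdx d R n, c p • haar 𝕜 ω (n, p) 0‖ ≤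
      ε * volume.real (Metric.closedBall (0 : Fin d → ℝ) (R + 1)) ^ (1 / (2 : ℝ)) := by
  classical
  let c : (Fin d → ℤ) → 𝕜 := fun p => f₀ (corner ω (n, p)) * ((amp ((n, p) : DCube d))⁻¹ : ℝ)
  refine ⟨c, ?_⟩
  have hU : MeasurableSet (Metric.closedBall (0 : Fin d → ℝ) (R + 1)) := measurableSet_closedBall
  have hUv : volume (Metric.closedBall (0 : Fin d → ℝ) (R + 1)) ≠ ⊤ := measure_closedBall_lt_top.ne
  have hn1 : (2 : ℝ) ^ (-(n : ℤ)) ≤ 1 := by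
    rw [zpow_neg, zpow_natCast]
    exact inv_le_one_of_one_le₀ (one_le_pow₀ (by norm_num))
  have key : ∀ x, ‖f₀ x - ∑ p ∈ boxIdx d R n, c p * (haarFun ω (n, p) 0 x : 𝕜)‖ ≤
      ‖(Metric.closedBall (0 : Fin d → ℝ) (R + 1)).indicator (fun _ => (ε : 𝕜)) x‖ := by
    intro x
    obtain ⟨q, hq⟩ := exists_mem_dcube ω n x
    have h1 : ∀ p ∈ boxIdx d R n, c p * (haarFun ω (n, p) 0 x : 𝕜) =
        if p = q then f₀ (corner ω (n, q)) else 0 := by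
      intro p _
      rw [haarFun_zero]
      split_ifs with hpq
      · subst hpq
        rw [indicator_of_mem hq, mul_one, mul_assoc, ← RCLike.ofReal_mul,
          inv_mul_cancel₀ (amp_pos _).ne', RCLike.ofReal_one, mul_one]
      · rw [indicator_of_notMem, mul_zero, RCLike.ofReal_zero, mul_zero]
        intro hc
        exact hpq (congrArg Prod.snd (eq_of_mem_dcube (I := (n, p)) (J := (n, q)) rfl hc hq))
    rw [Finset.sum_congr rfl h1, Finset.sum_ite_eq']
    have h2 : ‖x - corner ω (n, q)‖ ≤ (2 : ℝ) ^ (-(n : ℤ)) :=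
      norm_sub_corner_le (two_zpow_pos _).le hq
    by_cases hx : x ∈ Metric.closedBall (0 : Fin d → ℝ) (R + 1)
    · rw [indicator_of_mem hx, RCLike.norm_ofReal, abs_of_nonneg hε]
      split_ifs with hqB
      · exact hc _ _ h2
      · rw [h0 x (lt_of_not_ge fun h => hqB (mem_boxIdx hq h)), sub_zero, norm_zero]
        exact hε
    · rw [indicator_of_notMem hx, norm_zero]
      rw [mem_closedBall_zero_iff, not_le] at hx
      have h3 : R < ‖corner ω ((n, q) : DCube d)‖ := by
        have := norm_sub_norm_le x (corner ω (n, q))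
        linarith
      rw [h0 x (by linarith), h0 _ h3]
      simp
  have h4 := coeFn_finset_sum_smul_toLp (boxIdx d R n) c
    (fun p x => (haarFun ω ((n : ℤ), p) 0 x : 𝕜)) fun p => memLp_haarFun 𝕜 ω (n, p) 0
  have h5 : ‖f - ∑ p ∈ boxIdx d R n, c p • haar 𝕜 ω (n, p) 0‖ ≤
      ‖indicatorConstLp 2 hU hUv (ε : 𝕜)‖ := by
    refine Lp.norm_le_norm_of_ae_le ?_
    filter_upwards [hf, h4, Lp.coeFn_sub f (∑ p ∈ boxIdx d R n, c p • haar 𝕜 ω (n, p) 0),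
      indicatorConstLp_coeFn (p := 2) (hs := hU) (hμs := hUv) (c := (ε : 𝕜))] with x x1 x2 x3 x4
    rw [x3, x4, Pi.sub_apply, x1]
    refine le_trans (le_of_eq ?_) (key x)
    congr 2
  refine h5.trans (norm_indicatorConstLp_le.trans (le_of_eq ?_))
  rw [RCLike.norm_ofReal, abs_of_nonneg hε]
  norm_num

/-- Step functions of generation n are fixed by the projection, which is a contraction. Hence the
error is at most twice the distance to step functions, and this tends to 0 by uniform continuity. -/
theorem tendsto_condExpGen (hf : f =ᵐ[volume] f₀) (h0 : ∀ x, R < ‖x‖ → f₀ x = 0)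
    (hc : UniformContinuous f₀) (ω : Omega d) :
    Tendsto (fun n : ℕ => condExpGen ω (boxIdx d R) n f) atTop (𝓝 f) := by
  rw [Metric.tendsto_atTop]
  intro δ hδ
  generalize hV : volume.real (Metric.closedBall (0 : Fin d → ℝ) (R + 1)) ^ (1 / (2 : ℝ)) = V
  have hV0 : 0 ≤ V := by rw [← hV]; positivity
  have hε : 0 < δ / (2 * (V + 1)) := by positivity
  obtain ⟨r, hr, hr'⟩ := Metric.uniformContinuous_iff.1 hc _ hε
  obtain ⟨N, hN⟩ := exists_pow_lt_of_lt_one hr (by norm_num : (2 : ℝ)⁻¹ < 1)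
  refine ⟨N, fun n hn => ?_⟩
  have h2 : (2 : ℝ) ^ (-(n : ℤ)) < r := by
    rw [zpow_neg, zpow_natCast, ← inv_pow]
    exact (pow_le_pow_of_le_one (by norm_num) (by norm_num) hn).trans_lt hN
  obtain ⟨c, hc'⟩ := exists_norm_sub_sum_haar_le hf h0 ω (n := n) hε.le fun x y hxy => by
    have := hr' (a := x) (b := y) (by rw [dist_eq_norm]; linarith)
    rw [dist_eq_norm] at this
    exact this.le
  rw [hV] at hc'
  generalize hv : (∑ p ∈ boxIdx d R n, c p • haar 𝕜 ω (n, p) 0 : L2 𝕜 d) = v at hc'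
  have h3 : condExpGen ω (boxIdx d R) n v = v := by
    rw [← hv]
    exact condExpGen_sum_smul ω (boxIdx d R) n c
  have h4 : condExpGen ω (boxIdx d R) n f - f =
      condExpGen ω (boxIdx d R) n (f - v) - (f - v) := by
    rw [condExpGen_sub, h3]
    abel
  rw [dist_eq_norm, h4]
  have h5 := norm_sub_le (condExpGen ω (boxIdx d R) n (f - v)) (f - v)
  have h6 := norm_condExpGen_le ω (boxIdx d R) n (f - v)
  have h7 : δ / (2 * (V + 1)) * V < δ / 2 := by
    rw [div_mul_eq_mul_div, div_lt_div_iff₀ (by positivity) (by norm_num)]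
    nlinarith
  linarith

theorem card_boxIdx_neg_le (hR : 0 ≤ R) (n : ℕ) :
    ((boxIdx d R (-n)).card : ℝ) ≤ (2 * R + 7) ^ d := by
  have h1 : (boxIdx d R (-n)).card =
      (⌈R * 2 ^ (-(n : ℤ))⌉ + 2 + 1 - -(⌈R * 2 ^ (-(n : ℤ))⌉ + 2)).toNat ^ d := by
    simp [boxIdx, Fintype.card_piFinset]
  have h3 : R * 2 ^ (-(n : ℤ)) ≤ R := by
    refine mul_le_of_le_one_right hR ?_
    rw [zpow_neg, zpow_natCast]
    exact inv_le_one_of_one_le₀ (one_le_pow₀ (by norm_num))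
  have h4 : 0 ≤ R * 2 ^ (-(n : ℤ)) := mul_nonneg hR (two_zpow_pos _).le
  have h5 := Int.ceil_lt_add_one (R * 2 ^ (-(n : ℤ)))
  have h6 := Int.ceil_nonneg h4
  rw [h1]
  push_cast
  refine pow_le_pow_left₀ (Nat.cast_nonneg _) ?_ d
  generalize ⌈R * 2 ^ (-(n : ℤ))⌉ = m at h5 h6 ⊢
  have h7 : (((m + 2 + 1 - -(m + 2)).toNat : ℤ) : ℝ) = ((m + 2 + 1 - -(m + 2) : ℤ) : ℝ) := by
    rw [Int.toNat_of_nonneg (by omega)]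
  rw [Int.cast_natCast] at h7
  rw [h7]
  push_cast
  linarith

/-- At coarse generations a bounded number of cubes meets the support, and each contributes at most
2^{-dn} times the square of the L¹ norm. -/
theorem tendsto_condExpGen_neg (hd : 0 < d) (hf : f =ᵐ[volume] f₀) (hi : Integrable f₀) (hR : 0 ≤ R)
    (ω : Omega d) :
    Tendsto (fun n : ℕ => condExpGen ω (boxIdx d R) (-n) f) atTop (𝓝 0) := by
  have h1 : ∀ n : ℕ, ‖condExpGen ω (boxIdx d R) (-n) f‖ ^ 2 ≤
      (2 * R + 7) ^ d * (((2 : ℝ) ^ d)⁻¹ ^ n * (∫ x, ‖f₀ x‖) ^ 2) := by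
    intro n
    have h2 : ∀ p ∈ boxIdx d R (-n), ‖(inner 𝕜 (haar 𝕜 ω (-n, p) 0) f : 𝕜)‖ ^ 2 ≤
        ((2 : ℝ) ^ d)⁻¹ ^ n * (∫ x, ‖f₀ x‖) ^ 2 := by
      intro p _
      rw [inner_haar_zero_eq_integral, norm_mul, mul_pow, RCLike.norm_ofReal, sq_abs]
      have h3 : amp ((-n, p) : DCube d) ^ 2 = ((2 : ℝ) ^ d)⁻¹ ^ n := by
        have h4 := amp_sq_mul ((-n, p) : DCube d)
        have h5 : side ((-n, p) : DCube d) = 2 ^ n := by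
          rw [side_eq]
          simp
        rw [h5] at h4
        rw [inv_pow, ← pow_mul, mul_comm d n, pow_mul]
        exact eq_inv_of_mul_eq_one_left h4
      rw [h3]
      refine mul_le_mul_of_nonneg_left (pow_le_pow_left₀ (norm_nonneg _) ?_ 2) (by positivity)
      have h6 : ∫ x in dcube ω (-n, p), f x = ∫ x in dcube ω (-n, p), f₀ x :=
        setIntegral_congr_ae (measurableSet_cubeAt _ _) (hf.mono fun x hx _ => hx)
      rw [h6]
      exact (norm_integral_le_integral_norm _).trans
        (setIntegral_le_integral hi.norm (Eventually.of_forall fun x => norm_nonneg _))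
    rw [norm_condExpGen_sq]
    refine (Finset.sum_le_card_nsmul _ _ _ h2).trans ?_
    rw [nsmul_eq_mul]
    exact mul_le_mul_of_nonneg_right (card_boxIdx_neg_le hR n) (by positivity)
  have h2 : Tendsto (fun n : ℕ => (2 * R + 7) ^ d *
      (((2 : ℝ) ^ d)⁻¹ ^ n * (∫ x, ‖f₀ x‖) ^ 2)) atTop (𝓝 0) := by
    have h3 : Tendsto (fun n : ℕ => ((2 : ℝ) ^ d)⁻¹ ^ n) atTop (𝓝 0) :=
      tendsto_pow_atTop_nhds_zero_of_lt_one (by positivity)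
        (inv_lt_one_of_one_lt₀ (one_lt_pow₀ (by norm_num) hd.ne'))
    simpa using (h3.mul_const ((∫ x, ‖f₀ x‖) ^ 2)).const_mul ((2 * R + 7) ^ d)
  have h3 := squeeze_zero (fun n => by positivity) h1 h2
  have h4 := (Real.continuous_sqrt.tendsto 0).comp h3
  rw [Real.sqrt_zero] at h4
  refine tendsto_zero_iff_norm_tendsto_zero.2 (h4.congr fun n => ?_)
  exact Real.sqrt_sq (norm_nonneg _)

theorem IsC1c.exists_tendsto (hd : 0 < d) (hf : IsC1c f) :
    ∃ R₀ : ℝ, ∀ R, R₀ ≤ R → ∀ ω, HaarSupported ω (boxIdx d R) f ∧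
      Tendsto (fun n : ℕ => condExpGen ω (boxIdx d R) n f) atTop (𝓝 f) ∧
      Tendsto (fun n : ℕ => condExpGen ω (boxIdx d R) (-n) f) atTop (𝓝 0) := by
  obtain ⟨f₀, hf1, hf2, hf3⟩ := hf
  obtain ⟨r, hr⟩ := hf2.isCompact.isBounded.subset_closedBall (0 : Fin d → ℝ)
  refine ⟨max r 0, fun R hR ω => ?_⟩
  have h0 : ∀ x, R < ‖x‖ → f₀ x = 0 := by
    intro x hx
    by_contra hc
    have h1 := mem_closedBall_zero_iff.1 (hr (subset_tsupport f₀ hc))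
    have h2 := (le_max_left r 0).trans hR
    linarith
  exact ⟨haarSupported_boxIdx hf3 h0 ω,
    tendsto_condExpGen hf3 h0 (hf2.uniformContinuous_of_continuous hf1.continuous) ω,
    tendsto_condExpGen_neg hd hf3 (hf1.continuous.integrable_of_hasCompactSupport hf2)
      ((le_max_right r 0).trans hR) ω⟩

end CompactSupport

/-! ### The representation -/

section Representation

variable {𝕜 : Type*} [RCLike 𝕜] {d : ℕ} {φ ψ : ℝ → ℝ} {C : ℝ} {T : L2 𝕜 d →L[𝕜] L2 𝕜 d}
  {K : (Fin d → ℝ) → (Fin d → ℝ) → 𝕜}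

/-- Taking adjoints exchanges i and j, keeps the size and cancellation of the raw coefficients, and
turns the paraproduct into its dual. The symmetry of τ preserves the bound. -/
theorem WeakCZ.shiftBd_adjCoeff_halfCoeff (h : WeakCZ ψ C T K) (hφ : IsModulus φ)
    (hφ' : Tendsto (fun t => φ t / t) (𝓝[>] 0) atTop) (hψ : IsModulus ψ) (hd : 0 < d)
    (hC : 0 < C) (ω : Omega d) (i j : ℕ) :
    ShiftBd ω i j (adjCoeff (halfCoeff φ T ω j i)) (halfConst d * C * tau d φ ψ i j) := by
  have hτ := tau_pos (d := d) hφ hψ i j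
  have h1 : ShiftBd ω i j (adjCoeff (rawCoeff φ T ω j i)) (rawConst d * C * tau d φ ψ i j) := by
    refine shiftBd_of_isCancellative ω (by have := rawConst_pos d; positivity)
      (isCancellative_adjCoeff (isCancellative_rawCoeff φ T ω j i)) ?_
    rw [tau_comm]
    exact adjCoeff_bound (h.rawCoeff_bound hφ hφ' hψ hd ω j i)
  unfold halfCoeff
  split_ifs with hij
  · obtain ⟨rfl, rfl⟩ := hij
    have e1 : bigPsi ψ 1 = tau d φ ψ 0 0 := by rw [tau_zero_left, relScale_zero hφ]
    have h2 := h.isCarleson hψ hd ω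
    rw [e1] at h2
    have h3 := shiftBd_dualParaCoeff ω h2 (by have := carlesonConst_pos d; positivity)
    have e2 : adjCoeff (rawCoeff φ T ω 0 0 + paraCoeff (paraB T ω)) =
        adjCoeff (rawCoeff φ T ω 0 0) + dualParaCoeff (paraB T ω) := by
      funext I J P η η'
      simp [adjCoeff, paraCoeff, dualParaCoeff, apply_ite (starRingEnd 𝕜)]
    rw [e2]
    refine (h1.add h3).mono (le_of_eq ?_)
    unfold halfConst
    ring
  · refine h1.mono ?_
    unfold halfConst
    have := carlesonConst_pos d
    gcongr
    exact le_add_of_nonneg_right (by positivity)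

theorem integrable_conj {F : Omega d → 𝕜} (hF : Integrable F (prob d)) :
    Integrable (fun ω => starRingEnd 𝕜 (F ω)) (prob d) :=
  (RCLike.conjCLE (K := 𝕜)).toContinuousLinearMap.integrable_comp hF

/-- The coefficients of the shifts that represent `T`, up to normalization. -/
def totalCoeff (φ : ℝ → ℝ) (T : L2 𝕜 d →L[𝕜] L2 𝕜 d) (ω : Omega d) (i j : ℕ) : ShiftCoeff 𝕜 d :=
  halfCoeff φ T ω i j + adjCoeff (halfCoeff φ (ContinuousLinearMap.adjoint T) ω j i)

theorem isCancellative_totalCoeff (φ : ℝ → ℝ) (T : L2 𝕜 d →L[𝕜] L2 𝕜 d) (ω : Omega d) {i j : ℕ}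
    (hij : (i, j) ≠ (0, 0)) : (totalCoeff φ T ω i j).IsCancellative := by
  intro I J P η η' hη
  have hji : (j, i) ≠ (0, 0) := by
    rw [ne_eq, Prod.mk.injEq] at hij ⊢
    exact fun hc => hij hc.symm
  simp only [totalCoeff, Pi.add_apply, isCancellative_halfCoeff φ T ω hij I J P η η' hη,
    isCancellative_adjCoeff (isCancellative_halfCoeff φ (ContinuousLinearMap.adjoint T) ω hji)
      I J P η η' hη, add_zero]

theorem WeakCZ.shiftBd_totalCoeff (h : WeakCZ ψ C T K) (hφ : IsModulus φ)
    (hφ' : Tendsto (fun t => φ t / t) (𝓝[>] 0) atTop) (hψ : IsModulus ψ) (hd : 0 < d)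
    (hC : 0 < C) (ω : Omega d) (i j : ℕ) :
    ShiftBd ω i j (totalCoeff φ T ω i j) (2 * halfConst d * C * tau d φ ψ i j) :=
  ((h.shiftBd_halfCoeff hφ hφ' hψ hd hC ω i j).add
    (h.adjoint.shiftBd_adjCoeff_halfCoeff hφ hφ' hψ hd hC ω i j)).mono (le_of_eq (by ring))

theorem ShiftBd.summable_inner {ω : Omega d} {i j : ℕ} {a : ShiftCoeff 𝕜 d} {M : ℝ}
    (h : ShiftBd ω i j a M) (f g : L2 𝕜 d) :
    Summable fun P => (inner 𝕜 g (averagingOp ω i j a P f) : 𝕜) := by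
  obtain ⟨S, -, hS⟩ := h.subshift univ
  have h1 : HasSum (fun P => averagingOp ω i j a P f) (S f) :=
    (Equiv.Set.univ (DCube d)).hasSum_iff.1 (hS f)
  have h2 := (innerSL 𝕜 g).hasSum h1
  exact h2.summable

theorem WeakCZ.hasSum_inner_totalCoeff (h : WeakCZ ψ C T K) (hφ : IsModulus φ)
    (hφ' : Tendsto (fun t => φ t / t) (𝓝[>] 0) atTop) (hψ : IsModulus ψ) (hd : 0 < d)
    (hC : 0 < C) (ω : Omega d) (i j : ℕ) (f g : L2 𝕜 d) :
    HasSum (fun P => (inner 𝕜 g (averagingOp ω i j (totalCoeff φ T ω i j) P f) : 𝕜))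
      (halfForm φ T ω i j f g +
        starRingEnd 𝕜 (halfForm φ (ContinuousLinearMap.adjoint T) ω j i g f)) := by
  have h1 := ((h.shiftBd_halfCoeff hφ hφ' hψ hd hC ω i j).summable_inner f g).hasSum
  have h2 := (RCLike.hasSum_conj' 𝕜).2
    ((h.adjoint.shiftBd_halfCoeff hφ hφ' hψ hd hC ω j i).summable_inner g f).hasSum
  refine (h1.add h2).congr_fun fun P => ?_
  rw [totalCoeff, averagingOp_add_coeff, inner_add_right, inner_averagingOp_adjCoeff]

variable {B : ℤ → Finset (Fin d → ℤ)} {f g : L2 𝕜 d}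

/-- The sum of the forms over (i,j) is the bounded pointwise limit of finite sums over generations.
This yields its measurability in ω, and the limit passes through the expectation, which replaces
`genTotal` by `genForm`. -/
theorem WeakCZ.integral_halfForm (h : WeakCZ ψ C T K) (hφ : IsModulus φ)
    (hφ' : Tendsto (fun t => φ t / t) (𝓝[>] 0) atTop) (hψ : IsModulus ψ) (hd : 0 < d)
    (hC : 0 < C) (hτ : Summable fun x : ℕ × ℕ => tau d φ ψ x.1 x.2)
    (hf : ∀ ω, HaarSupported ω B f) (hg : ∀ ω, HaarSupported ω B g) :
    Integrable (fun ω => ∑' x : ℕ × ℕ, halfForm φ T ω x.1 x.2 f g) (prob d) ∧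
      Tendsto (fun n : ℕ => ∫ ω, ∑ k ∈ Finset.Ico (-n : ℤ) n, genForm T ω B f g k ∂(prob d)) atTop
        (𝓝 (∫ ω, ∑' x : ℕ × ℕ, halfForm φ T ω x.1 x.2 f g ∂(prob d))) := by
  have hB : ∀ ω k p η, p ∉ B k → inner 𝕜 g (haar 𝕜 ω (k, p) η) = 0 := fun ω k p η hp =>
    inner_eq_zero_symm.1 (hg ω k p η hp)
  have hlim : ∀ ω, Tendsto (fun n : ℕ => ∑ k ∈ Finset.Ico (-n : ℤ) n, genTotal φ T ω B f g k) atTop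
      (𝓝 (∑' x : ℕ × ℕ, halfForm φ T ω x.1 x.2 f g)) := fun ω =>
    (h.hasSum_genTotal hφ hφ' hψ hd hC hτ (hB ω)).comp Finset.tendsto_Ico_neg
  have hint : ∀ n : ℕ, Integrable
      (fun ω => ∑ k ∈ Finset.Ico (-n : ℤ) n, genTotal φ T ω B f g k) (prob d) := fun n =>
    integrable_finsetSum _ fun k _ => h.integrable_genTotal hφ hφ' hψ hd hf g k
  have hbd : ∀ (n : ℕ) ω, ‖∑ k ∈ Finset.Ico (-n : ℤ) n, genTotal φ T ω B f g k‖ ≤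
      halfConst d * C * ‖f‖ * ‖g‖ * ∑' x : ℕ × ℕ, tau d φ ψ x.1 x.2 := fun n ω =>
    h.norm_sum_genTotal_le hφ hφ' hψ hd hC hτ (hB ω) _
  constructor
  · refine Integrable.of_bound (aestronglyMeasurable_of_tendsto_ae atTop
      (fun n => (hint n).aestronglyMeasurable) (Eventually.of_forall hlim))
      (halfConst d * C * ‖f‖ * ‖g‖ * ∑' x : ℕ × ℕ, tau d φ ψ x.1 x.2)
      (Eventually.of_forall fun ω => ?_)
    exact le_of_tendsto (hlim ω).norm (Eventually.of_forall fun n => hbd n ω)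
  · refine (tendsto_integral_of_dominated_convergence _
      (fun n => (hint n).aestronglyMeasurable) (integrable_const _)
      (fun n => Eventually.of_forall (hbd n)) (Eventually.of_forall hlim)).congr fun n => ?_
    rw [integral_finsetSum _ fun k _ => h.integrable_genTotal hφ hφ' hψ hd hf g k,
      integral_finsetSum _ fun k _ => integrable_genForm T B f g k]
    exact Finset.sum_congr rfl fun k _ => h.integral_genTotal hφ hφ' hψ hd hf g k

/-- For each ω the telescoped sum is a difference of two projected forms, both bounded by ‖T‖‖f‖‖g‖.
Dominated convergence leaves only the limit at fine generations. -/
theorem tendsto_integral_sum_genForm (T : L2 𝕜 d →L[𝕜] L2 𝕜 d)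
    (hf : ∀ ω, HaarSupported ω B f) (hg : ∀ ω, HaarSupported ω B g)
    (hf1 : ∀ ω, Tendsto (fun n : ℕ => condExpGen ω B n f) atTop (𝓝 f))
    (hg1 : ∀ ω, Tendsto (fun n : ℕ => condExpGen ω B n g) atTop (𝓝 g))
    (hf2 : ∀ ω, Tendsto (fun n : ℕ => condExpGen ω B (-n) f) atTop (𝓝 0))
    (hg2 : ∀ ω, Tendsto (fun n : ℕ => condExpGen ω B (-n) g) atTop (𝓝 0)) :
    Tendsto (fun n : ℕ => ∫ ω, ∑ k ∈ Finset.Ico (-n : ℤ) n, (genForm T ω B f g k +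
        starRingEnd 𝕜 (genForm (ContinuousLinearMap.adjoint T) ω B g f k)) ∂(prob d)) atTop
      (𝓝 (inner 𝕜 g (T f))) := by
  have hlim : ∀ ω, Tendsto (fun n : ℕ => ∑ k ∈ Finset.Ico (-n : ℤ) n, (genForm T ω B f g k +
      starRingEnd 𝕜 (genForm (ContinuousLinearMap.adjoint T) ω B g f k))) atTop
      (𝓝 (inner 𝕜 g (T f))) := by
    intro ω
    simp only [sum_Ico_genForm (hf ω) (hg ω)]
    have h1 := (hg1 ω).inner (𝕜 := 𝕜) ((T.continuous.tendsto f).comp (hf1 ω))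
    have h2 := (hg2 ω).inner (𝕜 := 𝕜) ((T.continuous.tendsto 0).comp (hf2 ω))
    have h3 := h1.sub h2
    rwa [inner_zero_left, sub_zero] at h3
  have hterm : ∀ ω k, ‖(inner 𝕜 (condExpGen ω B k g) (T (condExpGen ω B k f)) : 𝕜)‖ ≤
      ‖g‖ * (‖T‖ * ‖f‖) := fun ω k => by
    refine (norm_inner_le_norm _ _).trans (mul_le_mul (norm_condExpGen_le ω B k g) ?_
      (norm_nonneg _) (norm_nonneg _))
    exact (T.le_opNorm _).trans
      (mul_le_mul_of_nonneg_left (norm_condExpGen_le ω B k f) (norm_nonneg _))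
  have h4 := tendsto_integral_of_dominated_convergence (μ := prob d)
    (fun _ => ‖g‖ * (‖T‖ * ‖f‖) + ‖g‖ * (‖T‖ * ‖f‖))
    (fun n : ℕ => (integrable_finsetSum (Finset.Ico (-n : ℤ) n) fun k _ =>
      (integrable_genForm T B f g k).add
        (integrable_conj (integrable_genForm (ContinuousLinearMap.adjoint T) B g f k))).aestronglyMeasurable)
    (integrable_const _) (fun n => Eventually.of_forall fun ω => ?_) (Eventually.of_forall hlim)
  · simpa using h4
  · have h5 := sum_Ico_genForm (T := T) (hf ω) (hg ω) n
    refine le_trans (le_of_eq (congrArg norm h5)) ?_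
    exact (norm_sub_le _ _).trans (add_le_add (hterm ω _) (hterm ω _))

theorem WeakCZ.integral_representation (h : WeakCZ ψ C T K) (hφ : IsModulus φ)
    (hφ' : Tendsto (fun t => φ t / t) (𝓝[>] 0) atTop) (hψ : IsModulus ψ) (hd : 0 < d)
    (hC : 0 < C) (hτ : Summable fun x : ℕ × ℕ => tau d φ ψ x.1 x.2)
    (hf : IsC1c f) (hg : IsC1c g) :
    (∀ ω, Summable fun x : ℕ × ℕ => halfForm φ T ω x.1 x.2 f g +
      starRingEnd 𝕜 (halfForm φ (ContinuousLinearMap.adjoint T) ω x.2 x.1 g f)) ∧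
    Integrable (fun ω => ∑' x : ℕ × ℕ, (halfForm φ T ω x.1 x.2 f g +
      starRingEnd 𝕜 (halfForm φ (ContinuousLinearMap.adjoint T) ω x.2 x.1 g f))) (prob d) ∧
    inner 𝕜 g (T f) = ∫ ω, ∑' x : ℕ × ℕ, (halfForm φ T ω x.1 x.2 f g +
      starRingEnd 𝕜 (halfForm φ (ContinuousLinearMap.adjoint T) ω x.2 x.1 g f)) ∂(prob d) := by
  obtain ⟨R₁, hR₁⟩ := hf.exists_tendsto hd
  obtain ⟨R₂, hR₂⟩ := hg.exists_tendsto hd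
  -- One family of boxes containing the supports of both functions, since the identities for
  -- `genForm` use the same projections on both sides.
  set B := boxIdx d (max R₁ R₂)
  replace hR₁ := hR₁ _ (le_max_left R₁ R₂)
  replace hR₂ := hR₂ _ (le_max_right R₁ R₂)
  have hf0 := fun ω => (hR₁ ω).1
  have hg0 := fun ω => (hR₂ ω).1
  obtain ⟨i1, l1⟩ := h.integral_halfForm hφ hφ' hψ hd hC hτ hf0 hg0
  obtain ⟨i2, l2⟩ := h.adjoint.integral_halfForm hφ hφ' hψ hd hC hτ hg0 hf0
  have s1 : ∀ ω, Summable fun x : ℕ × ℕ => halfForm φ T ω x.1 x.2 f g := fun ω =>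
    h.summable_halfForm hφ hφ' hψ hd hC hτ fun k p η hp =>
      inner_eq_zero_symm.1 (hg0 ω k p η hp)
  have s2 : ∀ ω, HasSum (fun x : ℕ × ℕ =>
      starRingEnd 𝕜 (halfForm φ (ContinuousLinearMap.adjoint T) ω x.2 x.1 g f))
      (starRingEnd 𝕜 (∑' x : ℕ × ℕ,
        halfForm φ (ContinuousLinearMap.adjoint T) ω x.1 x.2 g f)) := fun ω =>
    (RCLike.hasSum_conj' 𝕜).2 ((Equiv.prodComm ℕ ℕ).hasSum_iff.2
      (h.adjoint.summable_halfForm hφ hφ' hψ hd hC hτ fun k p η hp =>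
        inner_eq_zero_symm.1 (hf0 ω k p η hp)).hasSum)
  have e : ∀ ω, ∑' x : ℕ × ℕ, (halfForm φ T ω x.1 x.2 f g +
      starRingEnd 𝕜 (halfForm φ (ContinuousLinearMap.adjoint T) ω x.2 x.1 g f)) =
      (∑' x : ℕ × ℕ, halfForm φ T ω x.1 x.2 f g) + starRingEnd 𝕜 (∑' x : ℕ × ℕ,
        halfForm φ (ContinuousLinearMap.adjoint T) ω x.1 x.2 g f) := fun ω =>
    ((s1 ω).hasSum.add (s2 ω)).tsum_eq
  have i3 : Integrable (fun ω => starRingEnd 𝕜 (∑' x : ℕ × ℕ,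
      halfForm φ (ContinuousLinearMap.adjoint T) ω x.1 x.2 g f)) (prob d) := integrable_conj i2
  simp only [e]
  refine ⟨fun ω => (s1 ω).add (s2 ω).summable, i1.add i3, ?_⟩
  rw [integral_add i1 i3, integral_conj]
  refine tendsto_nhds_unique (tendsto_integral_sum_genForm T hf0 hg0 (fun ω => (hR₁ ω).2.1)
    (fun ω => (hR₂ ω).2.1) (fun ω => (hR₁ ω).2.2) fun ω => (hR₂ ω).2.2) ?_
  refine (l1.add ((RCLike.continuous_conj.tendsto _).comp l2)).congr fun n => ?_
  have j1 := integrable_finsetSum (Finset.Ico (-n : ℤ) n) fun k _ => integrable_genForm T B f g k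
  have j2 := integrable_finsetSum (Finset.Ico (-n : ℤ) n) fun k _ =>
    integrable_genForm (ContinuousLinearMap.adjoint T) B g f k
  have j3 : Integrable (fun ω => starRingEnd 𝕜 (∑ k ∈ Finset.Ico (-n : ℤ) n,
    genForm (ContinuousLinearMap.adjoint T) ω B g f k)) (prob d) := integrable_conj j2
  simp only [Finset.sum_add_distrib, Function.comp_apply, ← map_sum]
  rw [integral_add j1 j3, integral_conj]

end Representation

/-! ### Normalization of the shifts to norm one. -/

section Normalization

variable {𝕜 : Type*} [RCLike 𝕜] {d : ℕ} {φ ψ : ℝ → ℝ} {C : ℝ} {T : L2 𝕜 d →L[𝕜] L2 𝕜 d}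
  {K : (Fin d → ℝ) → (Fin d → ℝ) → 𝕜}

theorem isDyadicShift_zero (ω : Omega d) (i j : ℕ) :
    IsDyadicShift ω i j (0 : ShiftCoeff 𝕜 d) (0 : L2 𝕜 d →L[𝕜] L2 𝕜 d) := by
  have h0 : ∀ (P : DCube d) (f : L2 𝕜 d), averagingOp ω i j (0 : ShiftCoeff 𝕜 d) P f = 0 :=
    fun P f => by simp [averagingOp_eq]
  refine ⟨fun P I _ J _ => ?_, fun Q => ⟨0, by simp, fun f => ?_⟩, fun f => ?_⟩
  · simp only [Pi.zero_apply, norm_zero, Finset.sum_const_zero]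
    exact div_nonneg (Real.sqrt_nonneg _) (pow_nonneg (side_pos P).le d)
  · simp only [h0]
    exact hasSum_zero
  · simp only [h0]
    exact hasSum_zero

/-- Dividing by the full bound makes a normalized shift. The factor τ(i,j) of the representation
cancels its part of the divisor, leaving a constant independent of i, j and ω. -/
theorem WeakCZ.exists_isDyadicShift (h : WeakCZ ψ C T K) (hφ : IsModulus φ)
    (hφ' : Tendsto (fun t => φ t / t) (𝓝[>] 0) atTop) (hψ : IsModulus ψ) (hd : 0 < d)
    (hC : 0 < C) (ω : Omega d) (i j : ℕ) :
    ∃ S : L2 𝕜 d →L[𝕜] L2 𝕜 d,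
      IsDyadicShift ω i j
        ((((2 * halfConst d * C * tau d φ ψ i j)⁻¹ : ℝ) : 𝕜) • totalCoeff φ T ω i j) S ∧
      ∀ f g : L2 𝕜 d, (tau d φ ψ i j : 𝕜) * inner 𝕜 g (S f) =
        (((2 * halfConst d * C)⁻¹ : ℝ) : 𝕜) * (halfForm φ T ω i j f g +
          starRingEnd 𝕜 (halfForm φ (ContinuousLinearMap.adjoint T) ω j i g f)) := by
  have hτ := tau_pos (d := d) hφ hψ i j
  have hH := halfConst_pos d
  have hpos : 0 < 2 * halfConst d * C * tau d φ ψ i j := by positivity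
  have h1 := (h.shiftBd_totalCoeff hφ hφ' hψ hd hC ω i j).smul
    (((2 * halfConst d * C * tau d φ ψ i j)⁻¹ : ℝ) : 𝕜)
  rw [RCLike.norm_ofReal, abs_of_pos (inv_pos.2 hpos), inv_mul_cancel₀ hpos.ne'] at h1
  obtain ⟨S, hS⟩ := h1.isDyadicShift
  refine ⟨S, hS, fun f g => ?_⟩
  have h2 := (innerSL 𝕜 g).hasSum (hS.sum f)
  have h3 := (h.hasSum_inner_totalCoeff hφ hφ' hψ hd hC ω i j f g).mul_left
    (((2 * halfConst d * C * tau d φ ψ i j)⁻¹ : ℝ) : 𝕜)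
  have e1 : (fun P => (((2 * halfConst d * C * tau d φ ψ i j)⁻¹ : ℝ) : 𝕜) *
      inner 𝕜 g (averagingOp ω i j (totalCoeff φ T ω i j) P f)) = fun P => innerSL 𝕜 g
      (averagingOp ω i j ((((2 * halfConst d * C * tau d φ ψ i j)⁻¹ : ℝ) : 𝕜) •
        totalCoeff φ T ω i j) P f) := by
    funext P
    rw [averagingOp_smul_coeff, innerSL_apply_apply, inner_smul_right]
  rw [e1] at h3
  have h4 := h2.unique h3
  rw [innerSL_apply_apply] at h4
  rw [h4, ← mul_assoc, ← RCLike.ofReal_mul]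
  congr 2
  field_simp

end Normalization

end DyadicRep

end

/-! ### The representation theorem. -/

open DyadicRep in
theorem mainTheorem3 {𝕜 : Type*} [RCLike 𝕜] (d : ℕ) (hd : 0 < d)
    (φ : ℝ → ℝ) (hφ : IsModulus φ) (hφ' : Tendsto (fun t => φ t / t) (𝓝[>] 0) atTop) :
    ∃ c : ℝ, 0 < c ∧
      ∀ (ψ : ℝ → ℝ), IsModulus ψ → Summable (fun p : ℕ × ℕ => tau d φ ψ p.1 p.2) →
      ∀ (T : L2 𝕜 d →L[𝕜] L2 𝕜 d) (K : (Fin d → ℝ) → (Fin d → ℝ) → 𝕜),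
        IsBoundedCZOperator ψ T K →
      ∃ (a : Omega d → ℕ → ℕ → ShiftCoeff 𝕜 d) (S : Omega d → ℕ → ℕ → L2 𝕜 d →L[𝕜] L2 𝕜 d),
        (∀ ω i j, IsDyadicShift ω i j (a ω i j) (S ω i j)) ∧
        (∀ ω i j, (i, j) ≠ (0, 0) → (a ω i j).IsCancellative) ∧
        ∀ f g : L2 𝕜 d, IsC1c f → IsC1c g →
          (∀ ω, Summable fun p : ℕ × ℕ =>
            (tau d φ ψ p.1 p.2 : 𝕜) * inner 𝕜 g (S ω p.1 p.2 f)) ∧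
          Integrable (fun ω => ∑' p : ℕ × ℕ,
            (tau d φ ψ p.1 p.2 : 𝕜) * inner 𝕜 g (S ω p.1 p.2 f)) (prob d) ∧
          inner 𝕜 g (T f) = ((c * (‖T‖ + czNorm K ψ) : ℝ) : 𝕜) *
            ∫ ω, ∑' p : ℕ × ℕ,
              (tau d φ ψ p.1 p.2 : 𝕜) * inner 𝕜 g (S ω p.1 p.2 f) ∂(prob d) := by
  -- The factor 2 accounts for the two halves, from T and from its adjoint. The constant obtained
  -- involves the dimension only.
  refine ⟨2 * halfConst d, mul_pos two_pos (halfConst_pos d), fun ψ hψ hτ T K hT => ?_⟩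
  have h := hT.weakCZ hψ
  generalize hCdef : ‖T‖ + czNorm K ψ = C at h ⊢
  -- If ‖T‖ + ‖K‖ = 0 the normalization would divide by zero, but then T = 0 and zero shifts serve.
  rcases h.reg.1.eq_or_lt with hC | hC
  · refine ⟨fun _ _ _ => 0, fun _ _ _ => 0, fun ω i j => isDyadicShift_zero ω i j,
      fun _ _ _ _ _ _ _ _ _ _ => rfl, fun f g _ _ => ?_⟩
    have hT0 : T = 0 := norm_le_zero_iff.1 (hC ▸ h.norm_le)
    simp [hT0, summable_zero]
  -- The shifts are chosen separately for each ω. Integrability is not affected, because `hSform`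
  -- expresses their bilinear forms through the explicit `halfForm`.
  · choose S hS hSform using fun ω i j => h.exists_isDyadicShift hφ hφ' hψ hd hC ω i j
    refine ⟨_, S, hS, fun ω i j hij I J P η η' hη => ?_, fun f g hf hg => ?_⟩
    · rw [Pi.smul_apply, Pi.smul_apply, Pi.smul_apply, Pi.smul_apply, Pi.smul_apply,
        isCancellative_totalCoeff φ T ω hij I J P η η' hη, smul_zero]
    · obtain ⟨h1, h2, h3⟩ := h.integral_representation hφ hφ' hψ hd hC hτ hf hg
      have hc : 2 * halfConst d * C ≠ 0 := (mul_pos (mul_pos two_pos (halfConst_pos d)) hC).ne'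
      simp only [hSform, tsum_mul_left]
      refine ⟨fun ω => (h1 ω).mul_left _, h2.const_mul _, ?_⟩
      rw [integral_const_mul, ← mul_assoc, ← RCLike.ofReal_mul, mul_inv_cancel₀ hc,
        RCLike.ofReal_one, one_mul, h3]
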